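/- Let $X$ be a real Banach space. Write $B_r(x)$ for open balls, and let $\rho_X(t)=\sup_{\|x\|=1,\ \|y\|=t}\tfrac12(\|x+y\|+\|x-y\|)-1$ be its modulus of smoothness. Let $k\ge 0$ be an integer. A set $S\subset X$ is called $(k,\delta)$-Reifenberg flat (on $B_1(0)$) if $$\inf_{V} d_H\big(S\cap B_r(x),(x+V)\cap B_r(x)\big)\le\delta r\qquad\forall x\in S\cap B_2(0),\ 0<r\le 2,$$ and we set $\beta^k_{S,\infty}(x,r)=\inf_V\{\delta\ge0: S\cap B_r(x)\subset B_{\delta r}(x+V)\}$; both infima are over the $k$-dimensional linear subspaces $V\subset X$ (and are $+\infty$ if there are none), $d_H$ is the Hausdorff distance, and $B_s(A)$ is the open $s$-neighbourhood of $A$. An exponent $\alpha$ is called admissible for $(X,k)$ if one of the following holds: (i) $\alpha=1$; (ii) $X$ is a Hilbert space and $\alpha=2$; (iii) $k=1$, $X$ is uniformly smooth, i.e. $\rho_X(t)/t\to0$ as $t\to0$, and $X$ has smoothness power type $\alpha\in[1,2]$, i.e. $\limsup_{t\to0}t^{-\alpha}\rho_X(t)<\infty$. **Proposition.** There are constants $c(k)>0$,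 $c(k,\rho_X,\alpha)>0$ and, for each $\gamma\in(0,1)$, $\delta_1(k,\rho_X,\gamma)>0$ with $c(k)\,\delta_1<1$, such that the following holds. Let $S\subset X$ be closed and $(k,\delta)$-Reifenberg flat, with $0\in S$ and $0\le\delta\le\delta_1$. Then there are a $k$-dimensional linear subspace $V\subset X$ and a map $\phi:V\to X$ with $\phi=\mathrm{id}$ on $V\setminus B_{3/2}(0)$, with $S\cap B_1(0)=\phi(V)\cap B_1(0)$, and with $$(1-c(k)\delta)\min\{\|x-y\|,\|x-y\|^{1/\gamma}\}\le\|\phi(x)-\phi(y)\|\le(1+c(k)\delta)\max\{\|x-y\|,\|x-y\|^{\gamma}\}\qquad\forall x,y\in V .$$ Moreover, if $\alpha$ is admissible for $(X,k)$, $Q\ge 0$, and $$\int_0^2\beta^k_{S,\infty}(x,r)^\alpha\,\frac{dr}{r}\le Q^\alpha\qquad\forall x\in S,$$ then the same map $\phi$ satisfies $$e^{-c(k,\rho_X,\alpha)Q^\alpha}\|x-y\|\le\|\phi(x)-\phi(y)\|\le e^{c(k,\rho_X,\alpha)Q^\alpha}\|x-y\|\qquad\forall x,y\in V.$$ -/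

import Mathlib

open Set Filter Topology MeasureTheory
open scoped ENNReal NNReal

/-- The modulus of smoothness `ρ_X(t) = sup_{‖x‖ = 1, ‖y‖ = t} (‖x + y‖ + ‖x - y‖) / 2 - 1`.
The set below is bounded above by `t`. -/
noncomputable def modulusOfSmoothness (X : Type*) [NormedAddCommGroup X] (t : ℝ) : ℝ :=
  sSup {s : ℝ | ∃ x y : X, ‖x‖ = 1 ∧ ‖y‖ = t ∧ s = (‖x + y‖ + ‖x - y‖) / 2 - 1}

/-- `X` is uniformly smooth: `ρ_X(t) / t → 0` as `t → 0`. -/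
def IsUniformlySmooth (X : Type*) [NormedAddCommGroup X] : Prop :=
  Tendsto (fun t : ℝ => modulusOfSmoothness X t / t) (𝓝[>] 0) (𝓝 0)

/-- `X` is of smoothness power type `α ∈ [1, 2]`: `limsup_{t → 0} t ^ (-α) * ρ_X(t) < ∞`. -/
def HasSmoothnessPowerType (X : Type*) [NormedAddCommGroup X] (α : ℝ) : Prop :=
  1 ≤ α ∧ α ≤ 2 ∧ modulusOfSmoothness X =O[𝓝[>] 0] fun t : ℝ => t ^ α

/-- The norm of the real normed space `X` comes from an inner product. -/
def IsHilbertNorm (X : Type*) [NormedAddCommGroup X] [inst : NormedSpace ℝ X] : Prop :=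
  ∃ I : InnerProductSpace ℝ X, I.toNormedSpace = inst

/-- The exponents for which the `k`-dimensional summability condition is used: `1` in every Banach
space, `2` in a Hilbert space, and, for `k = 1`, any smoothness power of a uniformly smooth
space. -/
def IsCriticalExponent (X : Type*) [NormedAddCommGroup X] [NormedSpace ℝ X] (k : ℕ) (α : ℝ) :
    Prop :=
  α = 1 ∨ (IsHilbertNorm X ∧ α = 2) ∨
    (k = 1 ∧ IsUniformlySmooth X ∧ HasSmoothnessPowerType X α)

/-- `V` is a `k`-dimensional linear subspace (infinite-dimensional subspaces, whose `finrank` is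
`0`, are excluded). -/
def IsLinearPlane {X : Type*} [NormedAddCommGroup X] [NormedSpace ℝ X] (k : ℕ)
    (V : Submodule ℝ X) : Prop :=
  FiniteDimensional ℝ V ∧ Module.finrank ℝ V = k

/-- The affine plane `x + V`. -/
def translatedPlane {X : Type*} [NormedAddCommGroup X] [NormedSpace ℝ X] (x : X)
    (V : Submodule ℝ X) : Set X :=
  {y : X | y - x ∈ V}

/-- `S` is `(k, δ)`-Reifenberg flat on `B_1(p)`. The infimum is `∞` if `X` has no `k`-dimensional
subspace. -/
def IsReifenbergFlat {X : Type*} [NormedAddCommGroup X] [NormedSpace ℝ X] (k : ℕ) (δ : ℝ)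
    (S : Set X) (p : X) : Prop :=
  ∀ x ∈ S ∩ Metric.ball p 2, ∀ r : ℝ, 0 < r → r ≤ 2 →
    (⨅ (V : Submodule ℝ X) (_ : IsLinearPlane k V),
      Metric.hausdorffEDist (S ∩ Metric.ball x r) (translatedPlane x V ∩ Metric.ball x r))
      ≤ ENNReal.ofReal (δ * r)

/-- `β^k_{S,∞}(x, r)`: the infimum, over `k`-dimensional linear subspaces `V` and `δ ≥ 0`, of the
`δ` such that `S ∩ B_r(x)` lies in the `δ r`-neighbourhood of `x + V`. -/
noncomputable def betaInfty {X : Type*} [NormedAddCommGroup X] [NormedSpace ℝ X] (k : ℕ)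
    (S : Set X) (x : X) (r : ℝ) : ℝ≥0∞ :=
  ⨅ (V : Submodule ℝ X) (_ : IsLinearPlane k V) (δ : ℝ≥0)
    (_ : S ∩ Metric.ball x r ⊆ Metric.thickening (δ * r) (translatedPlane x V)), (δ : ℝ≥0∞)

/-- `∫_0^2 β^k_{S,∞}(x, r)^α dr / r ≤ Q^α` for all `x ∈ S`. -/
def BetaSummable {X : Type*} [NormedAddCommGroup X] [NormedSpace ℝ X] (k : ℕ)
    (S : Set X) (α Q : ℝ) : Prop :=
  ∀ x ∈ S, (∫⁻ r in Ioo (0 : ℝ) 2, betaInfty k S x r ^ α / ENNReal.ofReal r)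
    ≤ ENNReal.ofReal (Q ^ α)

/-!
The map `φ` is the limit of compositions of averaged projections. At every ball `B_r(x)` centred on
`S` a `k`-plane `W x r` spanned by points of `S` is chosen, with a projection `P x r` onto it; the
flatness of the ball is the distance from `S` to this plane, relative to `r` (`FlatSystem`). Since
the planes are spanned by points of `S`, the planes of comparable balls are close to each other, up
to an error bounded by the flatness of the larger ball alone; so every estimate below is in terms of
the one-sided flatness, which is what the beta numbers control. The starting surface is the plane
`W 0 (19/10)`, and the step at the dyadic scale `r_i` replaces a point `y` by the average, over a
partition of unity on an `r_i`-net of `S`, of its projections onto the affine planes at the net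
points (`FlatSystem.step`). By induction the images of the initial plane stay within distance
`O(r_i)` of `S`, are Lipschitz graphs of small slope over the reference planes, and have no holes
(`FlatSystem.Stage`, `FlatSystem.stage_succ`); so their limit covers the part of `S` in the unit
ball and lies in `S` there.

The bounds on `φ` come from the difference vector `u_i` of the images of two points. One step adds
to `u_i` a sum of boundedly many vectors in the kernels of the projections
(`averagedProjection_sub`), and `u_i` itself is almost in their ranges. While `‖u_i‖ ≤ r_i`, both
the added vectors and the angles between `u_i` and the planes are of the order of the flatness `β_i`
at scale `r_i`. Afterwards the added vectors are of relative size `2 ^ (-m) q`, where `m` counts the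
scales since `‖u_i‖` exceeded `r_i` and `q` bounds the flatness, whereas the angles are at
most of order `(m + 1) q`. In any Banach space the relative change of the length is thus at most
`O(β_i)`, respectively `O(2 ^ (-m) q)`. If the kernels of the projections are orthogonal to their
ranges and the norm has smoothness power type `α`, it is at most `O(β_i ^ α)`, respectively
`O(2 ^ (-m) (m + 1) q ^ α)` (`AlmostOrthogonal`, `abs_norm_add_sum_sub_norm_le`). In a Hilbert space
the orthogonal projections have this property with `α = 2`; for `k = 1` the norming functional of a
unit vector of the line gives a projection of norm one, whose kernel is Birkhoff orthogonal to the
line (`exists_orthogonality_constant`).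

Summation over the scales gives `FlatSystem.exists_logClose_limitMap`. With `α = 1` and all flatness
numbers at most `O(δ)`, the logarithmic distortion is `O(δ (1 + log⁺ (1 / ‖x - y‖)))`, which is
the Hölder estimate; its constant does not involve the modulus of smoothness, since no orthogonality
is used for `α = 1`. The integral condition on the beta numbers bounds both `∑ β_i ^ α` along a
point of `S` and the largest flatness number to the power `α` by `O(Q ^ α)`, which is the Lipschitz
estimate.
-/

section

variable {X : Type*} [NormedAddCommGroup X] [NormedSpace ℝ X]

/-! ### Auerbach bases and projections of controlled norm -/

/-- Every finite-dimensional normed space has an Auerbach basis: vectors of norm at most `1` whose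
coordinate functionals also have norm at most `1`. They maximise the determinant over the unit
ball. -/
theorem exists_auerbach_basis (E : Type*) [NormedAddCommGroup E] [NormedSpace ℝ E]
    [FiniteDimensional ℝ E] {k : ℕ} (hk : Module.finrank ℝ E = k) :
    ∃ b : Module.Basis (Fin k) ℝ E, (∀ i, ‖b i‖ ≤ 1) ∧ ∀ x i, |b.coord i x| ≤ ‖x‖ := by
  classical
  let b₀ := Module.finBasisOfFinrankEq ℝ E hk
  have hcont : Continuous fun v : Fin k → E => |b₀.det v| := by
    have h : Continuous fun v : Fin k → E => b₀.det v := by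
      simp only [Module.Basis.det_apply]
      refine Continuous.matrix_det (continuous_pi fun i => continuous_pi fun j => ?_)
      exact (LinearMap.continuous_of_finiteDimensional (b₀.coord i)).comp (continuous_apply j)
    exact h.abs
  have := FiniteDimensional.proper ℝ E
  obtain ⟨e, he, hmax⟩ := (isCompact_closedBall (0 : Fin k → E) 1).exists_isMaxOn
    ⟨0, by simp⟩ hcont.continuousOn
  have hball : ∀ v : Fin k → E, (∀ i, ‖v i‖ ≤ 1) → |b₀.det v| ≤ |b₀.det e| := fun v hv =>
    hmax (by simpa [pi_norm_le_iff_of_nonneg zero_le_one] using hv)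
  have he1 : ∀ i, ‖e i‖ ≤ 1 := by
    simpa [pi_norm_le_iff_of_nonneg zero_le_one] using he
  -- The normalised basis `b₀` shows that the maximum is positive.
  have hdet : b₀.det e ≠ 0 := by
    intro h0
    have h1 := hball (fun i => ‖b₀ i‖⁻¹ • b₀ i) fun i => by
      rw [norm_smul, norm_inv, norm_norm, inv_mul_cancel₀ (norm_ne_zero_iff.2 (b₀.ne_zero i))]
    rw [h0, abs_zero] at h1
    have h2 : b₀.det (fun i => ‖b₀ i‖⁻¹ • b₀ i) = (∏ i, ‖b₀ i‖⁻¹) * b₀.det b₀ :=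
      b₀.det.map_smul_univ _ _
    rw [h2, b₀.det_self, mul_one] at h1
    have h3 : 0 < ∏ i, ‖b₀ i‖⁻¹ :=
      Finset.prod_pos fun i _ => inv_pos.2 (norm_pos_iff.2 (b₀.ne_zero i))
    rw [abs_of_pos h3] at h1
    exact absurd h1 (not_le.2 h3)
  have hbas := (Module.Basis.is_basis_iff_det b₀).2 (isUnit_iff_ne_zero.2 hdet)
  refine ⟨Module.Basis.mk hbas.1 hbas.2.ge, by simpa using he1, fun x i => ?_⟩
  have hle : ∀ y : E, ‖y‖ ≤ 1 → |(Module.Basis.mk hbas.1 hbas.2.ge).coord i y| ≤ 1 := by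
    intro y hy
    have h4 := congrArg (fun f => f y)
      (b₀.det_smul_mk_coord_eq_det_update hbas.1 hbas.2.ge i)
    have h5 : b₀.det e * (Module.Basis.mk hbas.1 hbas.2.ge).coord i y
        = b₀.det (Function.update e i y) := h4
    have h6 := hball (Function.update e i y) fun j => by
      by_cases h : j = i
      · subst h; simpa using hy
      · simpa [h] using he1 j
    rw [← h5, abs_mul] at h6
    exact le_of_mul_le_mul_left (by simpa using h6) (abs_pos.2 hdet)
  rcases eq_or_ne x 0 with rfl | hx
  · rw [map_zero, abs_zero, norm_zero]
  · have h7 := hle (‖x‖⁻¹ • x) (by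
      rw [norm_smul, norm_inv, norm_norm, inv_mul_cancel₀ (norm_ne_zero_iff.2 hx)])
    rw [map_smul, smul_eq_mul, abs_mul, abs_inv, abs_norm] at h7
    have h8 := norm_pos_iff.2 hx
    rwa [inv_mul_le_iff₀ h8, mul_one] at h7

/-- The bounded operator `P` is a linear projection of `X` onto the subspace `V`. -/
structure ProjectsOnto (P : X →L[ℝ] X) (V : Submodule ℝ X) : Prop where
  mem : ∀ x, P x ∈ V
  id : ∀ v ∈ V, P v = v

theorem ProjectsOnto.map_sub_self {P : X →L[ℝ] X} {V : Submodule ℝ X} (h : ProjectsOnto P V)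
    (x : X) : P (x - P x) = 0 := by
  rw [map_sub, h.id _ (h.mem x), sub_self]

theorem norm_sub_apply_le {P : X →L[ℝ] X} {K : ℝ} (hK : ‖P‖ ≤ K) (h1 : 1 ≤ K) (x : X) :
    ‖x - P x‖ ≤ 2 * K * ‖x‖ := by
  have h2 : ‖P x‖ ≤ K * ‖x‖ := P.le_of_opNorm_le hK x
  have h3 := norm_sub_le x (P x)
  nlinarith [norm_nonneg x]

/-- Only the part of `x` outside of the plane contributes to `x - P x`. -/
theorem ProjectsOnto.norm_sub_apply_le_of_mem {P : X →L[ℝ] X} {V : Submodule ℝ X}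
    (h : ProjectsOnto P V) {K : ℝ} (hK : ‖P‖ ≤ K) (h1 : 1 ≤ K) (x : X) {v : X} (hv : v ∈ V) :
    ‖x - P x‖ ≤ 2 * K * ‖x - v‖ := by
  have : x - P x = (x - v) - P (x - v) := by rw [map_sub, h.id v hv]; abel
  rw [this]
  exact norm_sub_apply_le hK h1 _

/-- A basis of a `k`-plane with coordinates bounded by the norm. -/
theorem IsLinearPlane.exists_auerbach {k : ℕ} {V : Submodule ℝ X} (hV : IsLinearPlane k V) :
    ∃ e : Fin k → X, (∀ i, e i ∈ V) ∧ (∀ i, ‖e i‖ ≤ 1) ∧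
      (∀ v ∈ V, ∃ a : Fin k → ℝ, v = ∑ i, a i • e i) ∧
      ∀ a : Fin k → ℝ, ∀ i, |a i| ≤ ‖∑ j, a j • e j‖ := by
  have := hV.1
  obtain ⟨b, hb1, hb2⟩ := exists_auerbach_basis V hV.2
  refine ⟨fun i => b i, fun i => (b i).2, hb1, fun v hv => ⟨fun i => b.coord i ⟨v, hv⟩, ?_⟩,
    fun a i => ?_⟩
  · have h : ((∑ i, b.repr ⟨v, hv⟩ i • b i : V) : X) = v := by rw [b.sum_repr]
    rw [Submodule.coe_sum] at h
    exact h.symm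
  · have := hb2 (∑ j, a j • b j) i
    simpa [Finsupp.single_apply] using this

/-- A projection onto a `k`-plane of norm at most `k`. -/
theorem IsLinearPlane.exists_projection {k : ℕ} {V : Submodule ℝ X} (hV : IsLinearPlane k V) :
    ∃ P : X →L[ℝ] X, ProjectsOnto P V ∧ ‖P‖ ≤ k := by
  have := hV.1
  obtain ⟨b, hb1, hb2⟩ := exists_auerbach_basis V hV.2
  have hf : ∀ i, ∃ g : X →L[ℝ] ℝ, (∀ v : V, g v = b.coord i v) ∧ ‖g‖ ≤ 1 := by
    intro i
    let f : V →L[ℝ] ℝ := (b.coord i).mkContinuous 1 (by simpa using fun x h => hb2 ⟨x, h⟩ i)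
    obtain ⟨g, hg1, hg2⟩ := exists_extension_norm_eq V f
    exact ⟨g, hg1, hg2.le.trans (LinearMap.mkContinuous_norm_le _ zero_le_one _)⟩
  choose g hg1 hg2 using hf
  have happ : ∀ x, (∑ i, (g i).smulRight ((b i : V) : X)) x = ∑ i, g i x • ((b i : V) : X) := by
    intro x; simp
  refine ⟨∑ i, (g i).smulRight ((b i : V) : X), ⟨fun x => ?_, fun v hv => ?_⟩, ?_⟩
  · rw [happ]
    exact V.sum_mem fun i _ => V.smul_mem _ (b i).2
  · rw [happ]
    have h : ((∑ i, b.repr ⟨v, hv⟩ i • b i : V) : X) = v := by rw [b.sum_repr]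
    rw [Submodule.coe_sum] at h
    simp only [fun i => hg1 i ⟨v, hv⟩, Module.Basis.coord_apply]
    exact h
  · calc ‖∑ i, (g i).smulRight ((b i : V) : X)‖ ≤ ∑ i : Fin k, (1 : ℝ) := by
          refine norm_sum_le_of_le _ fun i _ => ?_
          rw [ContinuousLinearMap.norm_smulRight_apply]
          have h1 : ‖((b i : V) : X)‖ ≤ 1 := hb1 i
          exact mul_le_one₀ (hg2 i) (norm_nonneg _) h1
      _ = k := by simp

/-- Two planes of the same dimension: if `W` is close to `W'`, then `W'` is close to `W`, because
the projection onto `W'` is injective, hence surjective, on `W`. -/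
theorem exists_apply_eq_of_close {k : ℕ} {W W' : Submodule ℝ X} (hW : IsLinearPlane k W)
    (hW' : IsLinearPlane k W') {P' : X →L[ℝ] X} (hP' : ProjectsOnto P' W') {η : ℝ}
    (hη : η ≤ 1 / 2) (h : ∀ w ∈ W, ‖w - P' w‖ ≤ η * ‖w‖) {w' : X} (hw' : w' ∈ W') :
    ∃ w ∈ W, P' w = w' ∧ ‖w‖ ≤ 2 * ‖w'‖ := by
  have := hW.1
  have := hW'.1
  let f : W →ₗ[ℝ] W' :=
    { toFun := fun w => ⟨P' w, hP'.mem w⟩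
      map_add' := fun x y => by ext; simp
      map_smul' := fun c x => by ext; simp }
  have hlow : ∀ w ∈ W, ‖w‖ ≤ 2 * ‖P' w‖ := by
    intro w hw
    have h1 := h w hw
    have h2 : ‖w‖ ≤ ‖w - P' w‖ + ‖P' w‖ := by simpa using norm_add_le (w - P' w) (P' w)
    nlinarith [norm_nonneg w]
  have hinj : Function.Injective f := by
    rw [← LinearMap.ker_eq_bot, LinearMap.ker_eq_bot']
    intro w hw
    have h1 : P' (w : X) = 0 := congrArg Subtype.val hw
    have h2 := hlow w w.2
    rw [h1, norm_zero, mul_zero] at h2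
    exact Subtype.ext (norm_le_zero_iff.1 h2)
  have hsurj : Function.Surjective f :=
    (LinearMap.injective_iff_surjective_of_finrank_eq_finrank (hW.2.trans hW'.2.symm)).1 hinj
  obtain ⟨w, hw⟩ := hsurj ⟨w', hw'⟩
  have h3 : P' (w : X) = w' := congrArg Subtype.val hw
  exact ⟨w, w.2, h3, by rw [← h3]; exact hlow w w.2⟩

/-! ### Packing -/

/-- A separated set in a ball of a finite-dimensional normed space has boundedly many points. -/
theorem card_le_of_separated_of_norm_le (E : Type*) [NormedAddCommGroup E] [NormedSpace ℝ E]
    [FiniteDimensional ℝ E] {δ ρ : ℝ} (hδ : 0 < δ) (hρ : 0 ≤ ρ) (s : Finset E)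
    (hs : ∀ c ∈ s, ‖c‖ ≤ ρ) (h : ∀ c ∈ s, ∀ d ∈ s, c ≠ d → 2 * δ ≤ ‖c - d‖) :
    (s.card : ℝ) ≤ ((ρ + δ) / δ) ^ Module.finrank ℝ E := by
  borelize E
  let μ : Measure E := Measure.addHaar
  have hpos : 0 < ρ + δ := by linarith
  have D : Set.Pairwise (s : Set E) (Function.onFun Disjoint fun c => Metric.ball (c : E) δ) := by
    rintro c hc d hd hcd
    apply Metric.ball_disjoint_ball
    rw [dist_eq_norm]
    linarith [h c hc d hd hcd]
  have I : (s.card : ℝ≥0∞) * ENNReal.ofReal (δ ^ Module.finrank ℝ E) * μ (Metric.ball 0 1) ≤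
      ENNReal.ofReal ((ρ + δ) ^ Module.finrank ℝ E) * μ (Metric.ball 0 1) :=
    calc
      _ = μ (⋃ c ∈ s, Metric.ball (c : E) δ) := by
        rw [measure_biUnion_finset D fun c _ => measurableSet_ball]
        simp only [μ.addHaar_ball_of_pos _ hδ, Finset.sum_const, nsmul_eq_mul, mul_assoc]
      _ ≤ μ (Metric.ball (0 : E) (ρ + δ)) := by
        refine measure_mono (iUnion₂_subset fun x hx => Metric.ball_subset_ball' ?_)
        rw [dist_zero_right]
        linarith [hs x hx]
      _ = _ := by simp only [μ.addHaar_ball_of_pos _ hpos]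
  have J : (s.card : ℝ≥0∞) * ENNReal.ofReal (δ ^ Module.finrank ℝ E) ≤
      ENNReal.ofReal ((ρ + δ) ^ Module.finrank ℝ E) :=
    (ENNReal.mul_le_mul_iff_left (Metric.measure_ball_pos _ _ zero_lt_one).ne'
      measure_ball_lt_top.ne).1 I
  have L := ENNReal.toReal_le_of_le_ofReal (pow_nonneg hpos.le _) J
  rw [ENNReal.toReal_mul, ENNReal.toReal_ofReal (pow_nonneg hδ.le _)] at L
  rw [div_pow, le_div_iff₀ (pow_pos hδ _)]
  simpa using L

/-- The same packing bound for points lying near a `k`-plane. -/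
theorem card_le_of_separated_near_plane {k : ℕ} {W : Submodule ℝ X} (hW : IsLinearPlane k W)
    {P : X →L[ℝ] X} (hP : ProjectsOnto P W) {r ρ : ℝ} (hr : 0 < r) (hρ : 0 ≤ ρ) (x : X)
    (s : Finset X) (hs : ∀ a ∈ s, ‖a - x‖ ≤ ρ) (hflat : ∀ a ∈ s, ‖(a - x) - P (a - x)‖ ≤ r / 4)
    (hsep : ∀ a ∈ s, ∀ b ∈ s, a ≠ b → r ≤ ‖a - b‖) :
    (s.card : ℝ) ≤ ((ρ + r / 2) / (r / 4)) ^ k := by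
  classical
  have := hW.1
  let f : X → W := fun a => ⟨P (a - x), hP.mem _⟩
  have hf : ∀ a ∈ s, ∀ b ∈ s, a ≠ b → 2 * (r / 4) ≤ ‖f a - f b‖ := by
    intro a ha b hb hab
    have h1 : a - b = ((a - x) - P (a - x)) - ((b - x) - P (b - x)) + (P (a - x) - P (b - x)) := by
      abel
    have h2 := norm_add_le (((a - x) - P (a - x)) - ((b - x) - P (b - x))) (P (a - x) - P (b - x))
    rw [← h1] at h2
    have h3 := norm_sub_le ((a - x) - P (a - x)) ((b - x) - P (b - x))
    have h4 : ‖f a - f b‖ = ‖P (a - x) - P (b - x)‖ := rfl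
    linarith [hflat a ha, hflat b hb, hsep a ha b hb hab]
  have hinj : Set.InjOn f s := by
    intro a ha b hb hab
    by_contra hne
    have := hf a ha b hb hne
    rw [hab, sub_self, norm_zero] at this
    linarith
  have h := card_le_of_separated_of_norm_le W (δ := r / 4) (ρ := ρ + r / 4) (by positivity)
    (by positivity) (s.image f) ?_ ?_
  · rw [Finset.card_image_of_injOn hinj, hW.2] at h
    convert h using 3
    ring
  · intro c hc
    obtain ⟨a, ha, rfl⟩ := Finset.mem_image.1 hc
    have h4 : ‖f a‖ = ‖P (a - x)‖ := rfl
    have h5 := norm_sub_le (a - x) ((a - x) - P (a - x))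
    rw [sub_sub_cancel] at h5
    linarith [hs a ha, hflat a ha]
  · intro c hc d hd hcd
    obtain ⟨a, ha, rfl⟩ := Finset.mem_image.1 hc
    obtain ⟨b, hb, rfl⟩ := Finset.mem_image.1 hd
    exact hf a ha b hb fun h => hcd (by rw [h])

/-! ### Almost orthogonal perturbations -/

/-- The kernel of the projection `P` is orthogonal to its range up to errors of order `α`: if `u`
makes a relative angle at most `a` with the range of `P` and `D ∈ ker P` has relative size `b ≤ a`,
then adding `D` to `u` changes the norm by a relative amount of order `b * a ^ (α - 1)` only. -/
def AlmostOrthogonal (α C : ℝ) (P : X →L[ℝ] X) : Prop :=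
  ∀ u D : X, ∀ a b : ℝ, P D = 0 → 0 ≤ b → b ≤ a → ‖u - P u‖ ≤ a * ‖u‖ → ‖D‖ ≤ b * ‖u‖ →
    |‖u + D‖ - ‖u‖| ≤ C * b * a ^ (α - 1) * ‖u‖

theorem abs_norm_add_sub_norm_le {Y : Type*} [NormedAddCommGroup Y] (u D : Y) :
    |‖u + D‖ - ‖u‖| ≤ ‖D‖ := by
  simpa using abs_norm_sub_norm_le (u + D) u

theorem almostOrthogonal_one {C : ℝ} (hC : 1 ≤ C) (P : X →L[ℝ] X) : AlmostOrthogonal 1 C P := by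
  intro u D a b _ hb _ _ hD
  refine (abs_norm_add_sub_norm_le u D).trans ?_
  rw [sub_self, Real.rpow_zero, mul_one]
  have := mul_nonneg hb (norm_nonneg u)
  nlinarith

/-- If adding elements `w` of the kernel to vectors `v` in the range does not decrease the norm and
increases it by `O(‖w‖ ^ α)`, then the kernel is almost orthogonal to the range. The factor `b`
is gained from the convexity of `t ↦ ‖u + t • D‖`, whose increments over the longer interval of
length `a / b` are already of order `a ^ α`. -/
theorem AlmostOrthogonal.of_le_norm_add {P : X →L[ℝ] X} {V : Submodule ℝ X}
    (hP : ProjectsOnto P V) {α C : ℝ} (hα : 1 ≤ α) (hα2 : α ≤ 2) (hC : 0 ≤ C)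
    (h : ∀ v ∈ V, ∀ w, P w = 0 → ‖w‖ ≤ ‖v‖ →
      ‖v‖ ≤ ‖v + w‖ ∧ ‖v + w‖ ≤ ‖v‖ + C * ‖v‖ * (‖w‖ / ‖v‖) ^ α) :
    AlmostOrthogonal α (8 * C + 4) P := by
  intro u D a b hD hb hba hu hDb
  have hCu : 0 ≤ C * ‖u‖ := by positivity
  have ha : 0 ≤ a := hb.trans hba
  have hpa : 0 ≤ a ^ (α - 1) := Real.rpow_nonneg ha _
  have hprod : 0 ≤ b * a ^ (α - 1) * ‖u‖ := by positivity
  rcases le_or_gt (1 / 4) a with ha4 | ha4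
  · refine (abs_norm_add_sub_norm_le u D).trans (hDb.trans ?_)
    have h1 : (1 / 4 : ℝ) ≤ a ^ (α - 1) := by
      calc (1 / 4 : ℝ) = (1 / 4 : ℝ) ^ (1 : ℝ) := by rw [Real.rpow_one]
        _ ≤ (1 / 4 : ℝ) ^ (α - 1) :=
          Real.rpow_le_rpow_of_exponent_ge (by norm_num) (by norm_num) (by linarith)
        _ ≤ a ^ (α - 1) := Real.rpow_le_rpow (by norm_num) ha4 (by linarith)
    have h2 : b * ‖u‖ * (1 / 4) ≤ b * ‖u‖ * a ^ (α - 1) :=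
      mul_le_mul_of_nonneg_left h1 (by positivity)
    nlinarith [mul_nonneg hC hprod]
  rcases hb.eq_or_lt with rfl | hb
  · have hD0 : D = 0 := by simpa using hDb
    simp [hD0]
  have ha : 0 < a := hb.trans_le hba
  rcases (norm_nonneg u).eq_or_lt with hu0 | hu0
  · have hD0 : D = 0 := by rw [← hu0] at hDb; simpa using hDb
    simp [hD0, ← hu0]
  have hv : ‖u‖ ≤ ‖P u‖ + ‖u - P u‖ := by simpa using norm_add_le (P u) (u - P u)
  have hv' : 3 / 4 * ‖u‖ ≤ ‖P u‖ := by nlinarith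
  have hv0 : 0 < ‖P u‖ := by linarith
  -- All vectors `u + D'` with `D' ∈ ker P` of size at most `a * ‖u‖` have almost the same norm.
  have key : ∀ D', P D' = 0 → ‖D'‖ ≤ a * ‖u‖ →
      ‖P u‖ ≤ ‖u + D'‖ ∧ ‖u + D'‖ ≤ ‖P u‖ + 8 * C * ‖P u‖ * a ^ α := by
    intro D' hD' hD'a
    have h1 : ‖(u - P u) + D'‖ ≤ 8 / 3 * a * ‖P u‖ := by
      have := norm_add_le (u - P u) D'
      nlinarith
    have h2 := h (P u) (hP.mem u) ((u - P u) + D') (by rw [map_add, hP.map_sub_self, hD', add_zero])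
      (by nlinarith)
    have h3 : P u + ((u - P u) + D') = u + D' := by abel
    rw [h3] at h2
    refine ⟨h2.1, h2.2.trans ?_⟩
    have h4 : (‖(u - P u) + D'‖ / ‖P u‖) ^ α ≤ 8 * a ^ α := by
      calc (‖(u - P u) + D'‖ / ‖P u‖) ^ α ≤ (8 / 3 * a) ^ α :=
            Real.rpow_le_rpow (by positivity) ((div_le_iff₀ hv0).2 h1) (by linarith)
        _ = (8 / 3 : ℝ) ^ α * a ^ α := Real.mul_rpow (by norm_num) ha.le
        _ ≤ (8 / 3 : ℝ) ^ (2 : ℝ) * a ^ α := by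
            gcongr
            norm_num
        _ ≤ 8 * a ^ α := by
            have : (8 / 3 : ℝ) ^ (2 : ℝ) ≤ 8 := by rw [Real.rpow_two]; norm_num
            gcongr
    have h5 : C * ‖P u‖ * (‖(u - P u) + D'‖ / ‖P u‖) ^ α ≤ C * ‖P u‖ * (8 * a ^ α) := by gcongr
    linarith
  have hvu : ‖P u‖ ≤ ‖u‖ := by simpa using (key 0 (by simp) (by simp; positivity)).1
  have hpow : a ^ α = a * a ^ (α - 1) := by
    rw [Real.rpow_sub_one ha.ne', mul_div_cancel₀ _ ha.ne']
  have hTD : ‖(a / b) • D‖ ≤ a * ‖u‖ := by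
    rw [norm_smul, Real.norm_of_nonneg (by positivity)]
    calc a / b * ‖D‖ ≤ a / b * (b * ‖u‖) := by gcongr
      _ = a * ‖u‖ := by field_simp
  have hX : 8 * C * ‖P u‖ * a ^ α ≤ 8 * C * ‖u‖ * a ^ α := by gcongr
  rw [abs_le]
  constructor
  · have h1 := (key (-((a / b) • D)) (by rw [map_neg, map_smul, hD]; simp)
      (by rw [norm_neg]; exact hTD)).2
    have h2 : (a + b) • u = a • (u + D) + b • (u + -((a / b) • D)) := by
      rw [smul_add, smul_add, smul_neg, smul_smul, mul_div_cancel₀ _ hb.ne', add_smul]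
      abel
    have h3 := norm_add_le (a • (u + D)) (b • (u + -((a / b) • D)))
    rw [← h2, norm_smul, norm_smul, norm_smul, Real.norm_of_nonneg ha.le,
      Real.norm_of_nonneg hb.le, Real.norm_of_nonneg (by positivity)] at h3
    have h4 : b * ‖u + -((a / b) • D)‖ ≤ b * (‖u‖ + 8 * C * ‖u‖ * a ^ α) := by
      gcongr
      linarith
    have h5 : a * (‖u‖ - ‖u + D‖) ≤ a * (8 * C * b * a ^ (α - 1) * ‖u‖) := by
      rw [hpow] at h4
      nlinarith
    have h6 := le_of_mul_le_mul_left h5 ha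
    linarith
  · have h1 := (key ((a / b) • D) (by rw [map_smul, hD]; simp) hTD).2
    have h2 : a • (u + D) = (a - b) • u + b • (u + (a / b) • D) := by
      rw [smul_add, smul_add, smul_smul, mul_div_cancel₀ _ hb.ne', sub_smul]
      abel
    have h3 := norm_add_le ((a - b) • u) (b • (u + (a / b) • D))
    rw [← h2, norm_smul, norm_smul, norm_smul, Real.norm_of_nonneg ha.le,
      Real.norm_of_nonneg hb.le, Real.norm_of_nonneg (by linarith)] at h3
    have h4 : b * ‖u + (a / b) • D‖ ≤ b * (‖u‖ + 8 * C * ‖u‖ * a ^ α) := by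
      gcongr
      linarith
    have h5 : a * (‖u + D‖ - ‖u‖) ≤ a * (8 * C * b * a ^ (α - 1) * ‖u‖) := by
      rw [hpow] at h4
      nlinarith
    have h6 := le_of_mul_le_mul_left h5 ha
    linarith

/-- Adding finitely many vectors, each in the kernel of its own almost orthogonal projection. -/
theorem abs_norm_add_sum_sub_norm_le {ι : Type*} (G : Finset ι) (E : ι → X) (P : ι → X →L[ℝ] X)
    {α C K n a b : ℝ} (hα2 : α ≤ 2) (hC : 0 ≤ C) (hK : 1 ≤ K) (hn : 1 ≤ n)
    (hcard : (G.card : ℝ) ≤ n) (hP : ∀ i ∈ G, ‖P i‖ ≤ K) (hAO : ∀ i ∈ G, AlmostOrthogonal α C (P i))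
    (hE : ∀ i ∈ G, P i (E i) = 0) (u : X) (hb : 0 ≤ b) (hba : b ≤ a) (hnb : n * b ≤ 1 / 4)
    (hEb : ∀ i ∈ G, ‖E i‖ ≤ b * ‖u‖) (hu : ∀ i ∈ G, ‖u - P i u‖ ≤ a * ‖u‖) :
    |‖u + ∑ i ∈ G, E i‖ - ‖u‖| ≤ 7 * C * K * n ^ 2 * b * a ^ (α - 1) * ‖u‖ := by
  classical
  have ha : 0 ≤ a := hb.trans hba
  have hpa : 0 ≤ a ^ (α - 1) := Real.rpow_nonneg ha _
  have hKn : 1 ≤ K * n := by nlinarith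
  have hpow : (4 * (K * n) * a) ^ (α - 1) ≤ 4 * (K * n) * a ^ (α - 1) := by
    rw [Real.mul_rpow (by positivity) ha]
    gcongr
    calc (4 * (K * n)) ^ (α - 1) ≤ (4 * (K * n)) ^ (1 : ℝ) :=
          Real.rpow_le_rpow_of_exponent_le (by linarith) (by linarith)
      _ = 4 * (K * n) := Real.rpow_one _
  have hsum : ∀ s ⊆ G, ‖∑ i ∈ s, E i‖ ≤ n * b * ‖u‖ := by
    intro s hs
    calc ‖∑ i ∈ s, E i‖ ≤ ∑ i ∈ s, b * ‖u‖ := norm_sum_le_of_le _ fun i hi => hEb i (hs hi)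
      _ = s.card * (b * ‖u‖) := by simp
      _ ≤ n * (b * ‖u‖) := by
        have : (s.card : ℝ) ≤ n := le_trans (by exact_mod_cast Finset.card_le_card hs) hcard
        gcongr
      _ = n * b * ‖u‖ := by ring
  have main : ∀ s ⊆ G, |‖u + ∑ i ∈ s, E i‖ - ‖u‖| ≤
      s.card * (7 * C * (K * n) * b * a ^ (α - 1) * ‖u‖) := by
    intro s
    induction s using Finset.induction_on with
    | empty => intro _; simp
    | insert i s hi ih =>
      intro hs
      have hiG : i ∈ G := hs (Finset.mem_insert_self i s)
      have hsG : s ⊆ G := fun j hj => hs (Finset.mem_insert_of_mem hj)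
      have h1 := ih hsG
      set u' := u + ∑ i ∈ s, E i with hu'
      have h2 : u + ∑ i ∈ insert i s, E i = u' + E i := by
        rw [Finset.sum_insert hi, hu']; abel
      have hs1 := hsum s hsG
      have hs2 : n * b * ‖u‖ ≤ 1 / 4 * ‖u‖ := by gcongr
      have h3 := abs_norm_add_sub_norm_le u (∑ i ∈ s, E i)
      rw [← hu', abs_le] at h3
      have h4 : ‖u‖ ≤ 4 / 3 * ‖u'‖ := by linarith
      have h5 : ‖u'‖ ≤ 5 / 4 * ‖u‖ := by linarith
      have h6 : ‖u' - P i u'‖ ≤ 4 * (K * n) * a * ‖u'‖ := by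
        have e1 : u' - P i u' = (u - P i u) + (∑ i ∈ s, E i - P i (∑ i ∈ s, E i)) := by
          rw [hu', map_add]; abel
        have e2 := norm_add_le (u - P i u) (∑ i ∈ s, E i - P i (∑ i ∈ s, E i))
        rw [← e1] at e2
        have e3 := norm_sub_apply_le (hP i hiG) hK (∑ i ∈ s, E i)
        have e4 : 2 * K * ‖∑ i ∈ s, E i‖ ≤ 2 * K * (n * a * ‖u‖) := by
          gcongr
          exact hs1.trans (by gcongr)
        have e5 : a * ‖u‖ ≤ (K * n) * (a * ‖u‖) := le_mul_of_one_le_left (by positivity) hKn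
        have e6 : 3 * (K * n) * a * ‖u‖ ≤ 3 * (K * n) * a * (4 / 3 * ‖u'‖) := by gcongr
        linarith [hu i hiG]
      have h7 : ‖E i‖ ≤ 4 / 3 * b * ‖u'‖ := by
        have := hEb i hiG
        have e : b * ‖u‖ ≤ b * (4 / 3 * ‖u'‖) := by gcongr
        linarith
      have h8 := hAO i hiG u' (E i) (4 * (K * n) * a) (4 / 3 * b) (hE i hiG) (by positivity)
        (by nlinarith) h6 h7
      have h9 : C * (4 / 3 * b) * (4 * (K * n) * a) ^ (α - 1) * ‖u'‖ ≤
          C * (4 / 3 * b) * (4 * (K * n) * a ^ (α - 1)) * (5 / 4 * ‖u‖) := by gcongr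
      have h10 : 0 ≤ C * (K * n) * b * a ^ (α - 1) * ‖u‖ := by positivity
      rw [h2, Finset.card_insert_of_notMem hi]
      push_cast
      rw [abs_le] at h1 h8 ⊢
      constructor <;> linarith [h1.1, h1.2, h8.1, h8.2]
  refine (main G subset_rfl).trans ?_
  have : 0 ≤ 7 * C * (K * n) * b * a ^ (α - 1) * ‖u‖ := by positivity
  calc (G.card : ℝ) * (7 * C * (K * n) * b * a ^ (α - 1) * ‖u‖)
      ≤ n * (7 * C * (K * n) * b * a ^ (α - 1) * ‖u‖) := by gcongr
    _ = _ := by ring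

/-! ### Projections adapted to the critical exponents -/

/-- A power type bound for `ρ` near `0` extends to `(0, 1]` for quantities that are at most `t`. -/
theorem exists_power_bound {ρ : ℝ → ℝ} {α : ℝ} (hα : 0 ≤ α)
    (h : ρ =O[𝓝[>] 0] fun t : ℝ => t ^ α) :
    ∃ C : ℝ, 0 < C ∧ ∀ t s : ℝ, 0 < t → t ≤ 1 → s ≤ t → s ≤ ρ t → s ≤ C * t ^ α := by
  obtain ⟨c, hc, hcb⟩ := h.exists_pos
  rw [Asymptotics.isBigOWith_iff] at hcb
  obtain ⟨t₀, ht₀, hsub⟩ := mem_nhdsGT_iff_exists_Ioo_subset.1 hcb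
  have ht₀ : 0 < t₀ := ht₀
  have hp : 0 < t₀ ^ α := Real.rpow_pos_of_pos ht₀ α
  refine ⟨c + (t₀ ^ α)⁻¹, by positivity, fun t s ht ht1 hst hsρ => ?_⟩
  have htp : 0 ≤ t ^ α := Real.rpow_nonneg ht.le α
  rcases lt_or_ge t t₀ with h1 | h1
  · have h2 : ‖ρ t‖ ≤ c * ‖t ^ α‖ := hsub ⟨ht, h1⟩
    rw [Real.norm_of_nonneg htp] at h2
    have h3 := (le_abs_self (ρ t)).trans h2
    have : 0 ≤ (t₀ ^ α)⁻¹ * t ^ α := by positivity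
    linarith
  · have h2 : t₀ ^ α ≤ t ^ α := Real.rpow_le_rpow ht₀.le h1 hα
    have h3 : 1 ≤ (t₀ ^ α)⁻¹ * t ^ α := by
      rw [inv_mul_eq_div]
      exact (one_le_div hp).2 h2
    have : 0 ≤ c * t ^ α := by positivity
    linarith

theorem le_modulusOfSmoothness {Y : Type*} [NormedAddCommGroup Y] {x y : Y} (hx : ‖x‖ = 1) :
    (‖x + y‖ + ‖x - y‖) / 2 - 1 ≤ modulusOfSmoothness Y ‖y‖ := by
  refine le_csSup ⟨‖y‖, ?_⟩ ⟨x, y, hx, rfl, rfl⟩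
  rintro s ⟨x', y', hx', hy', rfl⟩
  linarith [norm_add_le x' y', norm_sub_le x' y']

/-- A projection of norm at most `1` in a space with a modulus of smoothness of power type. -/
theorem AlmostOrthogonal.of_norm_le_one {P : X →L[ℝ] X} {V : Submodule ℝ X}
    (hP : ProjectsOnto P V) (hP1 : ‖P‖ ≤ 1) {α C : ℝ} (hα : 1 ≤ α) (hα2 : α ≤ 2) (hC : 0 ≤ C)
    (h : ∀ t s : ℝ, 0 < t → t ≤ 1 → s ≤ t → s ≤ modulusOfSmoothness X t → s ≤ C * t ^ α) :
    AlmostOrthogonal α (8 * (2 * C) + 4) P := by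
  refine .of_le_norm_add hP hα hα2 (by positivity) fun v hv w hw hwv => ?_
  have hle : ∀ w, P w = 0 → ‖v‖ ≤ ‖v + w‖ := by
    intro w hw
    have h1 : P (v + w) = v := by rw [map_add, hw, add_zero, hP.id v hv]
    calc ‖v‖ = ‖P (v + w)‖ := by rw [h1]
      _ ≤ 1 * ‖v + w‖ := P.le_of_opNorm_le hP1 _
      _ = ‖v + w‖ := one_mul _
  refine ⟨hle w hw, ?_⟩
  rcases (norm_nonneg w).eq_or_lt with hw0 | hw0
  · have : w = 0 := norm_eq_zero.1 hw0.symm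
    subst this
    have : 0 ≤ 2 * C * ‖v‖ * (‖(0 : X)‖ / ‖v‖) ^ α := by positivity
    rw [add_zero]
    linarith
  have hv0 : 0 < ‖v‖ := hw0.trans_le hwv
  have hnorm : ∀ z : X, ‖‖v‖⁻¹ • z‖ = ‖z‖ / ‖v‖ := fun z => by
    rw [norm_smul, norm_inv, norm_norm, inv_mul_eq_div]
  have hx : ‖‖v‖⁻¹ • v‖ = 1 := by rw [hnorm, div_self hv0.ne']
  have h1 := le_modulusOfSmoothness (y := ‖v‖⁻¹ • w) hx
  rw [← smul_add, ← smul_sub, hnorm, hnorm, hnorm] at h1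
  have h2 : (‖v + w‖ / ‖v‖ + ‖v - w‖ / ‖v‖) / 2 - 1 ≤ ‖w‖ / ‖v‖ := by
    rw [← add_div, div_div, sub_le_iff_le_add, div_le_iff₀ (by positivity)]
    have : (‖w‖ / ‖v‖ + 1) * (‖v‖ * 2) = 2 * ‖w‖ + 2 * ‖v‖ := by field_simp
    rw [this]
    linarith [norm_add_le v w, norm_sub_le v w]
  have h3 := h _ _ (by positivity) ((div_le_one hv0).2 hwv) h2 h1
  have h4 : ‖v‖ ≤ ‖v - w‖ := by
    simpa [sub_eq_add_neg] using hle (-w) (by rw [map_neg, hw, neg_zero])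
  have h5 : 1 ≤ ‖v - w‖ / ‖v‖ := (one_le_div hv0).2 h4
  have h6 : ‖v + w‖ / ‖v‖ ≤ 1 + 2 * (C * (‖w‖ / ‖v‖) ^ α) := by linarith
  rw [div_le_iff₀ hv0] at h6
  linarith

/-- In a Hilbert space the orthogonal projections are almost orthogonal with exponent `2`. -/
theorem IsHilbertNorm.exists_projection (hX : IsHilbertNorm X) {k : ℕ} {V : Submodule ℝ X}
    (hV : IsLinearPlane k V) :
    ∃ P : X →L[ℝ] X, ProjectsOnto P V ∧ ‖P‖ ≤ 1 ∧ AlmostOrthogonal 2 12 P := by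
  rename_i _ inst
  obtain ⟨I, rfl⟩ := hX
  have := hV.1
  have hP : ProjectsOnto V.starProjection V :=
    ⟨fun x => V.starProjection_apply_mem x, fun v hv => V.starProjection_eq_self_iff.2 hv⟩
  refine ⟨V.starProjection, hP, V.starProjection_norm_le, ?_⟩
  have := AlmostOrthogonal.of_le_norm_add hP (α := 2) (C := 1) one_le_two le_rfl zero_le_one ?_
  · convert this using 1; norm_num
  intro v hv w hw hwv
  have hort : inner ℝ v w = 0 := by
    have : w ∈ Vᗮ := by rwa [Submodule.starProjection_apply_eq_zero_iff] at hw
    exact (Submodule.mem_orthogonal V w).1 this v hv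
  have hpy := norm_add_sq_eq_norm_sq_add_norm_sq_real hort
  constructor
  · nlinarith [norm_nonneg v, norm_nonneg (v + w), mul_self_nonneg ‖w‖]
  · rcases (norm_nonneg v).eq_or_lt with hv0 | hv0
    · have h0 : ‖w‖ = 0 := le_antisymm (hwv.trans hv0.symm.le) (norm_nonneg w)
      have hvz : v = 0 := norm_eq_zero.1 hv0.symm
      have hwz : w = 0 := norm_eq_zero.1 h0
      simp [hvz, hwz]
    · rw [Real.rpow_two]
      have h1 : 1 * ‖v‖ * (‖w‖ / ‖v‖) ^ 2 = ‖w‖ ^ 2 / ‖v‖ := by field_simp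
      rw [h1]
      refine abs_le_of_sq_le_sq' ?_ (by positivity) |>.2
      have h2 : (‖v‖ + ‖w‖ ^ 2 / ‖v‖) ^ 2 = ‖v‖ ^ 2 + 2 * ‖w‖ ^ 2 + (‖w‖ ^ 2 / ‖v‖) ^ 2 := by
        field_simp
        ring
      nlinarith [sq_nonneg (‖w‖ ^ 2 / ‖v‖), sq_nonneg ‖w‖]

/-- For every plane there is a projection that is almost orthogonal for all critical exponents
simultaneously: the orthogonal one in a Hilbert space, and otherwise one coming from an Auerbach
basis, which has norm `1` on lines. -/
theorem exists_orthogonality_constant (ρ : ℝ → ℝ) : ∃ C : ℝ → ℝ, (∀ α, 0 < C α) ∧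
    ∀ (X : Type*) [NormedAddCommGroup X] [NormedSpace ℝ X],
      (∀ t : ℝ, 0 ≤ t → modulusOfSmoothness X t = ρ t) →
      ∀ (k : ℕ) (V : Submodule ℝ X), IsLinearPlane k V → ∃ P : X →L[ℝ] X,
        ProjectsOnto P V ∧ ‖P‖ ≤ max 1 (k : ℝ) ∧
        ∀ α, IsCriticalExponent X k α → AlmostOrthogonal α (C α) P := by
  classical
  have hex : ∀ α : ℝ, ∃ C : ℝ, 0 < C ∧ ((0 ≤ α ∧ ρ =O[𝓝[>] 0] fun t : ℝ => t ^ α) →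
      ∀ t s : ℝ, 0 < t → t ≤ 1 → s ≤ t → s ≤ ρ t → s ≤ C * t ^ α) := by
    intro α
    by_cases h : 0 ≤ α ∧ ρ =O[𝓝[>] 0] fun t : ℝ => t ^ α
    · obtain ⟨C, hC, h'⟩ := exists_power_bound h.1 h.2
      exact ⟨C, hC, fun _ => h'⟩
    · exact ⟨1, one_pos, fun h' => absurd h' h⟩
  choose C₀ hC₀ hC₀' using hex
  refine ⟨fun α => 16 * C₀ α + 12, fun α => by have := hC₀ α; positivity, ?_⟩
  intro X _ _ hρ k V hV
  have hmono : ∀ {α C C' : ℝ} {P : X →L[ℝ] X}, C ≤ C' → AlmostOrthogonal α C P →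
      AlmostOrthogonal α C' P := by
    intro α C C' P hCC h u D a b h1 h2 h3 h4 h5
    refine (h u D a b h1 h2 h3 h4 h5).trans ?_
    have : 0 ≤ a ^ (α - 1) := Real.rpow_nonneg (h2.trans h3) _
    gcongr
  -- Any projection of norm at most `1` serves for the exponents given by the modulus.
  have hpow : ∀ {P : X →L[ℝ] X}, ProjectsOnto P V → ‖P‖ ≤ 1 → ∀ α, HasSmoothnessPowerType X α →
      AlmostOrthogonal α (16 * C₀ α + 12) P := by
    rintro P hP hP1 α ⟨h1, h2, h3⟩
    have h4 : ρ =O[𝓝[>] 0] fun t : ℝ => t ^ α := by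
      refine h3.congr' ?_ EventuallyEq.rfl
      filter_upwards [self_mem_nhdsWithin] with t ht using hρ t (le_of_lt ht)
    refine hmono ?_ (AlmostOrthogonal.of_norm_le_one hP hP1 h1 h2 (hC₀ α).le ?_)
    · linarith [hC₀ α]
    · intro t s ht ht1 hst hs
      exact hC₀' α ⟨by linarith, h4⟩ t s ht ht1 hst (by rwa [hρ t ht.le] at hs)
  by_cases hH : IsHilbertNorm X
  · obtain ⟨P, hP, hP1, hAO⟩ := hH.exists_projection hV
    refine ⟨P, hP, hP1.trans (le_max_left _ _), ?_⟩
    rintro α (rfl | ⟨-, rfl⟩ | ⟨-, -, h⟩)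
    · exact almostOrthogonal_one (by linarith [hC₀ 1]) P
    · exact hmono (by linarith [hC₀ 2]) hAO
    · exact hpow hP hP1 α h
  · obtain ⟨P, hP, hPk⟩ := hV.exists_projection
    refine ⟨P, hP, hPk.trans (le_max_right _ _), ?_⟩
    rintro α (rfl | ⟨h, -⟩ | ⟨rfl, -, h⟩)
    · exact almostOrthogonal_one (by linarith [hC₀ 1]) P
    · exact absurd h hH
    · exact hpow hP (by simpa using hPk) α h

/-! ### Logarithmic closeness -/

/-- The nonnegative numbers `a` and `b` agree up to a factor `exp e`. -/
def LogClose (e a b : ℝ) : Prop :=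
  a ≤ Real.exp e * b ∧ b ≤ Real.exp e * a

theorem LogClose.refl (a : ℝ) : LogClose 0 a a := by simp [LogClose]

theorem LogClose.trans {e f a b c : ℝ} (h : LogClose e a b) (h' : LogClose f b c) :
    LogClose (e + f) a c := by
  constructor
  · calc a ≤ Real.exp e * b := h.1
      _ ≤ Real.exp e * (Real.exp f * c) := by gcongr; exact h'.1
      _ = _ := by rw [Real.exp_add]; ring
  · calc c ≤ Real.exp f * b := h'.2
      _ ≤ Real.exp f * (Real.exp e * a) := by gcongr; exact h.2
      _ = _ := by rw [Real.exp_add]; ring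

theorem LogClose.mono {e f a b : ℝ} (ha : 0 ≤ a) (hb : 0 ≤ b) (hef : e ≤ f) (h : LogClose e a b) :
    LogClose f a b := by
  constructor
  · exact h.1.trans (by gcongr)
  · exact h.2.trans (by gcongr)

theorem LogClose.of_abs_sub_le {e a b : ℝ} (ha : 0 ≤ a) (hb : 0 ≤ b) (h : |a - b| ≤ e * b)
    (h2 : |a - b| ≤ b / 2) : LogClose (2 * e) a b := by
  rw [abs_le] at h h2
  rcases hb.eq_or_lt with rfl | hb
  · have : a = 0 := by linarith
    simp [LogClose, this]
  have he : 0 ≤ e := by nlinarith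
  have h3 := Real.add_one_le_exp (2 * e)
  constructor
  · nlinarith
  · have h4 : (1 + 2 * e) * a ≤ Real.exp (2 * e) * a := by nlinarith
    refine le_trans ?_ h4
    rcases le_or_gt e (1 / 2) with h5 | h5
    · nlinarith
    · nlinarith

/-! ### Systems of approximating planes -/

/-- The centres and radii at which a set `S` is controlled. -/
def IsAdmissibleBall (S : Set X) (x : X) (r : ℝ) : Prop :=
  x ∈ S ∧ ‖x‖ < 2 ∧ 0 < r ∧ r ≤ 2

/-- A choice, for every admissible ball, of a `k`-plane `W x r` approximating `S - x` at scale `r`,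
of a projection `P x r` onto it, and of a number `flatness x r` bounding the relative distance of
`S` from `x + W x r` in that ball. The planes are spanned by points of `S - x`, so that a plane in
a smaller ball is controlled by the flatness in a larger one (`tilt`). -/
structure FlatSystem (k : ℕ) (K ε : ℝ) (S : Set X) where
  W : X → ℝ → Submodule ℝ X
  P : X → ℝ → X →L[ℝ] X
  flatness : X → ℝ → ℝ
  dim : ∀ {x r}, IsAdmissibleBall S x r → IsLinearPlane k (W x r)
  proj : ∀ {x r}, IsAdmissibleBall S x r → ProjectsOnto (P x r) (W x r)
  norm_le : ∀ {x r}, IsAdmissibleBall S x r → ‖P x r‖ ≤ K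
  flatness_nonneg : ∀ x r, 0 ≤ flatness x r
  flatness_le : ∀ {x r}, IsAdmissibleBall S x r → flatness x r ≤ ε
  flat : ∀ {x r}, IsAdmissibleBall S x r → ∀ {s}, s ∈ S → ‖s - x‖ < r →
    ‖(s - x) - P x r (s - x)‖ ≤ flatness x r * r
  tilt : ∀ {x r x' r'}, IsAdmissibleBall S x r → IsAdmissibleBall S x' r' → ‖x - x'‖ + r ≤ r' →
    ∀ w ∈ W x r, ‖w - P x' r' w‖ ≤ K * flatness x' r' * (r' / r) * ‖w‖
  cover : ∀ {x r}, IsAdmissibleBall S x r → ∀ w ∈ W x r, ‖w‖ ≤ 3 / 4 * r →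
    ∃ s ∈ S, ‖s - x - w‖ ≤ ε * r

namespace FlatSystem

variable {k : ℕ} {K ε : ℝ} {S : Set X} (F : FlatSystem k K ε S)
include F

/-- The plane of a larger ball is close to the plane of a smaller one, since the converse is true
and their dimensions agree. -/
theorem tilt_reverse (hK : 1 ≤ K) {x : X} {r : ℝ} {x' : X} {r' : ℝ} (hx : IsAdmissibleBall S x r)
    (hx' : IsAdmissibleBall S x' r') (hr : ‖x - x'‖ + r ≤ r')
    (hsmall : K * F.flatness x' r' * (r' / r) ≤ 1 / 2) :
    ∀ w ∈ F.W x' r', ‖w - F.P x r w‖ ≤ 4 * K * (K * F.flatness x' r' * (r' / r)) * ‖w‖ := by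
  intro w hw
  obtain ⟨v, hv, hvw, hvn⟩ := exists_apply_eq_of_close (F.dim hx) (F.dim hx') (F.proj hx') hsmall
    (F.tilt hx hx' hr) hw
  have h1 := (F.proj hx).norm_sub_apply_le_of_mem (F.norm_le hx) hK w hv
  have h2 := F.tilt hx hx' hr v hv
  rw [hvw, norm_sub_rev] at h2
  have hη : 0 ≤ K * F.flatness x' r' * (r' / r) := by
    have := F.flatness_nonneg x' r'
    have := hx.2.2.1
    have := hx'.2.2.1
    positivity
  calc ‖w - F.P x r w‖ ≤ 2 * K * ‖w - v‖ := h1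
    _ ≤ 2 * K * (K * F.flatness x' r' * (r' / r) * (2 * ‖w‖)) := by
      gcongr
      exact h2.trans (by gcongr)
    _ = _ := by ring

/-- The distance of a vector from the plane of a smaller ball. -/
theorem norm_sub_apply_le_of_larger (hK : 1 ≤ K) {x : X} {r : ℝ} {x' : X} {r' : ℝ}
    (hx : IsAdmissibleBall S x r) (hx' : IsAdmissibleBall S x' r') (hr : ‖x - x'‖ + r ≤ r')
    (hsmall : K * F.flatness x' r' * (r' / r) ≤ 1 / 2) (u : X) :
    ‖u - F.P x r u‖ ≤ 2 * K * ‖u - F.P x' r' u‖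
      + 4 * K ^ 2 * (K * F.flatness x' r' * (r' / r)) * ‖u‖ := by
  have h1 := F.tilt_reverse hK hx hx' hr hsmall _ ((F.proj hx').mem u)
  have h2 := norm_sub_apply_le (F.norm_le hx) hK (u - F.P x' r' u)
  have h3 : u - F.P x r u = ((u - F.P x' r' u) - F.P x r (u - F.P x' r' u))
      + (F.P x' r' u - F.P x r (F.P x' r' u)) := by
    rw [map_sub]; abel
  have h4 := norm_add_le ((u - F.P x' r' u) - F.P x r (u - F.P x' r' u))
    (F.P x' r' u - F.P x r (F.P x' r' u))
  rw [← h3] at h4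
  have h5 : ‖F.P x' r' u‖ ≤ K * ‖u‖ := (F.P x' r').le_of_opNorm_le (F.norm_le hx') u
  have hη : 0 ≤ K * F.flatness x' r' * (r' / r) := by
    have := F.flatness_nonneg x' r'
    have := hx.2.2.1
    have := hx'.2.2.1
    positivity
  have h6 : 4 * K * (K * F.flatness x' r' * (r' / r)) * ‖F.P x' r' u‖ ≤
      4 * K * (K * F.flatness x' r' * (r' / r)) * (K * ‖u‖) := by gcongr
  linarith

end FlatSystem

/-! ### Planes spanned by points of a Reifenberg flat set -/

/-- The two-sided approximation of a Reifenberg flat set by planes, in terms of vectors. -/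
theorem IsReifenbergFlat.exists_plane {k : ℕ} {δ δ' : ℝ} {S : Set X}
    (hS : IsReifenbergFlat k δ S 0) (hδ : 0 ≤ δ) (hδ' : δ < δ') {x : X} {r : ℝ}
    (hx : IsAdmissibleBall S x r) :
    ∃ V : Submodule ℝ X, IsLinearPlane k V ∧
      (∀ s ∈ S, ‖s - x‖ < r → ∃ v ∈ V, ‖s - x - v‖ ≤ δ' * r) ∧
      ∀ v ∈ V, ‖v‖ < r → ∃ s ∈ S, ‖s - x - v‖ ≤ δ' * r := by
  obtain ⟨hxS, hx2, hr, hr2⟩ := hx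
  have h := hS x ⟨hxS, by simpa using hx2⟩ r hr hr2
  have hpos : 0 < δ' * r := mul_pos (hδ.trans_lt hδ') hr
  have hlt : ENNReal.ofReal (δ * r) < ENNReal.ofReal (δ' * r) :=
    (ENNReal.ofReal_lt_ofReal_iff hpos).2 (by gcongr)
  have h1 := h.trans_lt hlt
  simp only [iInf_lt_iff] at h1
  obtain ⟨V, hV, hd⟩ := h1
  have hdist : ∀ a b : X, edist a b < ENNReal.ofReal (δ' * r) → ‖a - b‖ ≤ δ' * r := by
    intro a b hab
    rw [edist_dist, ENNReal.ofReal_lt_ofReal_iff hpos, dist_eq_norm] at hab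
    exact hab.le
  refine ⟨V, hV, fun s hs hsr => ?_, fun v hv hvr => ?_⟩
  · obtain ⟨t, ht, hst⟩ := Metric.exists_edist_lt_of_hausdorffEDist_lt
      (show s ∈ S ∩ Metric.ball x r from ⟨hs, by simpa [dist_eq_norm] using hsr⟩) hd
    refine ⟨t - x, ht.1, ?_⟩
    rw [sub_sub_sub_cancel_right]
    exact hdist _ _ hst
  · rw [Metric.hausdorffEDist_comm] at hd
    obtain ⟨t, ht, hst⟩ := Metric.exists_edist_lt_of_hausdorffEDist_lt
      (show x + v ∈ translatedPlane x V ∩ Metric.ball x r from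
        ⟨by simpa [translatedPlane] using hv, by simpa [dist_eq_norm] using hvr⟩) hd
    refine ⟨t, ht.1, ?_⟩
    rw [sub_sub]
    exact hdist _ _ (by rwa [edist_comm])

/-- A perturbation of a rescaled Auerbach basis is linearly independent, quantitatively. -/
theorem abs_coord_le_of_near {k : ℕ} {e v : Fin k → X} {r η : ℝ} (hr : 0 < r)
    (he : ∀ a : Fin k → ℝ, ∀ i, |a i| ≤ ‖∑ j, a j • e j‖)
    (hv : ∀ i, ‖v i - (r / 2) • e i‖ ≤ η * r) (hη : k * η ≤ 1 / 4) (a : Fin k → ℝ) (i : Fin k) :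
    |a i| ≤ 4 / r * ‖∑ j, a j • v j‖ := by
  have h1 : (r / 2) • ∑ j, a j • e j
      = ∑ j, a j • v j - ∑ j, a j • (v j - (r / 2) • e j) := by
    simp only [smul_sub, Finset.sum_sub_distrib, Finset.smul_sum, smul_comm (r / 2)]
    abel
  have h2 : ‖∑ j, a j • (v j - (r / 2) • e j)‖ ≤ r / 4 * ‖∑ j, a j • e j‖ := by
    calc _ ≤ ∑ j : Fin k, ‖∑ j, a j • e j‖ * (η * r) := by
          refine norm_sum_le_of_le _ fun j _ => ?_
          rw [norm_smul, Real.norm_eq_abs]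
          exact mul_le_mul (he a j) (hv j) (norm_nonneg _) (norm_nonneg _)
      _ = k * η * (r * ‖∑ j, a j • e j‖) := by simp; ring
      _ ≤ 1 / 4 * (r * ‖∑ j, a j • e j‖) := by gcongr
      _ = _ := by ring
  have h3 := norm_sub_le (∑ j, a j • v j) (∑ j, a j • (v j - (r / 2) • e j))
  rw [← h1, norm_smul, Real.norm_of_nonneg (by positivity)] at h3
  have h4 : r / 4 * |a i| ≤ ‖∑ j, a j • v j‖ := by
    have := mul_le_mul_of_nonneg_left (he a i) (show 0 ≤ r / 4 by positivity)
    linarith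
  calc |a i| = 4 / r * (r / 4 * |a i|) := by field_simp
    _ ≤ _ := by gcongr

/-- The data spanning a plane of a `FlatSystem` in the ball `B_r(x)`: vectors `v i` with
`x + v i ∈ S` which are quantitatively independent and close to a plane that approximates `S`
from both sides. -/
theorem exists_spanning_vectors {k : ℕ} {S : Set X} {V : Submodule ℝ X} (hV : IsLinearPlane k V)
    {x : X} {r η : ℝ} (hr : 0 < r) (hη : k * η ≤ 1 / 4) (hη2 : η < 1 / 2)
    (h : ∀ v ∈ V, ‖v‖ < r → ∃ s ∈ S, ‖s - x - v‖ ≤ η * r) :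
    ∃ v : Fin k → X, (∀ i, x + v i ∈ S) ∧ (∀ i, ‖v i‖ < r) ∧
      (∀ i, ∃ u ∈ V, ‖v i - u‖ ≤ η * r) ∧
      (∀ a : Fin k → ℝ, ∀ i, |a i| ≤ 4 / r * ‖∑ j, a j • v j‖) ∧
      IsLinearPlane k (Submodule.span ℝ (range v)) := by
  obtain ⟨e, heV, he1, -, he⟩ := hV.exists_auerbach
  have hnorm : ∀ i, ‖(r / 2) • e i‖ ≤ r / 2 := by
    intro i
    rw [norm_smul, Real.norm_of_nonneg (by positivity)]
    exact mul_le_of_le_one_right (by positivity) (he1 i)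
  choose s hsS hs using fun i => h ((r / 2) • e i) (V.smul_mem _ (heV i))
    ((hnorm i).trans_lt (by linarith))
  have hcoord := fun a i => abs_coord_le_of_near (v := fun i => s i - x) hr he hs hη a i
  refine ⟨fun i => s i - x, fun i => by simpa using hsS i, fun i => ?_,
    fun i => ⟨_, V.smul_mem _ (heV i), hs i⟩, hcoord, ?_⟩
  · have h1 := norm_add_le (s i - x - (r / 2) • e i) ((r / 2) • e i)
    rw [sub_add_cancel] at h1
    have h2 := hs i
    have h3 := hnorm i
    nlinarith
  · have hli : LinearIndependent ℝ fun i => s i - x := by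
      rw [Fintype.linearIndependent_iff]
      intro a ha i
      have := hcoord a i
      rw [ha, norm_zero, mul_zero] at this
      exact abs_nonpos_iff.1 this
    exact ⟨FiniteDimensional.span_of_finite ℝ (finite_range _), by
      rw [finrank_span_eq_card hli, Fintype.card_fin]⟩

/-- Linear combinations of vectors with bounded coefficients. -/
theorem norm_sum_smul_le {k : ℕ} (a : Fin k → ℝ) (z : Fin k → X) {A B : ℝ} (hA : ∀ i, |a i| ≤ A)
    (hz : ∀ i, ‖z i‖ ≤ B) (hA0 : 0 ≤ A) : ‖∑ i, a i • z i‖ ≤ k * (A * B) := by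
  calc ‖∑ i, a i • z i‖ ≤ ∑ _i : Fin k, A * B := by
        refine norm_sum_le_of_le _ fun i _ => ?_
        rw [norm_smul, Real.norm_eq_abs]
        exact mul_le_mul (hA i) (hz i) (norm_nonneg _) hA0
    _ = k * (A * B) := by simp

/-- A Reifenberg flat set carries a system of approximating planes, with projections of any
prescribed kind `Φ`, whose flatness numbers are optimal up to a constant among all `k`-planes. -/
theorem IsReifenbergFlat.exists_flatSystem {k : ℕ} {δ η ε K : ℝ} {S : Set X}
    (hS : IsReifenbergFlat k δ S 0) (hδ : 0 ≤ δ) (hδη : δ < η) (hK : K = 8 * k + 1)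
    (hη1 : K * η ≤ 1 / 16) (hη2 : 10 * K ^ 3 * η ≤ ε) (Φ : (X →L[ℝ] X) → Prop)
    (hΦ : ∀ V : Submodule ℝ X, IsLinearPlane k V →
      ∃ P : X →L[ℝ] X, ProjectsOnto P V ∧ ‖P‖ ≤ max 1 (k : ℝ) ∧ Φ P) :
    ∃ F : FlatSystem k K ε S, (∀ x r, IsAdmissibleBall S x r → Φ (F.P x r)) ∧
      ∀ x r, IsAdmissibleBall S x r → ∀ b : ℝ, 0 ≤ b → ∀ V : Submodule ℝ X, IsLinearPlane k V →
        (∀ s ∈ S, ‖s - x‖ < r → ∃ v ∈ V, ‖s - x - v‖ ≤ b * r) →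
        F.flatness x r ≤ 10 * K ^ 3 * b := by
  classical
  have hη : 0 < η := hδ.trans_lt hδη
  have hk0 : (0 : ℝ) ≤ k := Nat.cast_nonneg k
  have hK1 : 1 ≤ K := by linarith
  have hmaxK : max 1 (k : ℝ) ≤ K := max_le hK1 (by linarith)
  have hkη : k * η ≤ 1 / 128 := by
    have : 8 * (k : ℝ) * η ≤ K * η := by gcongr; linarith
    linarith
  have hη12 : η ≤ 1 / 16 := by nlinarith
  have hKK : K ≤ K ^ 3 := le_self_pow₀ hK1 (by norm_num)
  have hKK2 : K ^ 2 ≤ K ^ 3 := pow_le_pow_right₀ hK1 (by norm_num)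
  -- At every admissible ball choose the spanning vectors and the projection.
  have hloc : ∀ x r, ∃ (v : Fin k → X) (P : X →L[ℝ] X), IsAdmissibleBall S x r →
      (∀ i, x + v i ∈ S) ∧ (∀ i, ‖v i‖ < r) ∧
      (∀ a : Fin k → ℝ, ∀ i, |a i| ≤ 4 / r * ‖∑ j, a j • v j‖) ∧
      IsLinearPlane k (Submodule.span ℝ (range v)) ∧
      ProjectsOnto P (Submodule.span ℝ (range v)) ∧ ‖P‖ ≤ K ∧ Φ P ∧
      ∀ w ∈ Submodule.span ℝ (range v), ‖w‖ ≤ 3 / 4 * r → ∃ s ∈ S, ‖s - x - w‖ ≤ ε * r := by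
    intro x r
    by_cases hx : IsAdmissibleBall S x r
    · have hr : 0 < r := hx.2.2.1
      obtain ⟨V, hV, -, hV2⟩ := hS.exists_plane hδ hδη hx
      obtain ⟨v, hv1, hv2, hv3, hv4, hv5⟩ := exists_spanning_vectors hV hr
        (by linarith) (by linarith) hV2
      obtain ⟨P, hP1, hP2, hP3⟩ := hΦ _ hv5
      refine ⟨v, P, fun _ => ⟨hv1, hv2, hv4, hv5, hP1, hP2.trans hmaxK, hP3, fun w hw hwr => ?_⟩⟩
      obtain ⟨a, rfl⟩ := (Submodule.mem_span_range_iff_exists_fun ℝ).1 hw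
      choose u huV hu using hv3
      have h1 : ‖∑ i, a i • v i - ∑ i, a i • u i‖ ≤ 3 * (k * η) * r := by
        rw [← Finset.sum_sub_distrib]
        simp only [← smul_sub]
        refine (norm_sum_smul_le a _ (hv4 a) hu (by positivity)).trans ?_
        calc (k : ℝ) * (4 / r * ‖∑ j, a j • v j‖ * (η * r))
            ≤ k * (4 / r * (3 / 4 * r) * (η * r)) := by gcongr
          _ = 3 * (k * η) * r := by field_simp
      have h2 : ‖∑ i, a i • u i‖ < r := by
        have := norm_sub_le (∑ i, a i • v i) (∑ i, a i • v i - ∑ i, a i • u i)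
        rw [sub_sub_cancel] at this
        nlinarith
      obtain ⟨s, hsS, hs⟩ := hV2 _ (V.sum_mem fun i _ => V.smul_mem _ (huV i)) h2
      refine ⟨s, hsS, ?_⟩
      have h3 : s - x - ∑ i, a i • v i
          = (s - x - ∑ i, a i • u i) - (∑ i, a i • v i - ∑ i, a i • u i) := by abel
      rw [h3]
      have h4 := norm_sub_le (s - x - ∑ i, a i • u i) (∑ i, a i • v i - ∑ i, a i • u i)
      have h5 : (3 * (k * η) + η) * r ≤ ε * r := by
        gcongr
        have : (3 * k + 1) * η ≤ K * η := by gcongr; linarith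
        nlinarith
      linarith
    · exact ⟨0, 0, fun h => absurd h hx⟩
  choose v P hvP using hloc
  -- The flatness number of the chosen plane.
  let A : X → ℝ → Set ℝ := fun x r =>
    insert 0 {t | ∃ s ∈ S, ‖s - x‖ < r ∧ t = ‖(s - x) - P x r (s - x)‖ / r}
  have hbound : ∀ {x r b}, IsAdmissibleBall S x r → 0 ≤ b →
      (∀ s ∈ S, ‖s - x‖ < r → ‖(s - x) - P x r (s - x)‖ ≤ b * r) → ∀ t ∈ A x r, t ≤ b := by
    rintro x r b hx hb h t (rfl | ⟨s, hs, hsr, rfl⟩)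
    · exact hb
    · exact (div_le_iff₀ hx.2.2.1).2 (h s hs hsr)
  have hcrude : ∀ {x r}, IsAdmissibleBall S x r → ∀ t ∈ A x r, t ≤ 2 * K := by
    intro x r hx
    refine hbound hx (by positivity) fun s hs hsr => ?_
    refine (norm_sub_apply_le (hvP x r hx).2.2.2.2.2.1 hK1 _).trans ?_
    gcongr
  have hA0 : ∀ x r, (A x r).Nonempty := fun x r => ⟨0, mem_insert _ _⟩
  have hopt : ∀ x r, IsAdmissibleBall S x r → ∀ b : ℝ, 0 ≤ b → ∀ V : Submodule ℝ X,
      IsLinearPlane k V → (∀ s ∈ S, ‖s - x‖ < r → ∃ v ∈ V, ‖s - x - v‖ ≤ b * r) →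
      sSup (A x r) ≤ 10 * K ^ 3 * b := by
    intro x r hx b hb V hV hVb
    have hr : 0 < r := hx.2.2.1
    obtain ⟨hv1, hv2, hv4, hv5, hP1, hP2, -, -⟩ := hvP x r hx
    rcases le_or_gt (K ^ 2 * b) (1 / 2) with hbs | hbs
    · have hb2 : b ≤ 1 / 2 := by nlinarith
      refine csSup_le (hA0 x r) (hbound hx (by positivity) fun s hs hsr => ?_)
      obtain ⟨Q, hQ, hQK, -⟩ := hΦ V hV
      have hclose : ∀ w ∈ Submodule.span ℝ (range (v x r)), ‖w - Q w‖ ≤ K ^ 2 * b * ‖w‖ := by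
        intro w hw
        obtain ⟨a, rfl⟩ := (Submodule.mem_span_range_iff_exists_fun ℝ).1 hw
        choose u huV hu using fun i => hVb (x + v x r i) (hv1 i) (by simpa using hv2 i)
        simp only [add_sub_cancel_left] at hu
        have h1 : ‖∑ i, a i • v x r i - ∑ i, a i • u i‖
            ≤ 4 * k * b * ‖∑ i, a i • v x r i‖ := by
          rw [← Finset.sum_sub_distrib]
          simp only [← smul_sub]
          refine (norm_sum_smul_le a _ (hv4 a) hu (by positivity)).trans (le_of_eq ?_)
          field_simp
        have hmem : ∑ i, a i • u i ∈ V := V.sum_mem fun i _ => V.smul_mem _ (huV i)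
        refine (hQ.norm_sub_apply_le_of_mem (hQK.trans hmaxK) hK1 _ hmem).trans ?_
        calc 2 * K * ‖∑ i, a i • v x r i - ∑ i, a i • u i‖
            ≤ 2 * K * (4 * k * b * ‖∑ i, a i • v x r i‖) := by gcongr
          _ = (8 * k) * (K * b * ‖∑ i, a i • v x r i‖) := by ring
          _ ≤ K * (K * b * ‖∑ i, a i • v x r i‖) := by gcongr; linarith
          _ = _ := by ring
      obtain ⟨v', hv', hsv'⟩ := hVb s hs hsr
      obtain ⟨w, hw, hwv', hwn⟩ := exists_apply_eq_of_close hv5 hV hQ hbs hclose hv'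
      have h2 : ‖v'‖ ≤ 2 * r := by
        have := norm_sub_le (s - x) (s - x - v')
        rw [sub_sub_cancel] at this
        nlinarith
      have h3 : ‖w - v'‖ ≤ K ^ 2 * b * (2 * ‖v'‖) := by
        have := hclose w hw
        rw [hwv'] at this
        exact this.trans (by gcongr)
      have h4 : ‖s - x - w‖ ≤ b * r + K ^ 2 * b * (2 * (2 * r)) := by
        have e1 : s - x - w = (s - x - v') - (w - v') := by abel
        rw [e1]
        have e2 : K ^ 2 * b * (2 * ‖v'‖) ≤ K ^ 2 * b * (2 * (2 * r)) := by gcongr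
        linarith [norm_sub_le (s - x - v') (w - v')]
      have h5 : b * r ≤ K ^ 2 * (b * r) :=
        le_mul_of_one_le_left (by positivity) (one_le_pow₀ hK1)
      calc ‖(s - x) - P x r (s - x)‖ ≤ 2 * K * ‖s - x - w‖ :=
            hP1.norm_sub_apply_le_of_mem hP2 hK1 _ hw
        _ ≤ 2 * K * (5 * K ^ 2 * (b * r)) := by gcongr; linarith
        _ = 10 * K ^ 3 * b * r := by ring
    · refine (csSup_le (hA0 x r) (hcrude hx)).trans ?_
      have : K * (1 / 2) ≤ K * (K ^ 2 * b) := by gcongr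
      have h6 : 0 ≤ K * (K ^ 2 * b) := by positivity
      calc 2 * K ≤ 10 * (K * (K ^ 2 * b)) := by linarith
        _ = _ := by ring
  let F : FlatSystem k K ε S :=
    { W := fun x r => Submodule.span ℝ (range (v x r))
      P := P
      flatness := fun x r => if IsAdmissibleBall S x r then sSup (A x r) else 0
      dim := fun {x r} hx => (hvP x r hx).2.2.2.1
      proj := fun {x r} hx => (hvP x r hx).2.2.2.2.1
      norm_le := fun {x r} hx => (hvP x r hx).2.2.2.2.2.1
      flatness_nonneg := fun x r => by
        split_ifs with hx
        · exact le_csSup ⟨2 * K, fun t ht => hcrude hx t ht⟩ (mem_insert _ _)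
        · exact le_rfl
      flatness_le := fun {x r} hx => by
        rw [if_pos hx]
        obtain ⟨V, hV, hV1, -⟩ := hS.exists_plane hδ hδη hx
        exact (hopt x r hx η hη.le V hV hV1).trans hη2
      flat := fun {x r} hx s hs hsr => by
        rw [if_pos hx, ← div_le_iff₀ hx.2.2.1]
        exact le_csSup ⟨2 * K, fun t ht => hcrude hx t ht⟩
          (mem_insert_of_mem _ ⟨s, hs, hsr, rfl⟩)
      tilt := fun {x r x' r'} hx hx' hrr w hw => by
        rw [if_pos hx']
        obtain ⟨hv1, hv2, hv4, -⟩ := hvP x r hx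
        have hr := hx.2.2.1
        have hr' := hx'.2.2.1
        have hflat : ∀ s ∈ S, ‖s - x'‖ < r' →
            ‖(s - x') - P x' r' (s - x')‖ ≤ sSup (A x' r') * r' := fun s hs hsr => by
          rw [← div_le_iff₀ hr']
          exact le_csSup ⟨2 * K, fun t ht => hcrude hx' t ht⟩
            (mem_insert_of_mem _ ⟨s, hs, hsr, rfl⟩)
        have hnn : 0 ≤ sSup (A x' r') :=
          le_csSup ⟨2 * K, fun t ht => hcrude hx' t ht⟩ (mem_insert _ _)
        obtain ⟨a, rfl⟩ := (Submodule.mem_span_range_iff_exists_fun ℝ).1 hw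
        have h1 : ∀ i, ‖v x r i - P x' r' (v x r i)‖ ≤ 2 * (sSup (A x' r') * r') := by
          intro i
          have e1 : ‖x + v x r i - x'‖ < r' := by
            have : x + v x r i - x' = (x - x') + v x r i := by abel
            rw [this]
            linarith [norm_add_le (x - x') (v x r i), hv2 i]
          have e2 : v x r i - P x' r' (v x r i)
              = ((x + v x r i - x') - P x' r' (x + v x r i - x'))
                - ((x - x') - P x' r' (x - x')) := by
            simp only [map_sub, map_add]; abel
          rw [e2]
          linarith [norm_sub_le ((x + v x r i - x') - P x' r' (x + v x r i - x'))
            ((x - x') - P x' r' (x - x')), hflat _ (hv1 i) e1, hflat x hx.1 (by linarith)]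
        have h2 : ∑ i, a i • v x r i - P x' r' (∑ i, a i • v x r i)
            = ∑ i, a i • (v x r i - P x' r' (v x r i)) := by
          simp only [map_sum, map_smul, smul_sub, Finset.sum_sub_distrib]
        rw [h2]
        refine (norm_sum_smul_le a _ (hv4 a) h1 (by positivity)).trans ?_
        calc (k : ℝ) * (4 / r * ‖∑ j, a j • v x r j‖ * (2 * (sSup (A x' r') * r')))
            = (8 * k) * (sSup (A x' r') * (r' / r) * ‖∑ j, a j • v x r j‖) := by
              field_simp; ring
          _ ≤ K * (sSup (A x' r') * (r' / r) * ‖∑ j, a j • v x r j‖) := by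
              gcongr; linarith
          _ = _ := by ring
      cover := fun {x r} hx => (hvP x r hx).2.2.2.2.2.2.2 }
  refine ⟨F, fun x r hx => (hvP x r hx).2.2.2.2.2.2.1, fun x r hx b hb V hV h => ?_⟩
  change (if IsAdmissibleBall S x r then sSup (A x r) else 0) ≤ _
  rw [if_pos hx]
  exact hopt x r hx b hb V hV h

/-! ### Averaged projections -/

/-- The unnormalised weight of the net point `a` at `y`. -/
noncomputable def tent (r : ℝ) (a y : X) : ℝ :=
  max 0 (3 - ‖a - y‖ / r)

open Classical in
/-- The net points whose weight at `y` is nonzero, as a `Finset`; the empty set if there are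
infinitely many of them. -/
noncomputable def nearPoints (A : Set X) (r : ℝ) (y : X) : Finset X :=
  if h : (A ∩ Metric.ball y (3 * r)).Finite then h.toFinset else ∅

/-- The normalising factor of the weights. It is at least `1`, so that the weights decay to `0` away
from the net instead of always having sum `1`. -/
noncomputable def tentTotal (A : Set X) (r : ℝ) (y : X) : ℝ :=
  max 1 (∑ a ∈ nearPoints A r y, tent r a y)

/-- The weight of the net point `a` at `y`. -/
noncomputable def netWeight (A : Set X) (r : ℝ) (a y : X) : ℝ :=
  tent r a y / tentTotal A r y

/-- The average of the affine projections `y ↦ a + P a (y - a)` over the points `a` of the net `A`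
near `y`. The remaining weight is given to `y` itself. -/
noncomputable def averagedProjection (A : Set X) (r : ℝ) (P : X → X →L[ℝ] X) (y : X) : X :=
  y + ∑ a ∈ nearPoints A r y, netWeight A r a y • ((a - y) - P a (a - y))

/-- Every ball of radius `3 * r` contains at most `N` points of `A`. -/
def HasBoundedOverlap (A : Set X) (r N : ℝ) : Prop :=
  ∀ y : X, ∃ s : Finset X, (s : Set X) = A ∩ Metric.ball y (3 * r) ∧ (s.card : ℝ) ≤ N

section tent

variable {Y : Type*} [NormedAddCommGroup Y] {r : ℝ}

theorem tent_nonneg (a y : Y) : 0 ≤ tent r a y := le_max_left _ _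

theorem tent_eq_zero (hr : 0 < r) {a y : Y} (h : 3 * r ≤ ‖a - y‖) : tent r a y = 0 := by
  refine max_eq_left ?_
  have := (le_div_iff₀ hr).2 h
  linarith

theorem one_le_tent (hr : 0 < r) {a y : Y} (h : ‖a - y‖ ≤ 2 * r) : 1 ≤ tent r a y := by
  refine le_trans ?_ (le_max_right _ _)
  have := (div_le_iff₀ hr).2 h
  linarith

theorem abs_tent_sub_le (hr : 0 < r) (a y z : Y) :
    |tent r a y - tent r a z| ≤ ‖y - z‖ / r := by
  have h := abs_max_sub_max_le_abs (3 - ‖a - y‖ / r) (3 - ‖a - z‖ / r) 0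
  rw [max_comm _ 0, max_comm _ 0, sub_sub_sub_cancel_left, ← sub_div, abs_div, abs_of_pos hr] at h
  refine h.trans ?_
  gcongr
  refine (abs_norm_sub_norm_le _ _).trans_eq ?_
  rw [sub_sub_sub_cancel_left]

end tent

section average

variable {Y : Type*} [NormedAddCommGroup Y] {A : Set Y} {r N : ℝ}

theorem coe_nearPoints (hA : HasBoundedOverlap A r N) (y : Y) :
    (nearPoints A r y : Set Y) = A ∩ Metric.ball y (3 * r) ∧ ((nearPoints A r y).card : ℝ) ≤ N := by
  obtain ⟨s, hs, hN⟩ := hA y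
  have hfin : (A ∩ Metric.ball y (3 * r)).Finite := hs ▸ s.finite_toSet
  have h1 : (nearPoints A r y : Set Y) = A ∩ Metric.ball y (3 * r) := by
    rw [nearPoints, dif_pos hfin, Set.Finite.coe_toFinset]
  have h2 : nearPoints A r y = s := by
    rw [← Finset.coe_inj, h1, hs]
  exact ⟨h1, h2 ▸ hN⟩

theorem mem_nearPoints (hA : HasBoundedOverlap A r N) {a y : Y} :
    a ∈ nearPoints A r y ↔ a ∈ A ∧ ‖a - y‖ < 3 * r := by
  rw [← Finset.mem_coe, (coe_nearPoints hA y).1]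
  simp [dist_eq_norm]

theorem tent_eq_zero_of_notMem (hr : 0 < r) (hA : HasBoundedOverlap A r N) {a y : Y} (ha : a ∈ A)
    (h : a ∉ nearPoints A r y) : tent r a y = 0 := by
  refine tent_eq_zero hr ?_
  by_contra hlt
  exact h ((mem_nearPoints hA).2 ⟨ha, not_le.1 hlt⟩)

theorem tentTotal_pos (y : Y) : 0 < tentTotal A r y := one_pos.trans_le (le_max_left _ _)

theorem netWeight_nonneg (a y : Y) : 0 ≤ netWeight A r a y :=
  div_nonneg (tent_nonneg a y) (tentTotal_pos y).le

theorem netWeight_eq_zero (hr : 0 < r) (hA : HasBoundedOverlap A r N) {a y : Y} (ha : a ∈ A)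
    (h : a ∉ nearPoints A r y) : netWeight A r a y = 0 := by
  rw [netWeight, tent_eq_zero_of_notMem hr hA ha h, zero_div]

theorem sum_netWeight (y : Y) : ∑ a ∈ nearPoints A r y, netWeight A r a y
    = (∑ a ∈ nearPoints A r y, tent r a y) / tentTotal A r y := by
  simp only [netWeight, Finset.sum_div]

theorem sum_netWeight_le_one (y : Y) : ∑ a ∈ nearPoints A r y, netWeight A r a y ≤ 1 := by
  rw [sum_netWeight, div_le_one (tentTotal_pos y)]
  exact le_max_right _ _

theorem sum_netWeight_eq_one (hr : 0 < r) (hA : HasBoundedOverlap A r N) {y : Y}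
    (h : ∃ a ∈ A, ‖a - y‖ ≤ 2 * r) : ∑ a ∈ nearPoints A r y, netWeight A r a y = 1 := by
  obtain ⟨a, ha, hay⟩ := h
  have h1 : 1 ≤ ∑ a ∈ nearPoints A r y, tent r a y :=
    (one_le_tent hr hay).trans (Finset.single_le_sum (f := fun a => tent r a y)
      (fun c _ => tent_nonneg c y) ((mem_nearPoints hA).2 ⟨ha, by linarith⟩))
  rw [sum_netWeight, tentTotal, max_eq_right h1, div_self (by linarith)]

/-- Sums against the weights at `y` may be taken over any larger set of net points. -/
theorem sum_nearPoints_eq {M : Type*} [AddCommMonoid M] (hr : 0 < r) (hA : HasBoundedOverlap A r N)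
    {y : Y} {G : Finset Y} (hGA : ∀ a ∈ G, a ∈ A) (hG : nearPoints A r y ⊆ G) (f : Y → M)
    (hf : ∀ a, tent r a y = 0 → f a = 0) :
    ∑ a ∈ nearPoints A r y, f a = ∑ a ∈ G, f a :=
  Finset.sum_subset hG fun a ha h => hf a (tent_eq_zero_of_notMem hr hA (hGA a ha) h)

theorem netWeight_eq_zero_of_tent {a y : Y} (h : tent r a y = 0) : netWeight A r a y = 0 := by
  rw [netWeight, h, zero_div]

theorem netWeight_le_one {a y : Y} (hr : 0 < r) (hA : HasBoundedOverlap A r N) (ha : a ∈ A) :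
    netWeight A r a y ≤ 1 := by
  by_cases h : a ∈ nearPoints A r y
  · exact (Finset.single_le_sum (f := fun a => netWeight A r a y)
      (fun c _ => netWeight_nonneg c y) h).trans (sum_netWeight_le_one y)
  · rw [netWeight_eq_zero hr hA ha h]
    exact zero_le_one

open Classical in
theorem card_union_nearPoints_le (hA : HasBoundedOverlap A r N) (y z : Y) :
    ((nearPoints A r y ∪ nearPoints A r z).card : ℝ) ≤ 2 * N := by
  have h1 : ((nearPoints A r y ∪ nearPoints A r z).card : ℝ)
      ≤ (nearPoints A r y).card + (nearPoints A r z).card := by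
    exact_mod_cast Finset.card_union_le _ _
  linarith [(coe_nearPoints hA y).2, (coe_nearPoints hA z).2]

open Classical in
theorem abs_tentTotal_sub_le (hr : 0 < r) (hA : HasBoundedOverlap A r N) (y z : Y) :
    |tentTotal A r y - tentTotal A r z| ≤ 2 * N * (‖y - z‖ / r) := by
  have hGA : ∀ a ∈ nearPoints A r y ∪ nearPoints A r z, a ∈ A := fun a ha =>
    (Finset.mem_union.1 ha).elim (fun h => ((mem_nearPoints hA).1 h).1)
      fun h => ((mem_nearPoints hA).1 h).1
  have hmax := abs_max_sub_max_le_abs (∑ a ∈ nearPoints A r y, tent r a y)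
    (∑ a ∈ nearPoints A r z, tent r a z) 1
  rw [max_comm _ 1, max_comm _ 1] at hmax
  refine hmax.trans ?_
  rw [sum_nearPoints_eq hr hA hGA Finset.subset_union_left (fun a => tent r a y) fun a h => h,
    sum_nearPoints_eq hr hA hGA Finset.subset_union_right (fun a => tent r a z) fun a h => h,
    ← Finset.sum_sub_distrib]
  refine (Finset.abs_sum_le_sum_abs _ _).trans ?_
  calc ∑ a ∈ nearPoints A r y ∪ nearPoints A r z, |tent r a y - tent r a z|
      ≤ ∑ a ∈ nearPoints A r y ∪ nearPoints A r z, ‖y - z‖ / r :=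
        Finset.sum_le_sum fun a _ => abs_tent_sub_le hr a y z
    _ = ((nearPoints A r y ∪ nearPoints A r z).card : ℝ) * (‖y - z‖ / r) := by simp
    _ ≤ 2 * N * (‖y - z‖ / r) := by
        gcongr
        exact card_union_nearPoints_le hA y z

theorem abs_netWeight_sub_le (hr : 0 < r) (hA : HasBoundedOverlap A r N) {a : Y} (ha : a ∈ A)
    (y z : Y) :
    |netWeight A r a y - netWeight A r a z| ≤ (1 + 2 * N) * (‖y - z‖ / r) := by
  have h1 := abs_tent_sub_le hr a y z
  have h2 := abs_tentTotal_sub_le hr hA y z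
  have hy : 1 ≤ tentTotal A r y := le_max_left _ _
  have hz := netWeight_le_one hr hA ha (y := z)
  have hz0 : 0 ≤ netWeight A r a z := netWeight_nonneg a z
  have h3 : netWeight A r a y - netWeight A r a z
      = ((tent r a y - tent r a z)
        - netWeight A r a z * (tentTotal A r y - tentTotal A r z)) / tentTotal A r y := by
    have hy0 := (tentTotal_pos (A := A) (r := r) y).ne'
    have hz0 := (tentTotal_pos (A := A) (r := r) z).ne'
    rw [netWeight, netWeight]
    field_simp
    ring
  rw [h3, abs_div, abs_of_pos (one_pos.trans_le hy)]
  refine (div_le_self (abs_nonneg _) hy).trans ?_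
  refine (abs_sub _ _).trans ?_
  rw [abs_mul, abs_of_nonneg hz0]
  have h4 : netWeight A r a z * |tentTotal A r y - tentTotal A r z| ≤
      1 * (2 * N * (‖y - z‖ / r)) := by gcongr
  linarith

end average

section average

variable {A : Set X} {r N : ℝ} {P : X → X →L[ℝ] X}

open Classical in
/-- The change of a difference vector under an averaged projection is a sum of vectors in the
kernels of the projections. -/
theorem averagedProjection_sub (hr : 0 < r) (hA : HasBoundedOverlap A r N) (y z : X) :
    averagedProjection A r P y - averagedProjection A r P z = (y - z)
      + ∑ a ∈ nearPoints A r y ∪ nearPoints A r z,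
        ((netWeight A r a y • (a - y) - netWeight A r a z • (a - z))
          - P a (netWeight A r a y • (a - y) - netWeight A r a z • (a - z))) := by
  have hGA : ∀ a ∈ nearPoints A r y ∪ nearPoints A r z, a ∈ A := fun a ha =>
    (Finset.mem_union.1 ha).elim (fun h => ((mem_nearPoints hA).1 h).1)
      fun h => ((mem_nearPoints hA).1 h).1
  rw [averagedProjection, averagedProjection,
    sum_nearPoints_eq hr hA hGA Finset.subset_union_left _ fun a h => by
      rw [netWeight_eq_zero_of_tent h, zero_smul],
    sum_nearPoints_eq hr hA hGA Finset.subset_union_right _ fun a h => by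
      rw [netWeight_eq_zero_of_tent h, zero_smul], add_sub_add_comm, ← Finset.sum_sub_distrib]
  congr 1
  refine Finset.sum_congr rfl fun a _ => ?_
  simp only [map_sub, map_smul, smul_sub]
  abel

theorem norm_averagedProjection_sub_le {B : ℝ} (hB : 0 ≤ B) (y : X)
    (h : ∀ a ∈ nearPoints A r y, ‖(a - y) - P a (a - y)‖ ≤ B) :
    ‖averagedProjection A r P y - y‖ ≤ B := by
  rw [averagedProjection, add_sub_cancel_left]
  calc _ ≤ ∑ a ∈ nearPoints A r y, netWeight A r a y * B := by
        refine norm_sum_le_of_le _ fun a ha => ?_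
        rw [norm_smul, Real.norm_of_nonneg (netWeight_nonneg a y)]
        exact mul_le_mul_of_nonneg_left (h a ha) (netWeight_nonneg a y)
    _ = (∑ a ∈ nearPoints A r y, netWeight A r a y) * B := by rw [Finset.sum_mul]
    _ ≤ 1 * B := by gcongr; exact sum_netWeight_le_one y
    _ = B := one_mul B

theorem averagedProjection_eq_self {y : X} (h : nearPoints A r y = ∅) :
    averagedProjection A r P y = y := by
  rw [averagedProjection, h, Finset.sum_empty, add_zero]

theorem averagedProjection_sub_of_sum_eq_one {y : X}
    (h : ∑ a ∈ nearPoints A r y, netWeight A r a y = 1) (p : X) :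
    averagedProjection A r P y - p
      = ∑ a ∈ nearPoints A r y, netWeight A r a y • ((a - p) + P a (y - a)) := by
  have h1 : averagedProjection A r P y - p
      = (∑ a ∈ nearPoints A r y, netWeight A r a y) • (y - p)
        + ∑ a ∈ nearPoints A r y, netWeight A r a y • ((a - y) - P a (a - y)) := by
    rw [h, one_smul, averagedProjection]; abel
  rw [h1, Finset.sum_smul, ← Finset.sum_add_distrib]
  refine Finset.sum_congr rfl fun a _ => ?_
  rw [← smul_add]
  congr 1
  simp only [map_sub]
  abel

open Classical in
/-- Where the weights have sum `1`, difference vectors are mapped into the span of the planes up to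
an error governed by the distance to the planes. -/
theorem averagedProjection_sub_of_sums_eq_one (hr : 0 < r) (hA : HasBoundedOverlap A r N) {y z : X}
    (hy : ∑ a ∈ nearPoints A r y, netWeight A r a y = 1)
    (hz : ∑ a ∈ nearPoints A r z, netWeight A r a z = 1) (p : X) :
    averagedProjection A r P y - averagedProjection A r P z
      = ∑ a ∈ nearPoints A r y, netWeight A r a y • P a (y - z)
        + ∑ a ∈ nearPoints A r y ∪ nearPoints A r z,
          (netWeight A r a y - netWeight A r a z) • ((a - p) + P a (z - a)) := by
  have hGA : ∀ a ∈ nearPoints A r y ∪ nearPoints A r z, a ∈ A := fun a ha =>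
    (Finset.mem_union.1 ha).elim (fun h => ((mem_nearPoints hA).1 h).1)
      fun h => ((mem_nearPoints hA).1 h).1
  have h1 : averagedProjection A r P y - averagedProjection A r P z
      = (averagedProjection A r P y - p) - (averagedProjection A r P z - p) := by abel
  rw [h1, averagedProjection_sub_of_sum_eq_one hy, averagedProjection_sub_of_sum_eq_one hz,
    sum_nearPoints_eq hr hA hGA Finset.subset_union_left
      (fun a => netWeight A r a y • ((a - p) + P a (y - a))) fun a h => by
      rw [netWeight_eq_zero_of_tent h, zero_smul],
    sum_nearPoints_eq hr hA hGA Finset.subset_union_left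
      (fun a => netWeight A r a y • P a (y - z)) fun a h => by
      rw [netWeight_eq_zero_of_tent h, zero_smul],
    sum_nearPoints_eq hr hA hGA Finset.subset_union_right
      (fun a => netWeight A r a z • ((a - p) + P a (z - a))) fun a h => by
      rw [netWeight_eq_zero_of_tent h, zero_smul],
    ← Finset.sum_sub_distrib, ← Finset.sum_add_distrib]
  refine Finset.sum_congr rfl fun a _ => ?_
  simp only [sub_smul, smul_add, map_sub, smul_sub]
  abel

end average

/-- A maximal `r`-separated subset. -/
theorem exists_maximal_separated {Y : Type*} [NormedAddCommGroup Y] (T : Set Y) {r : ℝ}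
    (hr : 0 < r) :
    ∃ A ⊆ T, (∀ a ∈ A, ∀ b ∈ A, a ≠ b → r ≤ ‖a - b‖) ∧ ∀ y ∈ T, ∃ a ∈ A, ‖a - y‖ < r := by
  obtain ⟨A, hA⟩ := zorn_subset
    {B : Set Y | B ⊆ T ∧ ∀ a ∈ B, ∀ b ∈ B, a ≠ b → r ≤ ‖a - b‖} fun c hc hchain => by
      refine ⟨⋃₀ c, ⟨sUnion_subset fun B hB => (hc hB).1, ?_⟩, fun B hB => subset_sUnion_of_mem hB⟩
      rintro a ⟨B, hB, haB⟩ b ⟨B', hB', hbB'⟩ hab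
      rcases hchain.total hB hB' with h | h
      · exact (hc hB').2 a (h haB) b hbB' hab
      · exact (hc hB).2 a haB b (h hbB') hab
  refine ⟨A, hA.prop.1, hA.prop.2, fun y hy => ?_⟩
  by_contra! hcon
  have hins : insert y A ∈ {B : Set Y | B ⊆ T ∧ ∀ a ∈ B, ∀ b ∈ B, a ≠ b → r ≤ ‖a - b‖} := by
    refine ⟨insert_subset hy hA.prop.1, ?_⟩
    rintro a (rfl | ha) b (rfl | hb) hab
    · exact absurd rfl hab
    · rw [norm_sub_rev]; exact hcon b hb
    · exact hcon a ha
    · exact hA.prop.2 a ha b hb hab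
  have hyA : y ∈ A := hA.le_of_ge hins (subset_insert y A) (mem_insert y A)
  have := hcon y hyA
  rw [sub_self, norm_zero] at this
  linarith

/-! ### Scales and constants -/

/-- The dyadic scales of the construction. -/
noncomputable def dyadicScale (i : ℕ) : ℝ := 1 / 1000 * (1 / 2) ^ i

theorem dyadicScale_pos (i : ℕ) : 0 < dyadicScale i := by
  unfold dyadicScale; positivity

theorem dyadicScale_succ (i : ℕ) : dyadicScale (i + 1) = dyadicScale i / 2 := by
  unfold dyadicScale; rw [pow_succ]; ring

theorem dyadicScale_le (i : ℕ) : dyadicScale i ≤ 1 / 1000 := by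
  unfold dyadicScale
  have : (1 / 2 : ℝ) ^ i ≤ 1 := pow_le_one₀ (by norm_num) (by norm_num)
  linarith

/-- The constants of the construction: `K` bounds the projections, `N` the overlap of the nets,
`CA` the height and `CB` the slope of the approximating surfaces over the planes, `CD` the
displacement and `CE` the distortion in one step, all relative to the flatness, and `ε` is the
largest flatness allowed. -/
structure StepConstants (K N CA CB CD CE ε : ℝ) : Prop where
  one_le_K : 1 ≤ K
  one_le_N : 1 ≤ N
  le_CA : 160000 * K ^ 2 ≤ CA
  le_CB : 800 * K ^ 2 * N ^ 2 ≤ CB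
  le_CD : 2 * K * (100 + CA) + 120 * K ^ 3 ≤ CD
  le_CE : 2 * K * CB + 20 * K ^ 3 + (1 + 2 * N) * CD ≤ CE
  ε_nonneg : 0 ≤ ε
  small : 1000 * K ^ 2 * N * CE * ε ≤ 1

namespace StepConstants

variable {K N CA CB CD CE ε : ℝ} (c : StepConstants K N CA CB CD CE ε)
include c

theorem K_pos : 0 < K := one_pos.trans_le c.one_le_K

theorem CA_ge : 160000 ≤ CA := by
  have := c.le_CA
  have : 1 ≤ K ^ 2 := one_le_pow₀ c.one_le_K
  linarith

theorem CB_ge : 800 ≤ CB := by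
  have := c.le_CB
  have h1 : 1 ≤ K ^ 2 := one_le_pow₀ c.one_le_K
  have h2 : 1 ≤ N ^ 2 := one_le_pow₀ c.one_le_N
  nlinarith

theorem CA_le_CD : 2 * K * CA ≤ CD := by
  have := c.le_CD
  have := c.K_pos
  nlinarith [pow_pos c.K_pos 3]

theorem CA_le : CA ≤ CD := by
  have := c.CA_le_CD
  have := c.CA_ge
  nlinarith [c.one_le_K]

theorem CD_le_CE : CD ≤ CE := by
  have h1 := c.le_CE
  have h2 := c.CA_le
  have h3 := c.CA_ge
  have h4 : 0 ≤ 2 * K * CB := by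
    have := c.K_pos
    have := c.CB_ge
    positivity
  have h5 := pow_pos c.K_pos 3
  nlinarith [c.one_le_N]

theorem CB_le_CE : 2 * K * CB ≤ CE := by
  have h1 := c.le_CE
  have h2 := c.CA_le
  have h3 := c.CA_ge
  have h5 := pow_pos c.K_pos 3
  nlinarith [c.one_le_N]

theorem CE_ge : 160000 ≤ CE := c.CA_ge.trans (c.CA_le.trans c.CD_le_CE)

theorem small_CE : 1000 * (K * (N * (CE * ε))) ≤ 1 := by
  have h := c.small
  have h1 : 0 ≤ 1000 * (K * (N * (CE * ε))) := by
    have := c.K_pos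
    have := c.CE_ge
    have := c.ε_nonneg
    have := c.one_le_N
    positivity
  nlinarith [c.one_le_K]

theorem small_KCE : 1000 * (K * (CE * ε)) ≤ 1 := by
  have h := c.small_CE
  have h1 : 0 ≤ K * (CE * ε) := by
    have := c.K_pos
    have := c.CE_ge
    have := c.ε_nonneg
    positivity
  nlinarith [c.one_le_N]

theorem small_CE' : 1000 * (CE * ε) ≤ 1 := by
  have h := c.small_KCE
  have h1 : 0 ≤ CE * ε := by
    have := c.CE_ge
    have := c.ε_nonneg
    positivity
  nlinarith [c.one_le_K]

theorem small_ε : 1000 * (160000 * (K * ε)) ≤ 1 := by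
  have h1 : K * (160000 * ε) ≤ K * (CE * ε) := by
    have := c.K_pos
    have := c.ε_nonneg
    gcongr
    exact c.CE_ge
  linarith [c.small_KCE]

theorem ε_le : 1000 * (160000 * ε) ≤ 1 := by
  have := c.small_ε
  nlinarith [c.one_le_K, c.ε_nonneg]

end StepConstants

/-! ### One step of the construction -/

/-- A maximal separated net at scale `i` in the part of `S` that is still to be approximated. -/
noncomputable def net (S : Set X) (i : ℕ) : Set X :=
  (exists_maximal_separated (S ∩ {y | ‖y‖ ≤ 1 + 21 * dyadicScale i}) (dyadicScale_pos i)).choose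

theorem net_spec {Y : Type*} [NormedAddCommGroup Y] (S : Set Y) (i : ℕ) :
    net S i ⊆ S ∩ {y | ‖y‖ ≤ 1 + 21 * dyadicScale i} ∧
    (∀ a ∈ net S i, ∀ b ∈ net S i, a ≠ b → dyadicScale i ≤ ‖a - b‖) ∧
    ∀ y ∈ S ∩ {y | ‖y‖ ≤ 1 + 21 * dyadicScale i}, ∃ a ∈ net S i, ‖a - y‖ < dyadicScale i :=
  (exists_maximal_separated (S ∩ {y | ‖y‖ ≤ 1 + 21 * dyadicScale i})
    (dyadicScale_pos i)).choose_spec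

theorem isAdmissibleBall_mul_dyadicScale {Y : Type*} [NormedAddCommGroup Y] {S : Set Y} {i : ℕ}
    {p : Y} (hp : p ∈ S) (hp2 : ‖p‖ < 2) {m : ℝ} (hm : 0 < m) (hm2 : m ≤ 100) :
    IsAdmissibleBall S p (m * dyadicScale i) := by
  have h1 := dyadicScale_pos i
  have h2 := dyadicScale_le i
  exact ⟨hp, hp2, by positivity, by nlinarith⟩

theorem norm_lt_two_of_close {Y : Type*} [NormedAddCommGroup Y] {i : ℕ} {y p : Y}
    (hy : ‖y‖ ≤ 1 + 40 * dyadicScale i) (hyp : ‖y - p‖ ≤ 60 * dyadicScale i) : ‖p‖ < 2 := by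
  have h1 := norm_sub_norm_le p y
  rw [norm_sub_rev] at h1
  linarith [dyadicScale_le i]

namespace FlatSystem

variable {k : ℕ} {K ε : ℝ} {S : Set X} (F : FlatSystem k K ε S)

/-- One step of the construction: the averaged projection at scale `i`. -/
noncomputable def step (i : ℕ) (y : X) : X :=
  averagedProjection (net S i) (dyadicScale i) (fun a => F.P a (20 * dyadicScale i)) y

/-- The flatness of `S` near `p` that governs the stage `i`. The initial plane contributes at
stage `0`. -/
noncomputable def stageFlatness (i : ℕ) (p : X) : ℝ :=
  F.flatness p (100 * dyadicScale i) + if i = 0 then F.flatness 0 (19 / 10) else 0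

/-- The set `T` approximates `S` at scale `i`, in the part of the unit ball where the construction
continues: it is close to `S`, it is a Lipschitz graph over the approximating planes, with height
and slope controlled by the flatness of `S`, and this graph has no holes. -/
structure Stage (F : FlatSystem k K ε S) (CA CB : ℝ) (i : ℕ) (T : Set X) : Prop where
  near : ∀ y ∈ T, ‖y‖ ≤ 1 + 40 * dyadicScale i → ∃ p ∈ S, ‖y - p‖ ≤ dyadicScale i / 10
  height : ∀ y ∈ T, ‖y‖ ≤ 1 + 40 * dyadicScale i → ∀ p ∈ S, ‖y - p‖ ≤ 10 * dyadicScale i →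
    ‖(y - p) - F.P p (100 * dyadicScale i) (y - p)‖ ≤ CA * F.stageFlatness i p * dyadicScale i
  angle : ∀ y ∈ T, ∀ z ∈ T, ‖y‖ ≤ 1 + 40 * dyadicScale i → ‖z‖ ≤ 1 + 40 * dyadicScale i →
    ‖y - z‖ ≤ 3 * dyadicScale i → ∀ p ∈ S, ‖y - p‖ ≤ 10 * dyadicScale i →
    ‖(y - z) - F.P p (100 * dyadicScale i) (y - z)‖ ≤ CB * F.stageFlatness i p * ‖y - z‖
  lift : ∀ y ∈ T, ‖y‖ ≤ 1 + 30 * dyadicScale i → ∀ p ∈ S, ‖y - p‖ ≤ dyadicScale i →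
    ∀ t ∈ F.W p (100 * dyadicScale i), ‖t‖ ≤ dyadicScale i / 4 →
    ∃ y' ∈ T, ‖y' - y‖ ≤ 2 * ‖t‖ ∧ F.P p (100 * dyadicScale i) (y' - y) = t

section

include F

variable {N CA CB CD CE : ℝ} (c : StepConstants K N CA CB CD CE ε)

theorem flatness_le_stageFlatness (i : ℕ) (p : X) :
    F.flatness p (100 * dyadicScale i) ≤ F.stageFlatness i p := by
  unfold stageFlatness
  split_ifs
  · linarith [F.flatness_nonneg 0 (19 / 10)]
  · linarith

theorem stageFlatness_nonneg (i : ℕ) (p : X) : 0 ≤ F.stageFlatness i p :=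
  (F.flatness_nonneg _ _).trans (F.flatness_le_stageFlatness i p)

theorem stageFlatness_le (h0 : (0 : X) ∈ S) (hε : 0 ≤ ε) {i : ℕ} {p : X} (hp : p ∈ S)
    (hp2 : ‖p‖ < 2) : F.stageFlatness i p ≤ 2 * ε := by
  have h1 := F.flatness_le
    (isAdmissibleBall_mul_dyadicScale (i := i) hp hp2 (m := 100) (by norm_num) le_rfl)
  have h2 := F.flatness_le (x := 0) (r := 19 / 10) ⟨h0, by simp, by norm_num, by norm_num⟩
  unfold stageFlatness
  split_ifs <;> linarith

include c

/-- The nets have bounded overlap because `S` is close to a `k`-plane. -/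
theorem hasBoundedOverlap (hN : (26 : ℝ) ^ k ≤ N) (i : ℕ) :
    HasBoundedOverlap (net S i) (dyadicScale i) N := by
  intro y
  have hr := dyadicScale_pos i
  have hr2 := dyadicScale_le i
  obtain ⟨hsub, hsep, -⟩ := net_spec S i
  have hcard : ∀ s : Finset X, (s : Set X) ⊆ net S i ∩ Metric.ball y (3 * dyadicScale i) →
      (s.card : ℝ) ≤ N := by
    intro s hs
    rcases s.eq_empty_or_nonempty with rfl | ⟨a₀, ha₀⟩
    · simpa using zero_le_one.trans c.one_le_N
    have hA : ∀ a ∈ s, a ∈ S ∧ ‖a - y‖ < 3 * dyadicScale i := fun a ha =>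
      ⟨(hsub (hs ha).1).1, by simpa [dist_eq_norm] using (hs ha).2⟩
    have ha₀2 : ‖a₀‖ < 2 := by
      have : ‖a₀‖ ≤ 1 + 21 * dyadicScale i := (hsub (hs ha₀).1).2
      linarith
    have hadm := isAdmissibleBall_mul_dyadicScale (i := i) (hA a₀ ha₀).1 ha₀2 (m := 20)
      (by norm_num) (by norm_num)
    have hdist : ∀ a ∈ s, ‖a - a₀‖ ≤ 6 * dyadicScale i := by
      intro a ha
      have h1 := norm_sub_le (a - y) (a₀ - y)
      rw [sub_sub_sub_cancel_right] at h1
      linarith [(hA a ha).2, (hA a₀ ha₀).2]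
    refine (card_le_of_separated_near_plane (F.dim hadm) (F.proj hadm) hr (ρ := 6 * dyadicScale i)
      (by positivity) a₀ s hdist ?_ ?_).trans ?_
    · intro a ha
      refine (F.flat hadm (hA a ha).1 (by linarith [hdist a ha])).trans ?_
      have h1 := F.flatness_le hadm
      have h2 := c.ε_le
      nlinarith
    · exact fun a ha b hb hab => hsep a (hs ha).1 b (hs hb).1 hab
    · have : (6 * dyadicScale i + dyadicScale i / 2) / (dyadicScale i / 4) = 26 := by
        field_simp; norm_num
      rwa [this]
  have hfin : (net S i ∩ Metric.ball y (3 * dyadicScale i)).Finite := by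
    by_contra hinf
    obtain ⟨n, hn⟩ := exists_nat_gt N
    obtain ⟨s, hs, hsn⟩ := Set.Infinite.exists_subset_card_eq hinf n
    have := hcard s hs
    rw [hsn] at this
    linarith
  exact ⟨hfin.toFinset, by simp, hcard _ (by simp)⟩

/-- Distance to the plane of a net point at scale `i` in terms of the reference plane at `p`. -/
theorem norm_sub_apply_le_reference {i : ℕ} {a p : X} (ha : a ∈ S) (ha2 : ‖a‖ < 2) (hp : p ∈ S)
    (hp2 : ‖p‖ < 2) (hap : ‖a - p‖ ≤ 80 * dyadicScale i) (u : X) :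
    ‖u - F.P a (20 * dyadicScale i) u‖ ≤ 2 * K * ‖u - F.P p (100 * dyadicScale i) u‖
      + 20 * K ^ 3 * F.stageFlatness i p * ‖u‖ := by
  have hr := dyadicScale_pos i
  have hK := c.K_pos
  have hadm := isAdmissibleBall_mul_dyadicScale (i := i) ha ha2 (m := 20)
    (by norm_num) (by norm_num)
  have hadm' := isAdmissibleBall_mul_dyadicScale (i := i) hp hp2 (m := 100) (by norm_num) le_rfl
  have hratio : 100 * dyadicScale i / (20 * dyadicScale i) = 5 := by field_simp; norm_num
  have hf := F.flatness_le hadm'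
  have hs : K * F.flatness p (100 * dyadicScale i) * 5 ≤ 1 / 2 := by
    have h1 := c.small_ε
    have h2 : K * F.flatness p (100 * dyadicScale i) ≤ K * ε := by gcongr
    have h3 := mul_nonneg hK.le c.ε_nonneg
    linarith
  have h := F.norm_sub_apply_le_of_larger c.one_le_K hadm hadm' (by linarith)
    (by rwa [hratio]) u
  rw [hratio] at h
  refine h.trans ?_
  have h5 : 20 * K ^ 3 * F.flatness p (100 * dyadicScale i) * ‖u‖
      ≤ 20 * K ^ 3 * F.stageFlatness i p * ‖u‖ := by
    gcongr
    exact F.flatness_le_stageFlatness i p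
  linarith

/-- Vectors in the plane of a net point at scale `i` are close to the reference plane of the next
scale. -/
theorem norm_sub_apply_le_next {i : ℕ} {a p : X} (ha : a ∈ S) (ha2 : ‖a‖ < 2) (hp : p ∈ S)
    (hp2 : ‖p‖ < 2) (hap : ‖a - p‖ ≤ 30 * dyadicScale i) (u : X) :
    ‖F.P a (20 * dyadicScale i) u
        - F.P p (100 * dyadicScale (i + 1)) (F.P a (20 * dyadicScale i) u)‖
      ≤ 5 / 2 * K ^ 2 * F.stageFlatness (i + 1) p * ‖u‖ := by
  have hr := dyadicScale_pos i
  have hK := c.K_pos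
  have hadm := isAdmissibleBall_mul_dyadicScale (i := i) ha ha2 (m := 20)
    (by norm_num) (by norm_num)
  have hadm' := isAdmissibleBall_mul_dyadicScale (i := i + 1) hp hp2 (m := 100) (by norm_num) le_rfl
  have hratio : 100 * dyadicScale (i + 1) / (20 * dyadicScale i) = 5 / 2 := by
    rw [dyadicScale_succ]; field_simp; norm_num
  have h := F.tilt hadm hadm' (by rw [dyadicScale_succ]; linarith) _ ((F.proj hadm).mem u)
  rw [hratio] at h
  refine h.trans ?_
  have h1 : ‖F.P a (20 * dyadicScale i) u‖ ≤ K * ‖u‖ :=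
    (F.P a (20 * dyadicScale i)).le_of_opNorm_le (F.norm_le hadm) u
  have h2 := F.flatness_le_stageFlatness (i + 1) p
  have h3 := F.flatness_nonneg p (100 * dyadicScale (i + 1))
  have h4 := F.stageFlatness_nonneg (i + 1) p
  calc K * F.flatness p (100 * dyadicScale (i + 1)) * (5 / 2) * ‖F.P a (20 * dyadicScale i) u‖
      ≤ K * F.stageFlatness (i + 1) p * (5 / 2) * (K * ‖u‖) := by gcongr
    _ = _ := by ring

variable {T : Set X} {i : ℕ}

/-- The displacement of a point of the surface by the projection at a nearby point of `S`. -/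
theorem norm_displacement_le (hT : F.Stage CA CB i T) {y a p : X} (hy : y ∈ T)
    (hy1 : ‖y‖ ≤ 1 + 40 * dyadicScale i) (ha : a ∈ S) (hay : ‖a - y‖ ≤ 6 * dyadicScale i)
    (hp : p ∈ S) (hyp : ‖y - p‖ ≤ 10 * dyadicScale i) :
    ‖(a - y) - F.P a (20 * dyadicScale i) (a - y)‖
      ≤ CD * F.stageFlatness i p * dyadicScale i := by
  have hr := dyadicScale_pos i
  have hK := c.K_pos
  have hb := F.stageFlatness_nonneg i p
  have hp2 : ‖p‖ < 2 := norm_lt_two_of_close hy1 (by linarith)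
  have ha2 : ‖a‖ < 2 := norm_lt_two_of_close hy1 (by rw [norm_sub_rev]; linarith)
  have hap : ‖a - p‖ ≤ 16 * dyadicScale i := by
    have := norm_add_le (a - y) (y - p)
    rw [sub_add_sub_cancel] at this
    linarith
  have hadm' := isAdmissibleBall_mul_dyadicScale (i := i) hp hp2 (m := 100) (by norm_num) le_rfl
  have h1 := F.norm_sub_apply_le_reference c ha ha2 hp hp2 (by linarith) (a - y)
  have h2 := F.flat hadm' ha (by linarith)
  have h3 := hT.height y hy hy1 p hp hyp
  have h4 : (a - y) - F.P p (100 * dyadicScale i) (a - y)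
      = ((a - p) - F.P p (100 * dyadicScale i) (a - p))
        - ((y - p) - F.P p (100 * dyadicScale i) (y - p)) := by
    simp only [map_sub]; abel
  have h5 := norm_sub_le ((a - p) - F.P p (100 * dyadicScale i) (a - p))
    ((y - p) - F.P p (100 * dyadicScale i) (y - p))
  rw [← h4] at h5
  have h6 : F.flatness p (100 * dyadicScale i) * (100 * dyadicScale i)
      ≤ F.stageFlatness i p * (100 * dyadicScale i) := by
    gcongr
    exact F.flatness_le_stageFlatness i p
  have h7 : 2 * K * ‖(a - y) - F.P p (100 * dyadicScale i) (a - y)‖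
      ≤ 2 * K * ((100 + CA) * F.stageFlatness i p * dyadicScale i) := by
    gcongr
    linarith
  have h8 : 20 * K ^ 3 * F.stageFlatness i p * ‖a - y‖
      ≤ 20 * K ^ 3 * F.stageFlatness i p * (6 * dyadicScale i) := by gcongr
  have h9 : (2 * K * (100 + CA) + 120 * K ^ 3) * (F.stageFlatness i p * dyadicScale i)
      ≤ CD * (F.stageFlatness i p * dyadicScale i) := by
    gcongr
    exact c.le_CD
  linarith

/-- Only points in the part of the ball where the construction continues are moved. -/
theorem norm_le_of_mem_nearPoints (hN : (26 : ℝ) ^ k ≤ N) {a y : X}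
    (ha : a ∈ nearPoints (net S i) (dyadicScale i) y) :
    a ∈ S ∧ ‖a - y‖ < 3 * dyadicScale i ∧ ‖y‖ ≤ 1 + 24 * dyadicScale i := by
  obtain ⟨h1, h2⟩ := (mem_nearPoints (F.hasBoundedOverlap c hN i)).1 ha
  have h3 := (net_spec S i).1 h1
  have h4 : ‖a‖ ≤ 1 + 21 * dyadicScale i := h3.2
  have h5 := norm_sub_norm_le y a
  rw [norm_sub_rev] at h5
  exact ⟨h3.1, h2, by linarith⟩

theorem norm_step_sub_le (hN : (26 : ℝ) ^ k ≤ N) (hT : F.Stage CA CB i T) {y p : X} (hy : y ∈ T)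
    (hp : p ∈ S) (hyp : ‖y - p‖ ≤ 10 * dyadicScale i) :
    ‖F.step i y - y‖ ≤ CD * F.stageFlatness i p * dyadicScale i := by
  have hr := dyadicScale_pos i
  have hb := F.stageFlatness_nonneg i p
  have hCD := c.CA_ge.trans c.CA_le
  refine norm_averagedProjection_sub_le (by positivity) y fun a ha => ?_
  obtain ⟨h1, h2, h3⟩ := F.norm_le_of_mem_nearPoints c hN ha
  exact F.norm_displacement_le c hT hy (by linarith) h1 (by linarith) hp hyp

theorem step_eq_self (hN : (26 : ℝ) ^ k ≤ N) {y : X} (hy : 1 + 24 * dyadicScale i < ‖y‖) :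
    F.step i y = y := by
  refine averagedProjection_eq_self (Finset.eq_empty_of_forall_notMem fun a ha => ?_)
  linarith [(F.norm_le_of_mem_nearPoints c hN ha).2.2]

/-- The step moves the points of the surface by a small fraction of the scale. -/
theorem norm_step_sub_le_scale (hN : (26 : ℝ) ^ k ≤ N) (h0 : (0 : X) ∈ S)
    (hT : F.Stage CA CB i T) {y : X} (hy : y ∈ T) :
    ‖F.step i y - y‖ ≤ dyadicScale i / 100 ∧ K * ‖F.step i y - y‖ ≤ dyadicScale i / 100 := by
  have hr := dyadicScale_pos i
  have hK := c.K_pos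
  rcases lt_or_ge (1 + 24 * dyadicScale i) ‖y‖ with h | h
  · rw [F.step_eq_self c hN h, sub_self, norm_zero]
    constructor <;> linarith
  · obtain ⟨p, hp, hyp⟩ := hT.near y hy (by linarith)
    have hp2 : ‖p‖ < 2 := norm_lt_two_of_close (by linarith) (hyp.trans (by linarith))
    have h1 := F.norm_step_sub_le c hN hT hy hp (by linarith)
    have h2 := F.stageFlatness_le h0 c.ε_nonneg (i := i) hp hp2
    have h3 : CD * F.stageFlatness i p * dyadicScale i ≤ CE * (2 * ε) * dyadicScale i := by
      have h4 := F.stageFlatness_nonneg i p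
      have h5 := c.CE_ge
      gcongr
      exact c.CD_le_CE
    have h4 : K * ‖F.step i y - y‖ ≤ dyadicScale i / 100 := by
      calc K * ‖F.step i y - y‖ ≤ K * (CE * (2 * ε) * dyadicScale i) := by gcongr; linarith
        _ = 2 * (K * (CE * ε)) * dyadicScale i := by ring
        _ ≤ (1 / 100) * dyadicScale i := by gcongr; linarith [c.small_KCE]
        _ = _ := by ring
    refine ⟨?_, h4⟩
    have := c.one_le_K
    nlinarith [norm_nonneg (F.step i y - y)]

open Classical in
/-- The change of a short difference vector of the surface under the step: a sum of vectors `E a`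
in the kernels of the projections, of size controlled by the flatness, while the difference vector
itself is close to the ranges of these projections. -/
theorem exists_step_sub_eq (hN : (26 : ℝ) ^ k ≤ N) (hT : F.Stage CA CB i T) {y z p : X}
    (hy : y ∈ T) (hz : z ∈ T) (hy1 : ‖y‖ ≤ 1 + 40 * dyadicScale i)
    (hz1 : ‖z‖ ≤ 1 + 40 * dyadicScale i) (hyz : ‖y - z‖ ≤ 3 * dyadicScale i) (hp : p ∈ S)
    (hyp : ‖y - p‖ ≤ 7 * dyadicScale i) :
    ∃ (G : Finset X) (E : X → X), (G.card : ℝ) ≤ 2 * N ∧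
      F.step i y - F.step i z = (y - z) + ∑ a ∈ G, E a ∧
      ∀ a ∈ G, a ∈ S ∧ ‖a‖ < 2 ∧ F.P a (20 * dyadicScale i) (E a) = 0 ∧
        ‖E a‖ ≤ CE * F.stageFlatness i p * ‖y - z‖ ∧
        ‖(y - z) - F.P a (20 * dyadicScale i) (y - z)‖
          ≤ CE * F.stageFlatness i p * ‖y - z‖ := by
  have hr := dyadicScale_pos i
  have hK := c.K_pos
  have hN1 := c.one_le_N
  have hb := F.stageFlatness_nonneg i p
  have hov := F.hasBoundedOverlap c hN i
  have hCD := c.CA_ge.trans c.CA_le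
  refine ⟨_, _, card_union_nearPoints_le hov y z, averagedProjection_sub hr hov y z,
    fun a ha => ?_⟩
  have haA : a ∈ net S i := (Finset.mem_union.1 ha).elim (fun h => ((mem_nearPoints hov).1 h).1)
      fun h => ((mem_nearPoints hov).1 h).1
  have haS := (net_spec S i).1 haA
  have ha2 : ‖a‖ < 2 := by
    have : ‖a‖ ≤ 1 + 21 * dyadicScale i := haS.2
    linarith [dyadicScale_le i]
  have hadm := isAdmissibleBall_mul_dyadicScale (i := i) haS.1 ha2 (m := 20)
    (by norm_num) (by norm_num)
  have hdist : ‖a - z‖ ≤ 6 * dyadicScale i ∧ ‖a - y‖ ≤ 6 * dyadicScale i := by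
    have e1 := norm_add_le (a - y) (y - z)
    have e2 := norm_sub_le (a - z) (y - z)
    rw [sub_add_sub_cancel] at e1
    rw [sub_sub_sub_cancel_right] at e2
    rcases Finset.mem_union.1 ha with h | h
    · have := ((mem_nearPoints hov).1 h).2
      constructor <;> linarith
    · have := ((mem_nearPoints hov).1 h).2
      constructor <;> linarith
  have hzp : ‖z - p‖ ≤ 10 * dyadicScale i := by
    have e1 := norm_sub_le (y - p) (y - z)
    rw [sub_sub_sub_cancel_left] at e1
    linarith
  have hap : ‖a - p‖ ≤ 80 * dyadicScale i := by
    have e1 := norm_add_le (a - y) (y - p)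
    rw [sub_add_sub_cancel] at e1
    linarith
  have hp2 : ‖p‖ < 2 := norm_lt_two_of_close hy1 (by linarith)
  -- The difference vector is close to the plane at `a`.
  have hdir : ‖(y - z) - F.P a (20 * dyadicScale i) (y - z)‖
      ≤ (2 * K * CB + 20 * K ^ 3) * F.stageFlatness i p * ‖y - z‖ := by
    have h1 := F.norm_sub_apply_le_reference c haS.1 ha2 hp hp2 hap (y - z)
    have h2 := hT.angle y hy z hz hy1 hz1 hyz p hp (by linarith)
    have h3 : 2 * K * ‖(y - z) - F.P p (100 * dyadicScale i) (y - z)‖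
      ≤ 2 * K * (CB * F.stageFlatness i p * ‖y - z‖) := by gcongr
    linarith
  have hCE1 : (2 * K * CB + 20 * K ^ 3) * F.stageFlatness i p * ‖y - z‖
      + (1 + 2 * N) * CD * (F.stageFlatness i p * ‖y - z‖)
      ≤ CE * F.stageFlatness i p * ‖y - z‖ := by
    have : (2 * K * CB + 20 * K ^ 3 + (1 + 2 * N) * CD) * (F.stageFlatness i p * ‖y - z‖)
        ≤ CE * (F.stageFlatness i p * ‖y - z‖) := by
      gcongr
      exact c.le_CE
    linarith
  have hnn : 0 ≤ (1 + 2 * N) * CD * (F.stageFlatness i p * ‖y - z‖) := by positivity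
  refine ⟨haS.1, ha2, (F.proj hadm).map_sub_self _, ?_, by linarith⟩
  set μ := netWeight (net S i) (dyadicScale i) a y with hμ
  set ν := netWeight (net S i) (dyadicScale i) a z with hν
  have hμ0 : 0 ≤ μ := netWeight_nonneg a y
  have hμ1 : μ ≤ 1 := netWeight_le_one hr hov haA
  have hμν : |μ - ν| ≤ (1 + 2 * N) * (‖y - z‖ / dyadicScale i) :=
    abs_netWeight_sub_le hr hov haA y z
  have h4 : (μ • (a - y) - ν • (a - z))
      - F.P a (20 * dyadicScale i) (μ • (a - y) - ν • (a - z))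
      = (μ - ν) • ((a - z) - F.P a (20 * dyadicScale i) (a - z))
        - μ • ((y - z) - F.P a (20 * dyadicScale i) (y - z)) := by
    simp only [map_sub, map_smul, smul_sub, sub_smul]
    abel
  rw [h4]
  refine (norm_sub_le _ _).trans ?_
  rw [norm_smul, norm_smul, Real.norm_eq_abs, Real.norm_of_nonneg hμ0]
  have h5 := F.norm_displacement_le c hT hz hz1 haS.1 hdist.1 hp hzp
  have h6 : |μ - ν| * ‖(a - z) - F.P a (20 * dyadicScale i) (a - z)‖
      ≤ (1 + 2 * N) * (‖y - z‖ / dyadicScale i)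
        * (CD * F.stageFlatness i p * dyadicScale i) := by gcongr
  have h7 : (1 + 2 * N) * (‖y - z‖ / dyadicScale i) * (CD * F.stageFlatness i p * dyadicScale i)
      = (1 + 2 * N) * CD * (F.stageFlatness i p * ‖y - z‖) := by
    field_simp
  have h8 : μ * ‖(y - z) - F.P a (20 * dyadicScale i) (y - z)‖
      ≤ 1 * ‖(y - z) - F.P a (20 * dyadicScale i) (y - z)‖ := by gcongr
  linarith

/-- The step is a small perturbation of the identity on the surface, at distances comparable to
the scale. -/
theorem norm_step_sub_sub_le (hN : (26 : ℝ) ^ k ≤ N) (h0 : (0 : X) ∈ S)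
    (hT : F.Stage CA CB i T) {y z : X} (hy : y ∈ T) (hz : z ∈ T)
    (hy1 : ‖y‖ ≤ 1 + 40 * dyadicScale i) (hz1 : ‖z‖ ≤ 1 + 40 * dyadicScale i)
    (hyz : ‖y - z‖ ≤ 3 * dyadicScale i) :
    K * ‖(F.step i y - F.step i z) - (y - z)‖ ≤ 1 / 100 * ‖y - z‖ := by
  have hr := dyadicScale_pos i
  have hK := c.K_pos
  have hN1 := c.one_le_N
  have hCE := c.CE_ge
  obtain ⟨p, hp, hyp⟩ := hT.near y hy hy1
  have hp2 : ‖p‖ < 2 := norm_lt_two_of_close hy1 (by linarith)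
  obtain ⟨G, E, hG, hsub, hE⟩ :=
    F.exists_step_sub_eq c hN hT hy hz hy1 hz1 hyz hp (by linarith)
  have hb := F.stageFlatness_le h0 c.ε_nonneg (i := i) hp hp2
  rw [hsub, add_sub_cancel_left]
  calc K * ‖∑ a ∈ G, E a‖ ≤ K * ∑ a ∈ G, CE * (2 * ε) * ‖y - z‖ := by
        gcongr
        refine norm_sum_le_of_le _ fun a ha => (hE a ha).2.2.2.1.trans ?_
        gcongr
    _ = K * (G.card * (CE * (2 * ε) * ‖y - z‖)) := by simp
    _ ≤ K * (2 * N * (CE * (2 * ε) * ‖y - z‖)) := by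
        have := c.ε_nonneg
        gcongr
    _ = 4 * (K * (N * (CE * ε))) * ‖y - z‖ := by ring
    _ ≤ 1 / 100 * ‖y - z‖ := by
        gcongr
        linarith [c.small_CE]

end

end FlatSystem

/-! ### The stages of the construction -/

theorem StepConstants.small_K2 {K N CA CB CD CE ε : ℝ} (c : StepConstants K N CA CB CD CE ε) :
    1000 * (160000 * (K ^ 2 * ε)) ≤ 1 := by
  have h := c.small
  have h1 : 160000 ≤ N * CE := by
    have := c.CE_ge
    nlinarith [c.one_le_N]
  have h2 : 0 ≤ K ^ 2 * ε := by
    have := c.ε_nonneg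
    positivity
  nlinarith

theorem StepConstants.small_CB {K N CA CB CD CE ε : ℝ} (c : StepConstants K N CA CB CD CE ε) :
    1000 * (K * (CB * (2 * ε))) ≤ 1 := by
  have h1 : 2 * K * CB * ε ≤ CE * ε := by
    have := c.ε_nonneg
    gcongr
    exact c.CB_le_CE
  linarith [c.small_CE']

/-- A map of a complete space that is close to the identity covers a ball. -/
theorem exists_eq_of_close_to_id {E : Type*} [NormedAddCommGroup E] [NormedSpace ℝ E]
    [CompleteSpace E] {R : ℝ} (hR : 0 ≤ R) {G : E → E} (hG0 : G 0 = 0)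
    (hG : ∀ x y, ‖x‖ ≤ R → ‖y‖ ≤ R → ‖G x - G y - (x - y)‖ ≤ 1 / 4 * ‖x - y‖) {w : E}
    (hw : ‖w‖ ≤ 3 / 4 * R) : ∃ x, ‖x‖ ≤ R ∧ G x = w := by
  have happ : ApproximatesLinearOn G (ContinuousLinearMap.id ℝ E) (Metric.closedBall 0 R)
      (1 / 4 : ℝ≥0) := by
    intro x hx y hy
    simpa using hG x y (by simpa using hx) (by simpa using hy)
  have hsurj := happ.surjOn_closedBall_of_nonlinearRightInverse
    ⟨fun x => x, 1, by simp, by intro; simp⟩ hR subset_rfl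
  obtain ⟨x, hx, hxw⟩ := hsurj (show w ∈ _ by
    rw [hG0, mem_closedBall_zero_iff]
    refine hw.trans_eq ?_
    norm_num)
  exact ⟨x, by simpa using hx, hxw⟩

theorem isAdmissibleBall_base {Y : Type*} [NormedAddCommGroup Y] {S : Set Y} (h0 : (0 : Y) ∈ S) :
    IsAdmissibleBall S 0 (19 / 10) :=
  ⟨h0, by simp, by norm_num, by norm_num⟩

namespace FlatSystem

variable {k : ℕ} {K ε : ℝ} {S : Set X} (F : FlatSystem k K ε S)
  {N CA CB CD CE : ℝ} (c : StepConstants K N CA CB CD CE ε)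

/-- The initial plane. -/
noncomputable def basePlane : Submodule ℝ X := F.W 0 (19 / 10)

include F

include c

/-- The initial plane in terms of the reference planes of stage `0`. -/
theorem norm_sub_apply_le_base (h0 : (0 : X) ∈ S) {p : X} (hp : p ∈ S) (hp2 : ‖p‖ ≤ 3 / 2) {v : X}
    (hv : v ∈ F.basePlane) : ‖v - F.P p (100 * dyadicScale 0) v‖
      ≤ 76 * K ^ 2 * F.flatness 0 (19 / 10) * ‖v‖ := by
  have hadm0 := isAdmissibleBall_base h0
  have hadm := isAdmissibleBall_mul_dyadicScale (i := 0) hp (by linarith) (m := 100)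
    (by norm_num) le_rfl
  have hratio : 19 / 10 / (100 * dyadicScale 0) = 19 := by
    unfold dyadicScale; norm_num
  have hf := F.flatness_le hadm0
  have hs : K * F.flatness 0 (19 / 10) * 19 ≤ 1 / 2 := by
    have h1 := c.small_ε
    have h2 : K * F.flatness 0 (19 / 10) ≤ K * ε := by
      have := c.K_pos
      gcongr
    linarith [mul_nonneg c.K_pos.le c.ε_nonneg]
  have h := F.tilt_reverse c.one_le_K hadm hadm0
    (by rw [sub_zero]; unfold dyadicScale; norm_num; linarith) (by rwa [hratio]) v hv
  rw [hratio] at h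
  linarith

theorem stage_zero (h0 : (0 : X) ∈ S) : F.Stage CA CB 0 (F.basePlane : Set X) := by
  have hadm0 := isAdmissibleBall_base h0
  have hf0 := F.flatness_nonneg 0 (19 / 10)
  have hf1 := F.flatness_le hadm0
  have hK := c.K_pos
  have hK2 : 1 ≤ K ^ 2 := one_le_pow₀ c.one_le_K
  have hsc : dyadicScale 0 = 1 / 1000 := by unfold dyadicScale; norm_num
  have hst : ∀ p, F.flatness 0 (19 / 10) ≤ F.stageFlatness 0 p := fun p => by
    unfold stageFlatness
    rw [if_pos rfl]
    linarith [F.flatness_nonneg p (100 * dyadicScale 0)]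
  have hnorm : ∀ y p : X, ‖y‖ ≤ 1 + 40 * dyadicScale 0 → ‖y - p‖ ≤ 10 * dyadicScale 0 →
      ‖p‖ ≤ 11 / 10 := by
    intro y p h1 h2
    have := norm_sub_norm_le p y
    rw [norm_sub_rev] at this
    rw [hsc] at *
    linarith
  have hCA : 160000 * K ^ 2 ≤ CA := c.le_CA
  have hCB : 76 * K ^ 2 ≤ CB := by
    have h1 := c.le_CB
    have h2 : 1 ≤ N ^ 2 := one_le_pow₀ c.one_le_N
    nlinarith
  refine ⟨fun y hy hy1 => ?_, fun y hy hy1 p hp hyp => ?_, fun y hy z hz hy1 _ _ p hp hyp => ?_,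
    fun y hy hy1 p hp hyp t ht _ => ?_⟩
  · obtain ⟨s, hs, hsy⟩ := F.cover hadm0 y hy (by rw [hsc] at hy1; linarith)
    refine ⟨s, hs, ?_⟩
    rw [sub_zero, norm_sub_rev] at hsy
    rw [hsc]
    linarith [c.ε_le]
  · have hp2 := hnorm y p hy1 hyp
    have h1 := F.norm_sub_apply_le_base c h0 hp (by linarith)
      (F.basePlane.sub_mem hy ((F.proj hadm0).mem p))
    have h2 := F.flat hadm0 hp (by rw [sub_zero]; linarith)
    rw [sub_zero] at h2
    have hadm := isAdmissibleBall_mul_dyadicScale (i := 0) hp (by linarith) (m := 100)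
      (by norm_num) le_rfl
    have h3 := norm_sub_apply_le (F.norm_le hadm) c.one_le_K (p - F.P 0 (19 / 10) p)
    have h4 : (y - p) - F.P p (100 * dyadicScale 0) (y - p)
        = ((y - F.P 0 (19 / 10) p) - F.P p (100 * dyadicScale 0) (y - F.P 0 (19 / 10) p))
          - ((p - F.P 0 (19 / 10) p)
            - F.P p (100 * dyadicScale 0) (p - F.P 0 (19 / 10) p)) := by
      simp only [map_sub]; abel
    have h5 : ‖y - F.P 0 (19 / 10) p‖ ≤ 1 := by
      have e : y - F.P 0 (19 / 10) p = (y - p) + (p - F.P 0 (19 / 10) p) := by abel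
      rw [e]
      have := norm_add_le (y - p) (p - F.P 0 (19 / 10) p)
      rw [hsc] at hyp
      linarith [c.ε_le]
    rw [h4]
    refine (norm_sub_le _ _).trans ?_
    have h6 : 76 * K ^ 2 * F.flatness 0 (19 / 10) * ‖y - F.P 0 (19 / 10) p‖
        ≤ 76 * K ^ 2 * F.flatness 0 (19 / 10) * 1 := by gcongr
    have h7 : 2 * K * ‖p - F.P 0 (19 / 10) p‖
        ≤ 2 * K ^ 2 * (F.flatness 0 (19 / 10) * (19 / 10)) := by
      gcongr
      exact le_self_pow₀ c.one_le_K (by norm_num)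
    have h8 : 160000 * K ^ 2 * F.flatness 0 (19 / 10) ≤ CA * F.stageFlatness 0 p := by
      have := c.CA_ge
      gcongr
      exact hst p
    have h9 : 0 ≤ K ^ 2 * F.flatness 0 (19 / 10) := by positivity
    rw [hsc] at *
    linarith
  · refine (F.norm_sub_apply_le_base c h0 hp (by linarith [hnorm y p hy1 hyp])
      (F.basePlane.sub_mem hy hz)).trans ?_
    have := c.CB_ge
    gcongr
    exact hst p
  · have hp2 := hnorm y p (hy1.trans (by rw [hsc]; norm_num)) (hyp.trans (by rw [hsc]; norm_num))
    have hadm := isAdmissibleBall_mul_dyadicScale (i := 0) hp (by linarith) (m := 100)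
      (by norm_num) le_rfl
    have hη : 76 * K ^ 2 * F.flatness 0 (19 / 10) ≤ 1 / 2 := by
      have h1 := c.small_K2
      have h2 : K ^ 2 * F.flatness 0 (19 / 10) ≤ K ^ 2 * ε := by gcongr
      have h3 : 0 ≤ K ^ 2 * ε := by have := c.ε_nonneg; positivity
      linarith
    obtain ⟨v, hv, hvt, hvn⟩ := exists_apply_eq_of_close (F.dim hadm0) (F.dim hadm) (F.proj hadm) hη
      (fun v hv => F.norm_sub_apply_le_base c h0 hp (by linarith) hv) ht
    exact ⟨y + v, F.basePlane.add_mem hy hv, by simpa using hvn, by simpa using hvt⟩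

variable {T : Set X} {i : ℕ}

/-- In the part of the ball that remains for the next stage, the weights have sum `1`. -/
theorem sum_netWeight_eq_one_of_stage (hN : (26 : ℝ) ^ k ≤ N) (hT : F.Stage CA CB i T) {y : X}
    (hy : y ∈ T) (hy1 : ‖y‖ ≤ 1 + 41 / 2 * dyadicScale i) :
    ∑ a ∈ nearPoints (net S i) (dyadicScale i) y, netWeight (net S i) (dyadicScale i) a y = 1 := by
  have hr := dyadicScale_pos i
  obtain ⟨p, hp, hyp⟩ := hT.near y hy (by linarith)
  have hp2 : ‖p‖ ≤ 1 + 21 * dyadicScale i := by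
    have := norm_sub_norm_le p y
    rw [norm_sub_rev] at this
    linarith
  obtain ⟨a, ha, hap⟩ := (net_spec S i).2.2 p ⟨hp, hp2⟩
  refine sum_netWeight_eq_one hr (F.hasBoundedOverlap c hN i) ⟨a, ha, ?_⟩
  have := norm_sub_le (a - p) (y - p)
  rw [sub_sub_sub_cancel_right] at this
  linarith

theorem norm_le_of_norm_step_le (hN : (26 : ℝ) ^ k ≤ N) (h0 : (0 : X) ∈ S)
    (hT : F.Stage CA CB i T) {y : X} (hy : y ∈ T) :
    ‖y‖ ≤ ‖F.step i y‖ + dyadicScale i / 100 := by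
  have h1 := (F.norm_step_sub_le_scale c hN h0 hT hy).1
  have h2 := norm_sub_norm_le y (F.step i y)
  rw [norm_sub_rev] at h2
  linarith

theorem near_succ (hN : (26 : ℝ) ^ k ≤ N) (h0 : (0 : X) ∈ S) (hT : F.Stage CA CB i T) {y : X}
    (hy : y ∈ T) (hy1 : ‖F.step i y‖ ≤ 1 + 40 * dyadicScale (i + 1)) :
    ∃ p ∈ S, ‖F.step i y - p‖ ≤ dyadicScale (i + 1) / 10 := by
  have hr := dyadicScale_pos i
  rw [dyadicScale_succ] at *
  have hy2 := F.norm_le_of_norm_step_le c hN h0 hT hy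
  have hdisp := F.norm_step_sub_le_scale c hN h0 hT hy
  obtain ⟨p, hp, hyp⟩ := hT.near y hy (by linarith)
  have hp2 : ‖p‖ < 2 := norm_lt_two_of_close (i := i) (y := y) (by linarith) (by linarith)
  have hadm := isAdmissibleBall_mul_dyadicScale (i := i) hp hp2 (m := 100) (by norm_num) le_rfl
  have h1 := hT.height y hy (by linarith) p hp (by linarith)
  have h2 := norm_sub_apply_le (F.norm_le hadm) c.one_le_K (F.step i y - y)
  have h3 := F.stageFlatness_le h0 c.ε_nonneg (i := i) hp hp2
  set u := F.step i y - p with hu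
  have h4 : ‖u - F.P p (100 * dyadicScale i) u‖ ≤ dyadicScale i / 40 := by
    have e1 : u - F.P p (100 * dyadicScale i) u
        = ((F.step i y - y) - F.P p (100 * dyadicScale i) (F.step i y - y))
          + ((y - p) - F.P p (100 * dyadicScale i) (y - p)) := by
      rw [hu]; simp only [map_sub]; abel
    have e2 := norm_add_le ((F.step i y - y) - F.P p (100 * dyadicScale i) (F.step i y - y))
      ((y - p) - F.P p (100 * dyadicScale i) (y - p))
    rw [← e1] at e2
    have e3 : CA * F.stageFlatness i p * dyadicScale i ≤ dyadicScale i / 200 := by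
      calc CA * F.stageFlatness i p * dyadicScale i ≤ CE * (2 * ε) * dyadicScale i := by
            have := F.stageFlatness_nonneg i p
            have := c.CE_ge
            gcongr
            exact c.CA_le.trans c.CD_le_CE
        _ = 2 * (CE * ε) * dyadicScale i := by ring
        _ ≤ 1 / 200 * dyadicScale i := by
            gcongr
            linarith [c.small_CE']
        _ = _ := by ring
    linarith [hdisp.2]
  have h5 : ‖u‖ ≤ dyadicScale i := by
    have : u = (F.step i y - y) + (y - p) := by rw [hu]; abel
    rw [this]
    linarith [norm_add_le (F.step i y - y) (y - p), hdisp.1]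
  have h6 : ‖F.P p (100 * dyadicScale i) u‖ ≤ 3 / 4 * (100 * dyadicScale i) := by
    have := norm_sub_le u (u - F.P p (100 * dyadicScale i) u)
    rw [sub_sub_cancel] at this
    linarith
  obtain ⟨s, hs, hsu⟩ := F.cover hadm _ ((F.proj hadm).mem u) h6
  refine ⟨s, hs, ?_⟩
  have h7 : F.step i y - s
      = (u - F.P p (100 * dyadicScale i) u) - (s - p - F.P p (100 * dyadicScale i) u) := by
    rw [hu]; abel
  rw [h7]
  refine (norm_sub_le _ _).trans ?_
  have h8 : ε * (100 * dyadicScale i) ≤ 1 / 1000 * dyadicScale i := by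
    have := c.ε_le
    nlinarith
  linarith

/-- A combination of projected net points is close to the reference plane of the next scale. -/
theorem norm_affine_sub_apply_le_next {a p : X} (ha : a ∈ S) (ha2 : ‖a‖ < 2) (hp : p ∈ S)
    (hp2 : ‖p‖ < 2) (hap : ‖a - p‖ ≤ 30 * dyadicScale i) {u : X}
    (hu : ‖u‖ ≤ 6 * dyadicScale i) :
    ‖((a - p) + F.P a (20 * dyadicScale i) u) - F.P p (100 * dyadicScale (i + 1))
        ((a - p) + F.P a (20 * dyadicScale i) u)‖
      ≤ 65 * K ^ 2 * F.stageFlatness (i + 1) p * dyadicScale i := by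
  have hr := dyadicScale_pos i
  have hadm' := isAdmissibleBall_mul_dyadicScale (i := i + 1) hp hp2 (m := 100) (by norm_num) le_rfl
  have h1 := F.norm_sub_apply_le_next c ha ha2 hp hp2 hap u
  have h2 := F.flat hadm' ha (by rw [dyadicScale_succ]; linarith)
  have hb := F.stageFlatness_nonneg (i + 1) p
  have h3 : F.flatness p (100 * dyadicScale (i + 1)) * (100 * dyadicScale (i + 1))
      ≤ 50 * (K ^ 2 * (F.stageFlatness (i + 1) p * dyadicScale i)) := by
    have e1 : F.stageFlatness (i + 1) p * dyadicScale i
        ≤ K ^ 2 * (F.stageFlatness (i + 1) p * dyadicScale i) :=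
      le_mul_of_one_le_left (by positivity) (one_le_pow₀ c.one_le_K)
    have e2 : F.flatness p (100 * dyadicScale (i + 1)) * dyadicScale i
        ≤ F.stageFlatness (i + 1) p * dyadicScale i := by
      gcongr
      exact F.flatness_le_stageFlatness (i + 1) p
    rw [dyadicScale_succ] at *
    linarith
  have h4 : 5 / 2 * K ^ 2 * F.stageFlatness (i + 1) p * ‖u‖
      ≤ 5 / 2 * K ^ 2 * F.stageFlatness (i + 1) p * (6 * dyadicScale i) := by gcongr
  have h5 : ((a - p) + F.P a (20 * dyadicScale i) u) - F.P p (100 * dyadicScale (i + 1))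
        ((a - p) + F.P a (20 * dyadicScale i) u)
      = ((a - p) - F.P p (100 * dyadicScale (i + 1)) (a - p))
        + (F.P a (20 * dyadicScale i) u - F.P p (100 * dyadicScale (i + 1))
          (F.P a (20 * dyadicScale i) u)) := by
    rw [map_add]; abel
  rw [h5]
  refine (norm_add_le _ _).trans ?_
  linarith

/-- Net points near a point of the surface, relative to a point `p` close to its image. -/
theorem net_point_bounds (hN : (26 : ℝ) ^ k ≤ N) (h0 : (0 : X) ∈ S)
    (hT : F.Stage CA CB i T) {y p : X} (hy : y ∈ T)
    (hyp : ‖F.step i y - p‖ ≤ 20 * dyadicScale i) {a : X}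
    (ha : a ∈ nearPoints (net S i) (dyadicScale i) y) :
    a ∈ S ∧ ‖a‖ < 2 ∧ ‖y - a‖ ≤ 3 * dyadicScale i ∧ ‖a - p‖ ≤ 30 * dyadicScale i := by
  have hr := dyadicScale_pos i
  obtain ⟨h1, h2, h3⟩ := F.norm_le_of_mem_nearPoints c hN ha
  have h4 := (F.norm_step_sub_le_scale c hN h0 hT hy).1
  rw [norm_sub_rev] at h4
  rw [norm_sub_rev] at h2
  refine ⟨h1, norm_lt_two_of_close (i := i) (y := y) (by linarith) (by linarith), h2.le, ?_⟩
  have h5 : a - p = ((y - F.step i y) + (F.step i y - p)) - (y - a) := by abel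
  rw [h5]
  have h6 := norm_sub_le ((y - F.step i y) + (F.step i y - p)) (y - a)
  have h7 := norm_add_le (y - F.step i y) (F.step i y - p)
  linarith

theorem height_succ (hN : (26 : ℝ) ^ k ≤ N) (h0 : (0 : X) ∈ S) (hT : F.Stage CA CB i T) {y p : X}
    (hy : y ∈ T) (hy1 : ‖F.step i y‖ ≤ 1 + 40 * dyadicScale (i + 1)) (hp : p ∈ S)
    (hyp : ‖F.step i y - p‖ ≤ 10 * dyadicScale (i + 1)) :
    ‖(F.step i y - p) - F.P p (100 * dyadicScale (i + 1)) (F.step i y - p)‖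
      ≤ CA * F.stageFlatness (i + 1) p * dyadicScale (i + 1) := by
  have hr := dyadicScale_pos i
  have hb := F.stageFlatness_nonneg (i + 1) p
  have hp2 : ‖p‖ < 2 := norm_lt_two_of_close hy1 (hyp.trans (by
    have := dyadicScale_pos (i + 1); linarith))
  have hy2 := F.norm_le_of_norm_step_le c hN h0 hT hy
  have hsum := F.sum_netWeight_eq_one_of_stage c hN hT hy
    (by rw [dyadicScale_succ] at hy1; linarith)
  have hyp' : ‖F.step i y - p‖ ≤ 20 * dyadicScale i := by
    rw [dyadicScale_succ] at hyp; linarith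
  have heq : F.step i y - p = ∑ a ∈ nearPoints (net S i) (dyadicScale i) y,
      netWeight (net S i) (dyadicScale i) a y • ((a - p) + F.P a (20 * dyadicScale i) (y - a)) :=
    averagedProjection_sub_of_sum_eq_one hsum p
  rw [heq, map_sum, ← Finset.sum_sub_distrib]
  have hterm : ∀ a ∈ nearPoints (net S i) (dyadicScale i) y,
      ‖netWeight (net S i) (dyadicScale i) a y • ((a - p) + F.P a (20 * dyadicScale i) (y - a))
        - F.P p (100 * dyadicScale (i + 1)) (netWeight (net S i) (dyadicScale i) a y •
          ((a - p) + F.P a (20 * dyadicScale i) (y - a)))‖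
      ≤ netWeight (net S i) (dyadicScale i) a y
        * (65 * K ^ 2 * F.stageFlatness (i + 1) p * dyadicScale i) := by
    intro a ha
    obtain ⟨h1, h2, h3, h4⟩ := F.net_point_bounds c hN h0 hT hy hyp' ha
    rw [map_smul, ← smul_sub, norm_smul, Real.norm_of_nonneg (netWeight_nonneg a y)]
    exact mul_le_mul_of_nonneg_left
      (F.norm_affine_sub_apply_le_next c h1 h2 hp hp2 h4 (by linarith)) (netWeight_nonneg a y)
  refine (norm_sum_le_of_le _ hterm).trans ?_
  rw [← Finset.sum_mul, hsum, one_mul, dyadicScale_succ]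
  have h5 : 160000 * K ^ 2 * (F.stageFlatness (i + 1) p * dyadicScale i)
      ≤ CA * (F.stageFlatness (i + 1) p * dyadicScale i) := by
    gcongr
    exact c.le_CA
  have h6 : 0 ≤ K ^ 2 * (F.stageFlatness (i + 1) p * dyadicScale i) := by positivity
  linarith

open Classical in
/-- The slope of the new surface, for points whose preimages are close to each other. -/
theorem angle_succ_of_close (hN : (26 : ℝ) ^ k ≤ N) (h0 : (0 : X) ∈ S) (hT : F.Stage CA CB i T)
    {y z p : X} (hy : y ∈ T) (hz : z ∈ T) (hy1 : ‖y‖ ≤ 1 + 41 / 2 * dyadicScale i)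
    (hz1 : ‖z‖ ≤ 1 + 41 / 2 * dyadicScale i) (hyz : ‖y - z‖ ≤ 3 * dyadicScale i) (hp : p ∈ S)
    (hyp : ‖F.step i y - p‖ ≤ 10 * dyadicScale i) :
    ‖(F.step i y - F.step i z)
        - F.P p (100 * dyadicScale (i + 1)) (F.step i y - F.step i z)‖
      ≤ CB * F.stageFlatness (i + 1) p * ‖F.step i y - F.step i z‖ := by
  have hr := dyadicScale_pos i
  have hK := c.K_pos
  have hN1 := c.one_le_N
  have hb := F.stageFlatness_nonneg (i + 1) p
  have hov := F.hasBoundedOverlap c hN i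
  have hdy := F.norm_step_sub_le_scale c hN h0 hT hy
  have hdz := F.norm_step_sub_le_scale c hN h0 hT hz
  have hpy : ‖y - p‖ ≤ 60 * dyadicScale i := by
    have := norm_sub_le (F.step i y - p) (F.step i y - y)
    rw [sub_sub_sub_cancel_left] at this
    linarith
  have hp2 : ‖p‖ < 2 := norm_lt_two_of_close (i := i) (y := y) (by linarith) hpy
  have hzp : ‖F.step i z - p‖ ≤ 20 * dyadicScale i := by
    have e : F.step i z - p
        = (F.step i z - z) - (F.step i y - y) - (y - z) + (F.step i y - p) := by abel
    rw [e]
    have e1 := norm_add_le ((F.step i z - z) - (F.step i y - y) - (y - z)) (F.step i y - p)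
    have e2 := norm_sub_le ((F.step i z - z) - (F.step i y - y)) (y - z)
    have e3 := norm_sub_le (F.step i z - z) (F.step i y - y)
    linarith
  have hsy := F.sum_netWeight_eq_one_of_stage c hN hT hy hy1
  have hsz := F.sum_netWeight_eq_one_of_stage c hN hT hz hz1
  set u := F.step i y - F.step i z with hu
  set Q := F.P p (100 * dyadicScale (i + 1)) with hQ
  set f := F.stageFlatness (i + 1) p with hf
  have heq : u = ∑ a ∈ nearPoints (net S i) (dyadicScale i) y,
        netWeight (net S i) (dyadicScale i) a y • F.P a (20 * dyadicScale i) (y - z)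
      + ∑ a ∈ nearPoints (net S i) (dyadicScale i) y ∪ nearPoints (net S i) (dyadicScale i) z,
        (netWeight (net S i) (dyadicScale i) a y - netWeight (net S i) (dyadicScale i) a z) •
          ((a - p) + F.P a (20 * dyadicScale i) (z - a)) :=
    averagedProjection_sub_of_sums_eq_one hr hov hsy hsz p
  have hfirst : ‖∑ a ∈ nearPoints (net S i) (dyadicScale i) y,
        netWeight (net S i) (dyadicScale i) a y • (F.P a (20 * dyadicScale i) (y - z)
          - Q (F.P a (20 * dyadicScale i) (y - z)))‖ ≤ 5 / 2 * K ^ 2 * f * ‖y - z‖ := by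
    refine (norm_sum_le_of_le _ fun a ha => ?_ : _ ≤ ∑ a ∈ nearPoints (net S i) (dyadicScale i) y,
        netWeight (net S i) (dyadicScale i) a y * (5 / 2 * K ^ 2 * f * ‖y - z‖)).trans ?_
    · obtain ⟨h1, h2, h3, h4⟩ := F.net_point_bounds c hN h0 hT hy (p := p) (by linarith) ha
      rw [norm_smul, Real.norm_of_nonneg (netWeight_nonneg a y)]
      exact mul_le_mul_of_nonneg_left (F.norm_sub_apply_le_next c h1 h2 hp hp2 h4 _)
        (netWeight_nonneg a y)
    · rw [← Finset.sum_mul, hsy, one_mul]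
  have hsecond : ‖∑ a ∈ nearPoints (net S i) (dyadicScale i) y ∪
        nearPoints (net S i) (dyadicScale i) z,
        (netWeight (net S i) (dyadicScale i) a y - netWeight (net S i) (dyadicScale i) a z) •
          (((a - p) + F.P a (20 * dyadicScale i) (z - a))
            - Q ((a - p) + F.P a (20 * dyadicScale i) (z - a)))‖
      ≤ 390 * N ^ 2 * K ^ 2 * f * ‖y - z‖ := by
    have hterm : ∀ a ∈ nearPoints (net S i) (dyadicScale i) y ∪
        nearPoints (net S i) (dyadicScale i) z,
        ‖(netWeight (net S i) (dyadicScale i) a y - netWeight (net S i) (dyadicScale i) a z) •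
          (((a - p) + F.P a (20 * dyadicScale i) (z - a))
            - Q ((a - p) + F.P a (20 * dyadicScale i) (z - a)))‖
          ≤ (3 * N) * (‖y - z‖ / dyadicScale i) * (65 * K ^ 2 * f * dyadicScale i) := by
      intro a ha
      have hbd : a ∈ net S i ∧ ‖a‖ < 2 ∧ ‖z - a‖ ≤ 6 * dyadicScale i
          ∧ ‖a - p‖ ≤ 30 * dyadicScale i := by
        rcases Finset.mem_union.1 ha with h | h
        · obtain ⟨h1, h2, h3, h4⟩ := F.net_point_bounds c hN h0 hT hy (p := p) (by linarith) h
          refine ⟨((mem_nearPoints hov).1 h).1, h2, ?_, h4⟩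
          have := norm_sub_le (y - a) (y - z)
          rw [sub_sub_sub_cancel_left] at this
          linarith
        · obtain ⟨h1, h2, h3, h4⟩ := F.net_point_bounds c hN h0 hT hz hzp h
          exact ⟨((mem_nearPoints hov).1 h).1, h2, by linarith, h4⟩
      obtain ⟨haA, h2, h3, h4⟩ := hbd
      have h5 := F.norm_affine_sub_apply_le_next c ((net_spec S i).1 haA).1 h2 hp hp2 h4 h3
      have h6 := abs_netWeight_sub_le hr hov haA y z
      have h7 : (1 + 2 * N) * (‖y - z‖ / dyadicScale i) ≤ 3 * N * (‖y - z‖ / dyadicScale i) := by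
        gcongr
        linarith
      rw [norm_smul, Real.norm_eq_abs]
      exact mul_le_mul (h6.trans h7) h5 (norm_nonneg _) (by positivity)
    refine (norm_sum_le_of_le _ hterm).trans ?_
    rw [Finset.sum_const, nsmul_eq_mul]
    calc _ ≤ 2 * N * ((3 * N) * (‖y - z‖ / dyadicScale i) * (65 * K ^ 2 * f * dyadicScale i)) := by
          gcongr
          exact card_union_nearPoints_le hov y z
      _ = _ := by field_simp; ring
  have heq2 : u - Q u = ∑ a ∈ nearPoints (net S i) (dyadicScale i) y,
        netWeight (net S i) (dyadicScale i) a y • (F.P a (20 * dyadicScale i) (y - z)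
          - Q (F.P a (20 * dyadicScale i) (y - z)))
      + ∑ a ∈ nearPoints (net S i) (dyadicScale i) y ∪ nearPoints (net S i) (dyadicScale i) z,
        (netWeight (net S i) (dyadicScale i) a y - netWeight (net S i) (dyadicScale i) a z) •
          (((a - p) + F.P a (20 * dyadicScale i) (z - a))
            - Q ((a - p) + F.P a (20 * dyadicScale i) (z - a))) := by
    conv_lhs =>
      rw [heq, map_add Q, map_sum Q, map_sum Q, add_sub_add_comm, ← Finset.sum_sub_distrib,
        ← Finset.sum_sub_distrib]
    congr 1 <;> refine Finset.sum_congr rfl fun a _ => ?_ <;> rw [map_smul, smul_sub]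
  have hlow : ‖y - z‖ ≤ 2 * ‖u‖ := by
    have h1 := F.norm_step_sub_sub_le c hN h0 hT hy hz (by linarith) (by linarith) hyz
    have h2 := norm_sub_le u (u - (y - z))
    rw [sub_sub_cancel] at h2
    have h3 : ‖u - (y - z)‖ ≤ K * ‖u - (y - z)‖ :=
      le_mul_of_one_le_left (norm_nonneg _) c.one_le_K
    have := norm_nonneg (y - z)
    linarith
  rw [heq2]
  refine (norm_add_le _ _).trans ((add_le_add hfirst hsecond).trans ?_)
  have hN2 : 1 ≤ N ^ 2 := one_le_pow₀ hN1
  calc 5 / 2 * K ^ 2 * f * ‖y - z‖ + 390 * N ^ 2 * K ^ 2 * f * ‖y - z‖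
      = (5 / 2 * 1 + 390 * N ^ 2) * (K ^ 2 * f * ‖y - z‖) := by ring
    _ ≤ (5 / 2 * N ^ 2 + 390 * N ^ 2) * (K ^ 2 * f * (2 * ‖u‖)) := by gcongr
    _ = 785 * K ^ 2 * N ^ 2 * (f * ‖u‖) := by ring
    _ ≤ CB * (f * ‖u‖) := by
        have h1 := c.le_CB
        have h2 : 0 ≤ K ^ 2 * N ^ 2 := by positivity
        gcongr
        linarith
    _ = _ := by ring

theorem angle_succ (hN : (26 : ℝ) ^ k ≤ N) (h0 : (0 : X) ∈ S) (hT : F.Stage CA CB i T)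
    {y z p : X} (hy : y ∈ T) (hz : z ∈ T)
    (hy1 : ‖F.step i y‖ ≤ 1 + 40 * dyadicScale (i + 1))
    (hz1 : ‖F.step i z‖ ≤ 1 + 40 * dyadicScale (i + 1))
    (hyz : ‖F.step i y - F.step i z‖ ≤ 3 * dyadicScale (i + 1)) (hp : p ∈ S)
    (hyp : ‖F.step i y - p‖ ≤ 10 * dyadicScale (i + 1)) :
    ‖(F.step i y - F.step i z)
        - F.P p (100 * dyadicScale (i + 1)) (F.step i y - F.step i z)‖
      ≤ CB * F.stageFlatness (i + 1) p * ‖F.step i y - F.step i z‖ := by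
  have hr := dyadicScale_pos i
  rw [dyadicScale_succ] at hy1 hz1 hyz hyp
  have hy2 := F.norm_le_of_norm_step_le c hN h0 hT hy
  have hz2 := F.norm_le_of_norm_step_le c hN h0 hT hz
  have hdy := (F.norm_step_sub_le_scale c hN h0 hT hy).1
  have hdz := (F.norm_step_sub_le_scale c hN h0 hT hz).1
  refine F.angle_succ_of_close c hN h0 hT hy hz (by linarith) (by linarith) ?_ hp (by linarith)
  have e : y - z = (F.step i y - F.step i z) - (F.step i y - y) + (F.step i z - z) := by abel
  rw [e]
  have e1 := norm_add_le ((F.step i y - F.step i z) - (F.step i y - y)) (F.step i z - z)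
  have e2 := norm_sub_le (F.step i y - F.step i z) (F.step i y - y)
  linarith

/-- The new surface has no holes: over the plane at scale `i` it is parametrised by a map close to
the identity, which covers a ball. -/
theorem lift_succ (hN : (26 : ℝ) ^ k ≤ N) (h0 : (0 : X) ∈ S) (hT : F.Stage CA CB i T)
    {y p : X} (hy : y ∈ T) (hy1 : ‖F.step i y‖ ≤ 1 + 30 * dyadicScale (i + 1)) (hp : p ∈ S)
    (hyp : ‖F.step i y - p‖ ≤ dyadicScale (i + 1)) {t : X}
    (ht : t ∈ F.W p (100 * dyadicScale (i + 1))) (htn : ‖t‖ ≤ dyadicScale (i + 1) / 4) :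
    ∃ z ∈ T, ‖F.step i z - F.step i y‖ ≤ 2 * ‖t‖ ∧
      F.P p (100 * dyadicScale (i + 1)) (F.step i z - F.step i y) = t := by
  have hr := dyadicScale_pos i
  have hK := c.K_pos
  have hscale := dyadicScale_succ i
  have hy2 := F.norm_le_of_norm_step_le c hN h0 hT hy
  have hdy := (F.norm_step_sub_le_scale c hN h0 hT hy).1
  obtain ⟨q, hq, hyq⟩ := hT.near y hy (by linarith)
  have hq2 : ‖q‖ < 2 := norm_lt_two_of_close (i := i) (y := y) (by linarith) (by linarith)
  have hp2 : ‖p‖ < 2 := norm_lt_two_of_close (i := i) (y := F.step i y) (by linarith) (by linarith)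
  have hadm := isAdmissibleBall_mul_dyadicScale (i := i) hq hq2 (m := 100) (by norm_num) le_rfl
  have hadm' := isAdmissibleBall_mul_dyadicScale (i := i + 1) hp hp2 (m := 100) (by norm_num) le_rfl
  have hpq : ‖p - q‖ ≤ dyadicScale i := by
    have e : p - q = (F.step i y - y) + (y - q) - (F.step i y - p) := by abel
    rw [e]
    have e1 := norm_sub_le ((F.step i y - y) + (y - q)) (F.step i y - p)
    have e2 := norm_add_le (F.step i y - y) (y - q)
    linarith
  set P := F.P q (100 * dyadicScale i) with hP
  set P' := F.P p (100 * dyadicScale (i + 1)) with hP'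
  -- The new plane is close to the old one.
  have htilt : ∀ w ∈ F.W p (100 * dyadicScale (i + 1)), ‖w - P w‖ ≤ 1 / 10 * ‖w‖ := by
    intro w hw
    refine (F.tilt hadm' hadm (by linarith) w hw).trans ?_
    have hratio : 100 * dyadicScale i / (100 * dyadicScale (i + 1)) = 2 := by
      rw [hscale]; field_simp
    rw [hratio]
    gcongr
    have h1 : K * F.flatness q (100 * dyadicScale i) ≤ K * ε := by
      gcongr
      exact F.flatness_le hadm
    linarith [c.small_ε, mul_nonneg hK.le c.ε_nonneg]
  have hlift : ∀ v, ∃ z, v ∈ F.W q (100 * dyadicScale i) → ‖v‖ ≤ dyadicScale i / 4 →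
      z ∈ T ∧ ‖z - y‖ ≤ 2 * ‖v‖ ∧ P (z - y) = v := by
    intro v
    by_cases hv : v ∈ F.W q (100 * dyadicScale i) ∧ ‖v‖ ≤ dyadicScale i / 4
    · obtain ⟨z, hz⟩ := hT.lift y hy (by linarith) q hq (by linarith) v hv.1 hv.2
      exact ⟨z, fun _ _ => hz⟩
    · exact ⟨0, fun h1 h2 => absurd ⟨h1, h2⟩ hv⟩
  choose g hg using hlift
  -- Difference vectors of lifts and of their images.
  have hdiff : ∀ v₁ v₂ : X, v₁ ∈ F.W q (100 * dyadicScale i) → v₂ ∈ F.W q (100 * dyadicScale i) →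
      ‖v₁‖ ≤ dyadicScale i / 4 → ‖v₂‖ ≤ dyadicScale i / 4 →
      K * ‖(F.step i (g v₁) - F.step i (g v₂)) - (g v₁ - g v₂)‖ ≤ 1 / 50 * ‖v₁ - v₂‖ ∧
      K * ‖(F.step i (g v₁) - F.step i (g v₂)) - P' (F.step i (g v₁) - F.step i (g v₂))‖
        ≤ 1 / 1000 * ‖F.step i (g v₁) - F.step i (g v₂)‖ ∧
      ‖F.step i (g v₁) - F.step i (g v₂)‖ ≤ 3 * ‖v₁ - v₂‖ := by
    intro v₁ v₂ hv₁ hv₂ hn₁ hn₂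
    obtain ⟨h1T, h1n, h1P⟩ := hg v₁ hv₁ hn₁
    obtain ⟨h2T, h2n, h2P⟩ := hg v₂ hv₂ hn₂
    have h1y : ‖g v₁‖ ≤ 1 + 16 * dyadicScale i := by
      have := norm_sub_norm_le (g v₁) y
      linarith
    have h2y : ‖g v₂‖ ≤ 1 + 16 * dyadicScale i := by
      have := norm_sub_norm_le (g v₂) y
      linarith
    have hu0 : ‖g v₁ - g v₂‖ ≤ dyadicScale i := by
      have := norm_sub_le (g v₁ - y) (g v₂ - y)
      rw [sub_sub_sub_cancel_right] at this
      linarith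
    have hgq : ‖g v₁ - q‖ ≤ 10 * dyadicScale i := by
      have := norm_add_le (g v₁ - y) (y - q)
      rw [sub_add_sub_cancel] at this
      linarith
    have hang := hT.angle _ h1T _ h2T (by linarith) (by linarith) (by linarith) q hq hgq
    have hPu : P (g v₁ - g v₂) = v₁ - v₂ := by
      rw [← sub_sub_sub_cancel_right (g v₁) (g v₂) y, map_sub, h1P, h2P]
    have hflat : ∀ {j : ℕ} {x : X}, x ∈ S → ‖x‖ < 2 →
        K * (CB * F.stageFlatness j x) ≤ 1 / 1000 := by
      intro j x hx hx2
      have h1 := F.stageFlatness_le h0 c.ε_nonneg (i := j) hx hx2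
      have h2 := c.CB_ge
      have h3 : K * (CB * F.stageFlatness j x) ≤ K * (CB * (2 * ε)) := by gcongr
      linarith [c.small_CB]
    have hu0v : ‖g v₁ - g v₂‖ ≤ 2 * ‖v₁ - v₂‖ := by
      rw [← hP, hPu] at hang
      have h1 := norm_add_le ((g v₁ - g v₂) - (v₁ - v₂)) (v₁ - v₂)
      rw [sub_add_cancel] at h1
      have h2 : CB * F.stageFlatness i q ≤ K * (CB * F.stageFlatness i q) := by
        have := c.CB_ge
        have := F.stageFlatness_nonneg i q
        exact le_mul_of_one_le_left (by positivity) c.one_le_K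
      have h3 := hflat (j := i) hq hq2
      nlinarith [norm_nonneg (g v₁ - g v₂)]
    have hstep := F.norm_step_sub_sub_le c hN h0 hT h1T h2T (by linarith) (by linarith)
      (by linarith)
    set u := F.step i (g v₁) - F.step i (g v₂) with hu
    have hun : ‖u‖ ≤ 101 / 100 * ‖g v₁ - g v₂‖ := by
      have h1 := norm_add_le (u - (g v₁ - g v₂)) (g v₁ - g v₂)
      rw [sub_add_cancel] at h1
      have h2 : ‖u - (g v₁ - g v₂)‖ ≤ K * ‖u - (g v₁ - g v₂)‖ :=
        le_mul_of_one_le_left (norm_nonneg _) c.one_le_K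
      linarith
    have hd1 := (F.norm_step_sub_le_scale c hN h0 hT h1T).1
    have hyp1 : ‖F.step i (g v₁) - p‖ ≤ 10 * dyadicScale i := by
      have e : F.step i (g v₁) - p
          = (F.step i (g v₁) - g v₁) + (g v₁ - y) - (F.step i y - y) + (F.step i y - p) := by abel
      rw [e]
      have e1 := norm_add_le ((F.step i (g v₁) - g v₁) + (g v₁ - y) - (F.step i y - y))
        (F.step i y - p)
      have e2 := norm_sub_le ((F.step i (g v₁) - g v₁) + (g v₁ - y)) (F.step i y - y)
      have e3 := norm_add_le (F.step i (g v₁) - g v₁) (g v₁ - y)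
      linarith
    have hang' := F.angle_succ_of_close c hN h0 hT h1T h2T (by linarith) (by linarith)
      (by linarith) hp hyp1
    refine ⟨by linarith, ?_, by linarith [norm_nonneg (v₁ - v₂)]⟩
    have h3 := hflat (j := i + 1) hp hp2
    calc K * ‖u - P' u‖ ≤ K * (CB * F.stageFlatness (i + 1) p * ‖u‖) := by gcongr
      _ = K * (CB * F.stageFlatness (i + 1) p) * ‖u‖ := by ring
      _ ≤ 1 / 1000 * ‖u‖ := by gcongr
  have hg0 : g 0 = y := by
    have := (hg 0 (Submodule.zero_mem _) (by rw [norm_zero]; positivity)).2.1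
    rw [norm_zero, mul_zero] at this
    exact sub_eq_zero.1 (norm_le_zero_iff.1 this)
  have := (F.dim hadm).1
  let G : F.W q (100 * dyadicScale i) → F.W q (100 * dyadicScale i) := fun v =>
    ⟨P (P' (F.step i (g v) - F.step i y)), (F.proj hadm).mem _⟩
  have hG0 : G 0 = 0 := by
    ext
    simp [G, hg0]
  have hG : ∀ x y : F.W q (100 * dyadicScale i), ‖x‖ ≤ dyadicScale i / 4 →
      ‖y‖ ≤ dyadicScale i / 4 → ‖G x - G y - (x - y)‖ ≤ 1 / 4 * ‖x - y‖ := by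
    intro v₁ v₂ hn₁ hn₂
    obtain ⟨h1, h2, h3⟩ := hdiff v₁ v₂ v₁.2 v₂.2 hn₁ hn₂
    set u := F.step i (g v₁) - F.step i (g v₂) with hu
    have hPu : P (g v₁ - g v₂) = v₁ - v₂ := by
      rw [← sub_sub_sub_cancel_right (g v₁) (g v₂) y, map_sub, (hg v₁ v₁.2 hn₁).2.2,
        (hg v₂ v₂.2 hn₂).2.2]
    have e : ((G v₁ - G v₂ - (v₁ - v₂) : F.W q (100 * dyadicScale i)) : X)
        = P (u - (g v₁ - g v₂)) - P (u - P' u) := by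
      have e1 : u = (F.step i (g v₁) - F.step i y) - (F.step i (g v₂) - F.step i y) := by
        rw [hu]; abel
      rw [map_sub P u (P' u), map_sub P u, hPu]
      have e2 : P (P' u) = P (P' (F.step i (g v₁) - F.step i y))
          - P (P' (F.step i (g v₂) - F.step i y)) := by
        rw [e1, map_sub P', map_sub P]
      rw [e2]
      simp only [G, Submodule.coe_sub]
      abel
    change ‖((G v₁ - G v₂ - (v₁ - v₂) : F.W q (100 * dyadicScale i)) : X)‖ ≤ _
    rw [e]
    have e3 : ‖P (u - (g v₁ - g v₂))‖ ≤ K * ‖u - (g v₁ - g v₂)‖ :=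
      P.le_of_opNorm_le (F.norm_le hadm) _
    have e4 : ‖P (u - P' u)‖ ≤ K * ‖u - P' u‖ := P.le_of_opNorm_le (F.norm_le hadm) _
    have e5 : ‖((v₁ : X) - v₂)‖ = ‖v₁ - v₂‖ := rfl
    have := norm_sub_le (P (u - (g v₁ - g v₂))) (P (u - P' u))
    have := norm_nonneg (v₁ - v₂)
    linarith
  have hPt : ‖P t‖ ≤ 3 / 4 * (dyadicScale i / 4) := by
    have h1 := htilt t ht
    have h2 := norm_sub_le t (t - P t)
    rw [sub_sub_cancel] at h2
    linarith
  obtain ⟨v, hvn, hv⟩ := exists_eq_of_close_to_id (by positivity) hG0 hG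
    (w := ⟨P t, (F.proj hadm).mem t⟩) hPt
  have hvn' : ‖(v : X)‖ ≤ dyadicScale i / 4 := hvn
  have hv' : P (P' (F.step i (g v) - F.step i y)) = P t := congrArg Subtype.val hv
  obtain ⟨-, h2, -⟩ := hdiff v 0 v.2 (Submodule.zero_mem _) hvn'
    (by rw [norm_zero]; positivity)
  rw [hg0] at h2
  set u := F.step i (g v) - F.step i y with hu
  -- `P` is injective on the new plane.
  have hP'u : P' u = t := by
    have h3 := htilt (P' u - t) (Submodule.sub_mem _ ((F.proj hadm').mem u) ht)
    rw [map_sub P, hv', sub_self, sub_zero] at h3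
    have h4 : ‖P' u - t‖ ≤ 0 := by linarith [norm_nonneg (P' u - t)]
    exact sub_eq_zero.1 (norm_le_zero_iff.1 h4)
  refine ⟨g v, (hg v v.2 hvn').1, ?_, hP'u⟩
  rw [hP'u] at h2
  have h5 := norm_add_le (u - t) t
  rw [sub_add_cancel] at h5
  have h6 : ‖u - t‖ ≤ K * ‖u - t‖ := le_mul_of_one_le_left (norm_nonneg _) c.one_le_K
  linarith [norm_nonneg u]

theorem stage_succ (hN : (26 : ℝ) ^ k ≤ N) (h0 : (0 : X) ∈ S) (hT : F.Stage CA CB i T) :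
    F.Stage CA CB (i + 1) (F.step i '' T) := by
  refine ⟨?_, ?_, ?_, ?_⟩
  · rintro _ ⟨y, hy, rfl⟩ hy1
    exact F.near_succ c hN h0 hT hy hy1
  · rintro _ ⟨y, hy, rfl⟩ hy1 p hp hyp
    exact F.height_succ c hN h0 hT hy hy1 hp hyp
  · rintro _ ⟨y, hy, rfl⟩ _ ⟨z, hz, rfl⟩ hy1 hz1 hyz p hp hyp
    exact F.angle_succ c hN h0 hT hy hz hy1 hz1 hyz hp hyp
  · rintro _ ⟨y, hy, rfl⟩ hy1 p hp hyp t ht htn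
    obtain ⟨z, hz, h⟩ := F.lift_succ c hN h0 hT hy hy1 hp hyp ht htn
    exact ⟨_, ⟨z, hz, rfl⟩, h⟩

end FlatSystem

/-! ### The limit parametrisation -/

theorem tendsto_dyadicScale : Tendsto dyadicScale atTop (𝓝 0) := by
  have h : dyadicScale = fun i => 1 / 1000 * (1 / 2) ^ i := rfl
  have h2 := (tendsto_pow_atTop_nhds_zero_of_lt_one (r := (1 / 2 : ℝ)) (by norm_num)
    (by norm_num)).const_mul (1 / 1000)
  rwa [mul_zero, ← h] at h2

namespace FlatSystem

variable {k : ℕ} {K ε : ℝ} {S : Set X} (F : FlatSystem k K ε S)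
  {N CA CB CD CE : ℝ} (c : StepConstants K N CA CB CD CE ε)

/-- The composition of the first `n` steps. -/
noncomputable def iter (F : FlatSystem k K ε S) : ℕ → X → X
  | 0, x => x
  | n + 1, x => F.step n (iter F n x)

/-- The limit of the construction at `x`; a junk value if the iterates do not converge, which does
not happen on the initial plane. -/
noncomputable def limitMap (x : X) : X :=
  haveI : Nonempty X := ⟨0⟩
  limUnder atTop fun n => F.iter n x

include F c

theorem stage_iter (hN : (26 : ℝ) ^ k ≤ N) (h0 : (0 : X) ∈ S) (n : ℕ) :
    F.Stage CA CB n (F.iter n '' F.basePlane) := by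
  induction n with
  | zero =>
    have : F.iter 0 '' (F.basePlane : Set X) = F.basePlane := by
      have : F.iter 0 = _root_.id := rfl
      rw [this, image_id]
    rw [this]
    exact F.stage_zero c h0
  | succ n ih =>
    have : F.iter (n + 1) '' (F.basePlane : Set X) = F.step n '' (F.iter n '' F.basePlane) := by
      rw [image_image]; rfl
    rw [this]
    exact F.stage_succ c hN h0 ih

theorem norm_iter_sub_iter_le (hN : (26 : ℝ) ^ k ≤ N) (h0 : (0 : X) ∈ S) {x : X}
    (hx : x ∈ F.basePlane) {n m : ℕ} (hnm : n ≤ m) :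
    ‖F.iter m x - F.iter n x‖ ≤ (dyadicScale n - dyadicScale m) / 50 := by
  induction m, hnm using Nat.le_induction with
  | base => simp
  | succ m hm ih =>
    have h1 := (F.norm_step_sub_le_scale c hN h0 (F.stage_iter c hN h0 m)
      (mem_image_of_mem _ hx)).1
    have h2 := norm_add_le (F.iter (m + 1) x - F.iter m x) (F.iter m x - F.iter n x)
    rw [sub_add_sub_cancel] at h2
    have h3 : F.iter (m + 1) x = F.step m (F.iter m x) := rfl
    rw [dyadicScale_succ]
    rw [← h3] at h1
    linarith

theorem norm_iter_sub_iter_le' (hN : (26 : ℝ) ^ k ≤ N) (h0 : (0 : X) ∈ S) {x : X}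
    (hx : x ∈ F.basePlane) {n m : ℕ} (hnm : n ≤ m) :
    ‖F.iter m x - F.iter n x‖ ≤ dyadicScale n / 50 := by
  have := F.norm_iter_sub_iter_le c hN h0 hx hnm
  have := dyadicScale_pos m
  linarith

theorem tendsto_iter [CompleteSpace X] (hN : (26 : ℝ) ^ k ≤ N) (h0 : (0 : X) ∈ S) {x : X}
    (hx : x ∈ F.basePlane) : Tendsto (fun n => F.iter n x) atTop (𝓝 (F.limitMap x)) := by
  have hc : CauchySeq fun n => F.iter n x := by
    refine cauchySeq_of_le_tendsto_0' (fun n => dyadicScale n / 50) (fun n m hnm => ?_) ?_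
    · rw [dist_comm, dist_eq_norm]
      exact F.norm_iter_sub_iter_le' c hN h0 hx hnm
    · simpa using tendsto_dyadicScale.div_const 50
  exact tendsto_nhds_limUnder (cauchySeq_tendsto_of_complete hc)

theorem norm_limitMap_sub_iter_le [CompleteSpace X] (hN : (26 : ℝ) ^ k ≤ N) (h0 : (0 : X) ∈ S)
    {x : X} (hx : x ∈ F.basePlane) (n : ℕ) :
    ‖F.limitMap x - F.iter n x‖ ≤ dyadicScale n / 50 := by
  refine le_of_tendsto ((F.tendsto_iter c hN h0 hx).sub_const _).norm ?_
  filter_upwards [eventually_ge_atTop n] with m hm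
  exact F.norm_iter_sub_iter_le' c hN h0 hx hm

theorem iter_eq_self (hN : (26 : ℝ) ^ k ≤ N) {x : X} (hx : 3 / 2 ≤ ‖x‖) (n : ℕ) :
    F.iter n x = x := by
  induction n with
  | zero => rfl
  | succ n ih =>
    change F.step n (F.iter n x) = x
    rw [ih]
    refine F.step_eq_self c hN ?_
    linarith [dyadicScale_le n]

theorem limitMap_eq_self [CompleteSpace X] (hN : (26 : ℝ) ^ k ≤ N) (h0 : (0 : X) ∈ S) {x : X}
    (hxV : x ∈ F.basePlane) (hx : 3 / 2 ≤ ‖x‖) : F.limitMap x = x := by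
  refine tendsto_nhds_unique (F.tendsto_iter c hN h0 hxV) ?_
  simp only [F.iter_eq_self c hN hx]
  exact tendsto_const_nhds

theorem limitMap_mem [CompleteSpace X] (hN : (26 : ℝ) ^ k ≤ N) (h0 : (0 : X) ∈ S)
    (hS : IsClosed S) {x : X} (hx : x ∈ F.basePlane) (hx1 : ‖F.limitMap x‖ < 1) :
    F.limitMap x ∈ S := by
  refine hS.closure_subset (Metric.mem_closure_iff.2 fun η hη => ?_)
  obtain ⟨n, hn⟩ := (tendsto_dyadicScale.eventually_lt_const hη).exists
  have h1 := F.norm_limitMap_sub_iter_le c hN h0 hx n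
  have h2 := norm_sub_norm_le (F.iter n x) (F.limitMap x)
  rw [norm_sub_rev] at h2
  have hr := dyadicScale_pos n
  obtain ⟨p, hp, hxp⟩ := (F.stage_iter c hN h0 n).near _ (mem_image_of_mem _ hx) (by linarith)
  refine ⟨p, hp, ?_⟩
  rw [dist_eq_norm]
  have h3 := norm_add_le (F.limitMap x - F.iter n x) (F.iter n x - p)
  rw [sub_add_sub_cancel] at h3
  linarith

/-- Every point of `S` in the unit ball is approached by the iterated surfaces: the lifting
property moves the approximating point until it lies above the given one. -/
theorem exists_iter_near (hN : (26 : ℝ) ^ k ≤ N) (h0 : (0 : X) ∈ S) {p : X} (hp : p ∈ S)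
    (hp1 : ‖p‖ < 1) (n : ℕ) : ∃ x ∈ F.basePlane, ‖F.iter n x - p‖ ≤ dyadicScale n / 8 := by
  induction n with
  | zero =>
    have hadm0 := isAdmissibleBall_base h0
    refine ⟨F.P 0 (19 / 10) p, (F.proj hadm0).mem p, ?_⟩
    have h1 := F.flat hadm0 hp (by rw [sub_zero]; linarith)
    have h2 := F.flatness_le hadm0
    rw [sub_zero, norm_sub_rev] at h1
    change ‖F.P 0 (19 / 10) p - p‖ ≤ _
    have h3 : dyadicScale 0 = 1 / 1000 := by unfold dyadicScale; norm_num
    rw [h3]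
    linarith [c.ε_le]
  | succ n ih =>
    obtain ⟨x, hx, hxp⟩ := ih
    have hr := dyadicScale_pos n
    have hT := F.stage_iter c hN h0 n
    have hp2 : ‖p‖ < 2 := by linarith
    have hadm := isAdmissibleBall_mul_dyadicScale (i := n) hp hp2 (m := 100) (by norm_num) le_rfl
    set y := F.iter n x with hy
    have hyT : y ∈ F.iter n '' F.basePlane := mem_image_of_mem _ hx
    have hy1 : ‖y‖ ≤ 1 + dyadicScale n := by
      have := norm_sub_norm_le y p
      linarith
    have hsmall : CA * F.stageFlatness n p * dyadicScale n ≤ dyadicScale n / 100 := by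
      calc CA * F.stageFlatness n p * dyadicScale n ≤ CE * (2 * ε) * dyadicScale n := by
            have := F.stageFlatness_nonneg n p
            have := c.CE_ge
            gcongr
            · exact c.CA_le.trans c.CD_le_CE
            · exact F.stageFlatness_le h0 c.ε_nonneg hp hp2
        _ = 2 * (CE * ε) * dyadicScale n := by ring
        _ ≤ 1 / 100 * dyadicScale n := by gcongr; linarith [c.small_CE']
        _ = _ := by ring
    have h1 := hT.height y hyT (by linarith) p hp (by linarith)
    set P := F.P p (100 * dyadicScale n) with hP
    have h2 : ‖P (p - y)‖ ≤ dyadicScale n / 4 := by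
      have e : P (p - y) = ((y - p) - P (y - p)) - (y - p) := by
        simp only [map_sub]; abel
      rw [e]
      linarith [norm_sub_le ((y - p) - P (y - p)) (y - p)]
    obtain ⟨z, ⟨x', hx', hz⟩, hzy, hPz⟩ := hT.lift y hyT (by linarith) p hp (by linarith)
      _ ((F.proj hadm).mem (p - y)) h2
    have hzT : z ∈ F.iter n '' F.basePlane := ⟨x', hx', hz⟩
    have hPzp : P (z - p) = 0 := by
      have e : z - p = (z - y) - (p - y) := by abel
      rw [e, map_sub, hPz, sub_self]
    have hzp : ‖z - p‖ ≤ 10 * dyadicScale n := by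
      have := norm_add_le (z - y) (y - p)
      rw [sub_add_sub_cancel] at this
      linarith
    have hz1 : ‖z‖ ≤ 1 + 40 * dyadicScale n := by
      have := norm_sub_norm_le z p
      linarith
    have h3 := hT.height z hzT hz1 p hp hzp
    rw [← hP, hPzp, sub_zero] at h3
    have h4 := (F.norm_step_sub_le_scale c hN h0 hT hzT).1
    refine ⟨x', hx', ?_⟩
    have e : F.iter (n + 1) x' = F.step n z := by rw [← hz]; rfl
    rw [e, dyadicScale_succ]
    have h5 := norm_add_le (F.step n z - z) (z - p)
    rw [sub_add_sub_cancel] at h5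
    linarith

theorem exists_limitMap_eq [CompleteSpace X] (hN : (26 : ℝ) ^ k ≤ N) (h0 : (0 : X) ∈ S)
    (hcont : Continuous fun x : F.basePlane => F.limitMap x) {p : X} (hp : p ∈ S)
    (hp1 : ‖p‖ < 1) : ∃ x : F.basePlane, F.limitMap x = p := by
  have hadm0 := isAdmissibleBall_base h0
  have : FiniteDimensional ℝ F.basePlane := (F.dim hadm0).1
  have : ProperSpace F.basePlane := FiniteDimensional.proper ℝ _
  choose x hxV hx using F.exists_iter_near c hN h0 hp hp1
  let w : ℕ → F.basePlane := fun n => ⟨x n, hxV n⟩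
  have hw : ∀ n, w n ∈ Metric.closedBall (0 : F.basePlane) 2 := by
    intro n
    rw [mem_closedBall_zero_iff]
    change ‖x n‖ ≤ 2
    have h1 : ‖F.iter n (x n) - x n‖ ≤ dyadicScale 0 / 50 :=
      F.norm_iter_sub_iter_le' c hN h0 (hxV n) (Nat.zero_le n)
    have h2 : x n = p + (F.iter n (x n) - p) - (F.iter n (x n) - x n) := by abel
    rw [h2]
    have h3 := norm_sub_le (p + (F.iter n (x n) - p)) (F.iter n (x n) - x n)
    have h4 := norm_add_le p (F.iter n (x n) - p)
    linarith [hx n, dyadicScale_le n, dyadicScale_le 0]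
  obtain ⟨a, -, ψ, hψ, hlim⟩ := (isCompact_closedBall (0 : F.basePlane) 2).tendsto_subseq hw
  refine ⟨a, tendsto_nhds_unique ((hcont.tendsto a).comp hlim) ?_⟩
  have hfull : Tendsto (fun n => F.limitMap (w n)) atTop (𝓝 p) := by
    rw [tendsto_iff_norm_sub_tendsto_zero]
    refine squeeze_zero (fun n => norm_nonneg _) (fun n => ?_) tendsto_dyadicScale
    have h1 := F.norm_limitMap_sub_iter_le c hN h0 (hxV n) n
    have h2 := norm_add_le (F.limitMap (w n) - F.iter n (x n)) (F.iter n (x n) - p)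
    rw [sub_add_sub_cancel] at h2
    change ‖F.limitMap (w n) - F.iter n (x n)‖ ≤ _ at h1
    linarith [hx n, dyadicScale_pos n]
  exact hfull.comp hψ.tendsto_atTop

end FlatSystem

/-! ### Distortion at distances below the scale -/

theorem LogClose.of_tendsto {e a b : ℝ} {s : ℕ → ℝ} (hs : Tendsto s atTop (𝓝 a))
    (h : ∀ᶠ n in atTop, LogClose e (s n) b) : LogClose e a b :=
  ⟨le_of_tendsto hs (h.mono fun _ h => h.1),
    ge_of_tendsto (hs.const_mul _) (h.mono fun _ h => h.2)⟩

/-- `x * x ^ (α - 1) = x ^ α` with a constant taken out of the power. -/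
theorem mul_rpow_sub_one_le {A q α : ℝ} (hA : 1 ≤ A) (hq : 0 ≤ q) (hα : 1 ≤ α) (hα2 : α ≤ 2) :
    q * (A * q) ^ (α - 1) ≤ A * q ^ α := by
  rw [Real.mul_rpow (by linarith) hq]
  have h1 : A ^ (α - 1) ≤ A := by
    calc A ^ (α - 1) ≤ A ^ (1 : ℝ) := Real.rpow_le_rpow_of_exponent_le hA (by linarith)
      _ = A := Real.rpow_one A
  have h2 : q * q ^ (α - 1) = q ^ α := by
    rw [← Real.rpow_one_add' hq (by linarith)]
    congr 1; ring
  calc q * (A ^ (α - 1) * q ^ (α - 1)) = A ^ (α - 1) * (q * q ^ (α - 1)) := by ring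
    _ ≤ A * (q * q ^ (α - 1)) := by
        have := Real.rpow_nonneg hq (α - 1)
        gcongr
    _ = _ := by rw [h2]

namespace FlatSystem

variable {k : ℕ} {K ε : ℝ} {S : Set X} (F : FlatSystem k K ε S)
  {N CA CB CD CE : ℝ} (c : StepConstants K N CA CB CD CE ε)
  {α C : ℝ}

include F c

/-- The distortion of a distance below the scale in one step. -/
theorem logClose_step (hN : (26 : ℝ) ^ k ≤ N) (h0 : (0 : X) ∈ S) (hα : 1 ≤ α) (hα2 : α ≤ 2)
    (hC : 0 ≤ C) (hAO : ∀ x r, IsAdmissibleBall S x r → AlmostOrthogonal α C (F.P x r))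
    {T : Set X} {i : ℕ} (hT : F.Stage CA CB i T) {y z p : X}
    (hy : y ∈ T) (hz : z ∈ T) (hy1 : ‖y‖ ≤ 1 + 40 * dyadicScale i)
    (hz1 : ‖z‖ ≤ 1 + 40 * dyadicScale i) (hyz : ‖y - z‖ ≤ 3 * dyadicScale i) (hp : p ∈ S)
    (hyp : ‖y - p‖ ≤ 7 * dyadicScale i) :
    LogClose (56 * K * N ^ 2 * CE ^ 2 * C * F.stageFlatness i p ^ α)
      ‖F.step i y - F.step i z‖ ‖y - z‖ := by
  have hr := dyadicScale_pos i
  have hK := c.K_pos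
  have hN1 := c.one_le_N
  have hCE := c.CE_ge
  have hb := F.stageFlatness_nonneg i p
  have hp2 : ‖p‖ < 2 := norm_lt_two_of_close hy1 (by linarith)
  have hb2 := F.stageFlatness_le h0 c.ε_nonneg (i := i) hp hp2
  obtain ⟨G, E, hG, hsub, hE⟩ := F.exists_step_sub_eq c hN hT hy hz hy1 hz1 hyz hp hyp
  have hadm : ∀ a ∈ G, IsAdmissibleBall S a (20 * dyadicScale i) := fun a ha =>
    isAdmissibleBall_mul_dyadicScale (hE a ha).1 (hE a ha).2.1 (by norm_num) (by norm_num)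
  have hsmall := F.norm_step_sub_sub_le c hN h0 hT hy hz hy1 hz1 hyz
  have hnb : 2 * N * (CE * F.stageFlatness i p) ≤ 1 / 4 := by
    have h1 : 2 * N * (CE * F.stageFlatness i p) ≤ 2 * N * (CE * (2 * ε)) := by gcongr
    have h2 : N * (CE * ε) ≤ K * (N * (CE * ε)) := by
      have := c.ε_nonneg
      exact le_mul_of_one_le_left (by positivity) c.one_le_K
    linarith [c.small_CE]
  have h := abs_norm_add_sum_sub_norm_le G E (fun a => F.P a (20 * dyadicScale i)) hα2 hC
    c.one_le_K (n := 2 * N) (by linarith) hG (fun a ha => F.norm_le (hadm a ha))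
    (fun a ha => hAO _ _ (hadm a ha)) (fun a ha => (hE a ha).2.2.1) (y - z)
    (b := CE * F.stageFlatness i p) (a := CE * F.stageFlatness i p) (by positivity) le_rfl hnb
    (fun a ha => (hE a ha).2.2.2.1) (fun a ha => (hE a ha).2.2.2.2)
  rw [← hsub] at h
  have h3 := mul_rpow_sub_one_le (A := CE) (by linarith) hb hα hα2
  have h4 : 7 * C * K * (2 * N) ^ 2 * (CE * F.stageFlatness i p)
      * (CE * F.stageFlatness i p) ^ (α - 1)
      ≤ 28 * K * N ^ 2 * CE ^ 2 * C * F.stageFlatness i p ^ α := by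
    calc _ = 28 * K * N ^ 2 * CE * C * (F.stageFlatness i p
          * (CE * F.stageFlatness i p) ^ (α - 1)) := by ring
      _ ≤ 28 * K * N ^ 2 * CE * C * (CE * F.stageFlatness i p ^ α) := by gcongr
      _ = _ := by ring
  have h5 := LogClose.of_abs_sub_le (norm_nonneg _) (norm_nonneg _)
    (h.trans (mul_le_mul_of_nonneg_right h4 (norm_nonneg _))) (by
      refine (abs_norm_sub_norm_le _ _).trans ?_
      have := c.one_le_K
      nlinarith [norm_nonneg (y - z), norm_nonneg (F.step i y - F.step i z - (y - z))])
  convert h5 using 1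
  ring

/-- Two points at distance below the scale are either both fixed, or both lie in the part of the
ball where the construction continues. -/
theorem step_eq_self_or_norm_le (hN : (26 : ℝ) ^ k ≤ N) {y z : X} {i : ℕ}
    (hyz : ‖y - z‖ ≤ dyadicScale i) :
    (F.step i y = y ∧ F.step i z = z) ∨
      (‖y‖ ≤ 1 + 25 * dyadicScale i ∧ ‖z‖ ≤ 1 + 25 * dyadicScale i) := by
  have hr := dyadicScale_pos i
  have h1 := norm_sub_norm_le y z
  have h2 := norm_sub_norm_le z y
  rw [norm_sub_rev] at h2
  rcases lt_or_ge (1 + 24 * dyadicScale i) ‖y‖ with hy | hy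
  · rcases lt_or_ge (1 + 24 * dyadicScale i) ‖z‖ with hz | hz
    · exact Or.inl ⟨F.step_eq_self c hN hy, F.step_eq_self c hN hz⟩
    · exact Or.inr ⟨by linarith, by linarith⟩
  · exact Or.inr ⟨by linarith, by linarith⟩

variable {x x' : X}

theorem norm_iter_succ_sub_ge (hN : (26 : ℝ) ^ k ≤ N) (h0 : (0 : X) ∈ S) (hx : x ∈ F.basePlane)
    (hx' : x' ∈ F.basePlane) {j : ℕ} (hj : ‖F.iter j x - F.iter j x'‖ ≤ dyadicScale j) :
    3 / 4 * ‖F.iter j x - F.iter j x'‖ ≤ ‖F.iter (j + 1) x - F.iter (j + 1) x'‖ := by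
  have hr := dyadicScale_pos j
  have hT := F.stage_iter c hN h0 j
  change _ ≤ ‖F.step j (F.iter j x) - F.step j (F.iter j x')‖
  rcases F.step_eq_self_or_norm_le c hN hj with ⟨h1, h2⟩ | ⟨h1, h2⟩
  · rw [h1, h2]
    linarith [norm_nonneg (F.iter j x - F.iter j x')]
  · have h := F.norm_step_sub_sub_le c hN h0 hT (mem_image_of_mem _ hx) (mem_image_of_mem _ hx')
      (by linarith) (by linarith) (by linarith)
    set u := F.iter j x - F.iter j x'
    set v := F.step j (F.iter j x) - F.step j (F.iter j x')
    have h3 := norm_sub_norm_le u v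
    rw [norm_sub_rev u v] at h3
    have := c.one_le_K
    nlinarith [norm_nonneg u, norm_nonneg (v - u)]

theorem norm_iter_sub_ge (hN : (26 : ℝ) ^ k ≤ N) (h0 : (0 : X) ∈ S) (hx : x ∈ F.basePlane)
    (hx' : x' ∈ F.basePlane) {n : ℕ}
    (hn : ∀ j < n, ‖F.iter j x - F.iter j x'‖ ≤ dyadicScale j) :
    (3 / 4) ^ n * ‖x - x'‖ ≤ ‖F.iter n x - F.iter n x'‖ := by
  induction n with
  | zero => simp [iter]
  | succ n ih =>
    have h1 := ih fun j hj => hn j (hj.trans n.lt_succ_self)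
    have h2 := F.norm_iter_succ_sub_ge c hN h0 hx hx' (hn n n.lt_succ_self)
    rw [pow_succ]
    linarith

/-- As long as the distance stays below the scale, one point of `S` serves as the reference point
for all steps in which the two points move. -/
theorem exists_reference_point (hN : (26 : ℝ) ^ k ≤ N) (h0 : (0 : X) ∈ S) (hx : x ∈ F.basePlane)
    {n : ℕ} (hn : ∀ j < n, ‖F.iter j x - F.iter j x'‖ ≤ dyadicScale j) :
    ∃ p ∈ S, ‖p‖ ≤ 3 / 2 ∧ ∀ j < n, (F.step j (F.iter j x) = F.iter j x ∧
      F.step j (F.iter j x') = F.iter j x') ∨ (‖F.iter j x‖ ≤ 1 + 25 * dyadicScale j ∧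
        ‖F.iter j x'‖ ≤ 1 + 25 * dyadicScale j ∧ ‖F.iter j x - p‖ ≤ 7 * dyadicScale j) := by
  induction n with
  | zero => exact ⟨0, h0, by norm_num, by simp⟩
  | succ n ih =>
    have hr := dyadicScale_pos n
    rcases F.step_eq_self_or_norm_le c hN (hn n n.lt_succ_self) with h | ⟨h1, h2⟩
    · obtain ⟨p, hp, hp2, hpj⟩ := ih fun j hj => hn j (hj.trans n.lt_succ_self)
      refine ⟨p, hp, hp2, fun j hj => ?_⟩
      rcases (Nat.lt_succ_iff.1 hj).lt_or_eq with hj | rfl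
      · exact hpj j hj
      · exact Or.inl h
    · obtain ⟨p, hp, hyp⟩ := (F.stage_iter c hN h0 n).near _ (mem_image_of_mem _ hx) (by linarith)
      have hp2 := norm_sub_norm_le p (F.iter n x)
      rw [norm_sub_rev] at hp2
      refine ⟨p, hp, by linarith [dyadicScale_le n], fun j hj => ?_⟩
      have hjn := Nat.lt_succ_iff.1 hj
      have h3 := F.norm_iter_sub_iter_le c hN h0 hx hjn
      refine (F.step_eq_self_or_norm_le c hN (hn j hj)).imp_right fun h => ⟨h.1, h.2, ?_⟩
      have h4 := norm_sub_le (F.iter n x - p) (F.iter n x - F.iter j x)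
      rw [sub_sub_sub_cancel_left] at h4
      have h5 : dyadicScale n ≤ dyadicScale j := by
        have := norm_nonneg (F.iter n x - F.iter j x)
        linarith
      linarith

/-- The distortion as long as the distance is below the scale: the flatness numbers of one point
of `S` at the different scales add up. -/
theorem logClose_iter_of_le (hN : (26 : ℝ) ^ k ≤ N) (h0 : (0 : X) ∈ S) (hα : 1 ≤ α) (hα2 : α ≤ 2)
    (hC : 0 ≤ C) (hAO : ∀ x r, IsAdmissibleBall S x r → AlmostOrthogonal α C (F.P x r))
    (hx : x ∈ F.basePlane) (hx' : x' ∈ F.basePlane) {n : ℕ}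
    (hn : ∀ j < n, ‖F.iter j x - F.iter j x'‖ ≤ dyadicScale j) {T : ℝ}
    (hT : ∀ p ∈ S, ‖p‖ ≤ 3 / 2 → ∑ j ∈ Finset.range n, F.stageFlatness j p ^ α ≤ T) :
    LogClose (56 * K * N ^ 2 * CE ^ 2 * C * T) ‖F.iter n x - F.iter n x'‖ ‖x - x'‖ := by
  have hK := c.K_pos
  obtain ⟨p, hp, hp2, hpj⟩ := F.exists_reference_point c hN h0 hx hn
  have key : ∀ m ≤ n, LogClose (56 * K * N ^ 2 * CE ^ 2 * C
      * ∑ j ∈ Finset.range m, F.stageFlatness j p ^ α) ‖F.iter m x - F.iter m x'‖ ‖x - x'‖ := by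
    intro m hm
    induction m with
    | zero => simpa [iter] using LogClose.refl _
    | succ m ih =>
      have h1 := ih (Nat.le_of_succ_le hm)
      have hb := Real.rpow_nonneg (F.stageFlatness_nonneg m p) α
      rw [Finset.sum_range_succ, mul_add, add_comm]
      refine LogClose.trans ?_ h1
      change LogClose _ ‖F.step m (F.iter m x) - F.step m (F.iter m x')‖ _
      have hr := dyadicScale_pos m
      have hm' := hn m hm
      rcases hpj m hm with ⟨h2, h3⟩ | ⟨h2, h3, h4⟩
      · rw [h2, h3]
        exact (LogClose.refl _).mono (norm_nonneg _) (norm_nonneg _) (by positivity)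
      · exact F.logClose_step c hN h0 hα hα2 hC hAO (F.stage_iter c hN h0 m)
          (mem_image_of_mem _ hx) (mem_image_of_mem _ hx') (by linarith) (by linarith)
          (by linarith) hp h4
  refine (key n le_rfl).mono (norm_nonneg _) (norm_nonneg _) ?_
  have := hT p hp hp2
  gcongr

/-- The first stage at which the distance exceeds the scale. -/
theorem exists_exit_stage (hN : (26 : ℝ) ^ k ≤ N) (h0 : (0 : X) ∈ S) (hx : x ∈ F.basePlane)
    (hx' : x' ∈ F.basePlane) (hne : x ≠ x') :
    ∃ i, (∀ j < i, ‖F.iter j x - F.iter j x'‖ ≤ dyadicScale j) ∧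
      dyadicScale i < ‖F.iter i x - F.iter i x'‖ ∧
      (i = 0 ∨ ‖F.iter i x - F.iter i x'‖ ≤ 3 * dyadicScale i) ∧
      (i = 0 ∨ ‖x - x'‖ ≤ (2 / 3) ^ i) := by
  have hpos : 0 < ‖x - x'‖ := norm_pos_iff.2 (sub_ne_zero.2 hne)
  have hbound : ∀ n, (∀ j < n + 1, ‖F.iter j x - F.iter j x'‖ ≤ dyadicScale j) →
      ‖x - x'‖ ≤ 1 / 1000 * (2 / 3) ^ n := by
    intro n hn
    have h1 := F.norm_iter_sub_ge c hN h0 hx hx' fun j hj => hn j (hj.trans n.lt_succ_self)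
    have h2 := h1.trans (hn n n.lt_succ_self)
    have h3 : (1 / 2 : ℝ) ^ n = (3 / 4) ^ n * (2 / 3) ^ n := by
      rw [← mul_pow]; norm_num
    unfold dyadicScale at h2
    rw [h3] at h2
    have h4 : (0 : ℝ) < (3 / 4) ^ n := by positivity
    nlinarith
  have hex : ∃ i, dyadicScale i < ‖F.iter i x - F.iter i x'‖ := by
    by_contra! hcon
    have h1 : Tendsto (fun n : ℕ => 1 / 1000 * (2 / 3 : ℝ) ^ n) atTop (𝓝 (1 / 1000 * 0)) :=
      (tendsto_pow_atTop_nhds_zero_of_lt_one (by norm_num) (by norm_num)).const_mul _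
    have := ge_of_tendsto h1 (Eventually.of_forall fun n => hbound n fun j _ => hcon j)
    linarith
  classical
  refine ⟨Nat.find hex, fun j hj => not_lt.1 (Nat.find_min hex hj), Nat.find_spec hex, ?_, ?_⟩
  · rcases hi : Nat.find hex with _ | n
    · exact Or.inl rfl
    · right
      have h1 := not_lt.1 (Nat.find_min hex (m := n) (by omega))
      have hT := F.stage_iter c hN h0 n
      have h2 := (F.norm_step_sub_le_scale c hN h0 hT (mem_image_of_mem _ hx)).1
      have h3 := (F.norm_step_sub_le_scale c hN h0 hT (mem_image_of_mem _ hx')).1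
      change ‖F.step n (F.iter n x) - F.step n (F.iter n x')‖ ≤ _
      rw [dyadicScale_succ]
      have e : F.step n (F.iter n x) - F.step n (F.iter n x')
        = (F.iter n x - F.iter n x') + (F.step n (F.iter n x) - F.iter n x)
          - (F.step n (F.iter n x') - F.iter n x') := by abel
      rw [e]
      have h4 := norm_sub_le ((F.iter n x - F.iter n x') + (F.step n (F.iter n x) - F.iter n x))
        (F.step n (F.iter n x') - F.iter n x')
      have h5 := norm_add_le (F.iter n x - F.iter n x') (F.step n (F.iter n x) - F.iter n x)
      linarith [dyadicScale_pos n]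
  · rcases hi : Nat.find hex with _ | n
    · exact Or.inl rfl
    · right
      refine (hbound n fun j hj => not_lt.1 (Nat.find_min hex (m := j) (by omega))).trans ?_
      rw [pow_succ]
      have : (0 : ℝ) < (2 / 3) ^ n := by positivity
      linarith

/-! ### Distortion at distances above the scale -/

variable {q : ℝ}

theorem norm_step_sub_le_of_flatness_le (hN : (26 : ℝ) ^ k ≤ N) (h0 : (0 : X) ∈ S) {j : ℕ}
    (hq0 : 0 ≤ q) (hq : ∀ p ∈ S, ‖p‖ ≤ 3 / 2 → F.stageFlatness j p ≤ q) (hx : x ∈ F.basePlane) :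
    ‖F.iter (j + 1) x - F.iter j x‖ ≤ CD * q * dyadicScale j := by
  have hr := dyadicScale_pos j
  have hT := F.stage_iter c hN h0 j
  have hCD := c.CA_ge.trans c.CA_le
  change ‖F.step j (F.iter j x) - F.iter j x‖ ≤ _
  rcases lt_or_ge (1 + 24 * dyadicScale j) ‖F.iter j x‖ with h | h
  · rw [F.step_eq_self c hN h, sub_self, norm_zero]
    positivity
  · obtain ⟨p, hp, hyp⟩ := hT.near _ (mem_image_of_mem _ hx) (by linarith)
    have hp2 := norm_sub_norm_le p (F.iter j x)
    rw [norm_sub_rev] at hp2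
    refine (F.norm_step_sub_le c hN hT (mem_image_of_mem _ hx) hp (by linarith)).trans ?_
    gcongr
    exact hq p hp (by linarith [dyadicScale_le j])

theorem norm_iter_sub_iter_le_of_flatness_le (hN : (26 : ℝ) ^ k ≤ N) (h0 : (0 : X) ∈ S) {i j : ℕ}
    (hij : i ≤ j) (hq0 : 0 ≤ q)
    (hq : ∀ j, i ≤ j → ∀ p ∈ S, ‖p‖ ≤ 3 / 2 → F.stageFlatness j p ≤ q) (hx : x ∈ F.basePlane) :
    ‖F.iter j x - F.iter i x‖ ≤ 2 * CD * q * (dyadicScale i - dyadicScale j) := by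
  induction j, hij using Nat.le_induction with
  | base => simp
  | succ m hm ih =>
    have h1 := F.norm_step_sub_le_of_flatness_le c hN h0 hq0 (hq m hm) hx
    have h2 := norm_add_le (F.iter (m + 1) x - F.iter m x) (F.iter m x - F.iter i x)
    rw [sub_add_sub_cancel] at h2
    rw [dyadicScale_succ]
    linarith

/-- The difference vector changes little after the distance has exceeded the scale. -/
theorem norm_iter_sub_sub_le (hN : (26 : ℝ) ^ k ≤ N) (h0 : (0 : X) ∈ S) {i j : ℕ}
    (hij : i ≤ j) (hq0 : 0 ≤ q) (hqε : q ≤ 2 * ε)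
    (hq : ∀ j, i ≤ j → ∀ p ∈ S, ‖p‖ ≤ 3 / 2 → F.stageFlatness j p ≤ q) (hx : x ∈ F.basePlane)
    (hx' : x' ∈ F.basePlane) (hi : dyadicScale i < ‖F.iter i x - F.iter i x'‖) :
    ‖(F.iter j x - F.iter j x') - (F.iter i x - F.iter i x')‖
        ≤ 4 * CD * q * ‖F.iter i x - F.iter i x'‖ ∧
      ‖F.iter i x - F.iter i x'‖ ≤ 2 * ‖F.iter j x - F.iter j x'‖ := by
  have hr := dyadicScale_pos j
  have hCD := c.CA_ge.trans c.CA_le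
  have h1 := F.norm_iter_sub_iter_le_of_flatness_le c hN h0 hij hq0 hq hx
  have h2 := F.norm_iter_sub_iter_le_of_flatness_le c hN h0 hij hq0 hq hx'
  have hb : 2 * CD * q * (dyadicScale i - dyadicScale j)
      ≤ 2 * CD * q * ‖F.iter i x - F.iter i x'‖ := by gcongr; linarith
  have e : (F.iter j x - F.iter j x') - (F.iter i x - F.iter i x')
      = (F.iter j x - F.iter i x) - (F.iter j x' - F.iter i x') := by abel
  have h3 := norm_sub_le (F.iter j x - F.iter i x) (F.iter j x' - F.iter i x')
  rw [← e] at h3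
  have h4 : ‖(F.iter j x - F.iter j x') - (F.iter i x - F.iter i x')‖
        ≤ 4 * CD * q * ‖F.iter i x - F.iter i x'‖ := by linarith
  refine ⟨h4, ?_⟩
  have h5 : 4 * CD * q ≤ 1 / 2 := by
    have h6 : CD * q ≤ CE * (2 * ε) := by
      have := c.CE_ge
      gcongr
      exact c.CD_le_CE
    linarith [c.small_CE']
  have h6 := norm_sub_norm_le (F.iter i x - F.iter i x') (F.iter j x - F.iter j x')
  rw [norm_sub_rev (F.iter i x - F.iter i x') (F.iter j x - F.iter j x')] at h6
  nlinarith [norm_nonneg (F.iter i x - F.iter i x')]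

/-- At the first stage at which the distance exceeds the scale, the difference vector is close to
the reference planes. -/
theorem norm_exit_sub_apply_le (hN : (26 : ℝ) ^ k ≤ N) (h0 : (0 : X) ∈ S) {i : ℕ}
    (hx : x ∈ F.basePlane) (hx' : x' ∈ F.basePlane)
    (hi3 : i = 0 ∨ ‖F.iter i x - F.iter i x'‖ ≤ 3 * dyadicScale i) {a : X} (ha : a ∈ S)
    (ha1 : ‖a‖ ≤ 1 + 21 * dyadicScale i)
    (hay : ‖F.iter i x - a‖ ≤ 4 * dyadicScale i ∨ ‖F.iter i x' - a‖ ≤ 4 * dyadicScale i) :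
    ‖(F.iter i x - F.iter i x') - F.P a (100 * dyadicScale i) (F.iter i x - F.iter i x')‖
      ≤ CB * F.stageFlatness i a * ‖F.iter i x - F.iter i x'‖ := by
  have hr := dyadicScale_pos i
  rcases hi3 with rfl | hi3
  · refine (F.norm_sub_apply_le_base c h0 ha (by linarith [dyadicScale_le 0])
      (F.basePlane.sub_mem hx hx')).trans ?_
    have h1 : 76 * K ^ 2 ≤ CB := by
      have h1 := c.le_CB
      have h2 : 1 ≤ N ^ 2 := one_le_pow₀ c.one_le_N
      have h3 : 1 ≤ K ^ 2 := one_le_pow₀ c.one_le_K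
      nlinarith
    have h2 : F.flatness 0 (19 / 10) ≤ F.stageFlatness 0 a := by
      unfold stageFlatness
      rw [if_pos rfl]
      linarith [F.flatness_nonneg a (100 * dyadicScale 0)]
    have h3 := F.flatness_nonneg 0 (19 / 10)
    have h4 := c.CB_ge
    change _ ≤ CB * F.stageFlatness 0 a * ‖x - x'‖
    gcongr
  · have key : ∀ y ∈ F.basePlane, ∀ z ∈ F.basePlane,
        ‖F.iter i y - F.iter i z‖ ≤ 3 * dyadicScale i → ‖F.iter i y - a‖ ≤ 4 * dyadicScale i →
        ‖(F.iter i y - F.iter i z) - F.P a (100 * dyadicScale i) (F.iter i y - F.iter i z)‖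
          ≤ CB * F.stageFlatness i a * ‖F.iter i y - F.iter i z‖ := by
      intro y hy z hz hyz hya
      have h1 := norm_sub_norm_le (F.iter i y) a
      have h2 := norm_sub_norm_le (F.iter i z) (F.iter i y)
      rw [norm_sub_rev] at h2
      exact (F.stage_iter c hN h0 i).angle _ (mem_image_of_mem _ hy) _ (mem_image_of_mem _ hz)
        (by linarith) (by linarith) hyz a ha (by linarith)
    rcases hay with hay | hay
    · exact key x hx x' hx' hi3 hay
    · have h := key x' hx' x hx (by rwa [norm_sub_rev]) hay
      rw [← neg_sub (F.iter i x) (F.iter i x'), map_neg, neg_sub_neg, norm_neg, norm_sub_rev] at h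
      exact h

/-- Passing from the reference plane at scale `i` to the one at scale `j`, a vector loses an error
of the size of the flatness with each scale. -/
theorem exists_mem_near_of_le {i j : ℕ} (hij : i ≤ j) (hq0 : 0 ≤ q) (hqε : q ≤ 2 * ε) {a : X}
    (ha : a ∈ S) (ha2 : ‖a‖ < 2) (hq : ∀ l, i ≤ l → F.stageFlatness l a ≤ q) {u : X} {d : ℝ}
    (hd : ‖u - F.P a (100 * dyadicScale i) u‖ ≤ d) :
    ∃ w ∈ F.W a (100 * dyadicScale j), ‖w‖ ≤ 2 * ‖u‖ ∧
      ‖u - w‖ ≤ d + 16 * K ^ 2 * q * (j - i : ℕ) * ‖u‖ := by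
  have hK := c.K_pos
  have hadm : ∀ l, IsAdmissibleBall S a (100 * dyadicScale l) := fun l =>
    isAdmissibleBall_mul_dyadicScale ha ha2 (by norm_num) le_rfl
  -- The zero vector serves once the error exceeds the length of `u`.
  have haux : ∀ l, ∀ w ∈ F.W a (100 * dyadicScale l), ∀ e, ‖u - w‖ ≤ e →
      ∃ w ∈ F.W a (100 * dyadicScale l), ‖w‖ ≤ 2 * ‖u‖ ∧ ‖u - w‖ ≤ e := by
    intro l w hw e he
    rcases le_or_gt ‖u‖ e with h | h
    · exact ⟨0, Submodule.zero_mem _, by simp, by simpa using h⟩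
    · refine ⟨w, hw, ?_, he⟩
      have := norm_sub_le u (u - w)
      rw [sub_sub_cancel] at this
      linarith
  induction j, hij using Nat.le_induction with
  | base =>
    refine haux _ _ ((F.proj (hadm i)).mem u) _ (hd.trans ?_)
    simp
  | succ m hm ih =>
    obtain ⟨w, hw, hwu, hwd⟩ := ih
    have hr := dyadicScale_pos m
    have hratio : 100 * dyadicScale m / (100 * dyadicScale (m + 1)) = 2 := by
      rw [dyadicScale_succ]; field_simp
    have hf : F.flatness a (100 * dyadicScale m) ≤ q :=
      (F.flatness_le_stageFlatness m a).trans (hq m hm)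
    have hf0 := F.flatness_nonneg a (100 * dyadicScale m)
    have hs : K * F.flatness a (100 * dyadicScale m) * 2 ≤ 1 / 2 := by
      have h1 := c.small_ε
      have h2 : K * F.flatness a (100 * dyadicScale m) ≤ K * (2 * ε) := by
        gcongr; linarith
      linarith [mul_nonneg hK.le c.ε_nonneg]
    have h := F.tilt_reverse c.one_le_K (hadm (m + 1)) (hadm m)
      (by rw [sub_self, norm_zero, dyadicScale_succ]; linarith) (by rwa [hratio]) w hw
    rw [hratio] at h
    refine haux _ _ ((F.proj (hadm (m + 1))).mem w) _ ?_
    have h1 : 4 * K * (K * F.flatness a (100 * dyadicScale m) * 2) * ‖w‖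
        ≤ 4 * K * (K * q * 2) * (2 * ‖u‖) := by gcongr
    have h2 := norm_add_le (u - w) (w - F.P a (100 * dyadicScale (m + 1)) w)
    rw [sub_add_sub_cancel] at h2
    have h3 : ((m + 1 - i : ℕ) : ℝ) = (m - i : ℕ) + 1 := by
      rw [Nat.succ_sub hm]; push_cast; ring
    rw [h3]
    linarith

end FlatSystem

theorem dyadicScale_add (i m : ℕ) : dyadicScale (i + m) = dyadicScale i / 2 ^ m := by
  unfold dyadicScale
  rw [pow_add, one_div_pow 2 m]
  ring

namespace FlatSystem

variable {k : ℕ} {K ε : ℝ} {S : Set X} (F : FlatSystem k K ε S)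
  {N CA CB CD CE : ℝ} (c : StepConstants K N CA CB CD CE ε)
  {α C q A : ℝ} {x x' : X}

include F c

/-- The difference vector at stage `i + m` makes an angle of order `(m + 1) * q` with the planes of
the net points that act on it, if its length exceeds the scale since stage `i`. -/
theorem norm_sub_apply_le_of_lt (hN : (26 : ℝ) ^ k ≤ N) (h0 : (0 : X) ∈ S)
    (hA : 8 * K ^ 2 * (CB + 16 * K ^ 2 + 4 * CD) + 20 * K ^ 3 ≤ A) {i m : ℕ}
    (hq0 : 0 ≤ q) (hqε : q ≤ 2 * ε)
    (hq : ∀ j, i ≤ j → ∀ p ∈ S, ‖p‖ ≤ 3 / 2 → F.stageFlatness j p ≤ q) (hx : x ∈ F.basePlane)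
    (hx' : x' ∈ F.basePlane) (hi : dyadicScale i < ‖F.iter i x - F.iter i x'‖)
    (hi3 : i = 0 ∨ ‖F.iter i x - F.iter i x'‖ ≤ 3 * dyadicScale i) {a : X} (ha : a ∈ S)
    (ha1 : ‖a‖ ≤ 1 + 21 * dyadicScale (i + m))
    (hay : ‖a - F.iter (i + m) x‖ ≤ 3 * dyadicScale (i + m) ∨
      ‖a - F.iter (i + m) x'‖ ≤ 3 * dyadicScale (i + m)) :
    ‖(F.iter (i + m) x - F.iter (i + m) x') - F.P a (20 * dyadicScale (i + m))
        (F.iter (i + m) x - F.iter (i + m) x')‖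
      ≤ A * (m + 1) * q * ‖F.iter (i + m) x - F.iter (i + m) x'‖ := by
  have hr := dyadicScale_pos i
  have hK := c.K_pos
  have hCB := c.CB_ge
  have hCD := c.CA_ge.trans c.CA_le
  have hsc : dyadicScale (i + m) ≤ dyadicScale i := by
    rw [dyadicScale_add]
    exact div_le_self hr.le (one_le_pow₀ (by norm_num))
  have ha2 : ‖a‖ ≤ 3 / 2 := by linarith [dyadicScale_le (i + m)]
  have hqa : ∀ l, i ≤ l → F.stageFlatness l a ≤ q := fun l hl => hq l hl a ha ha2
  obtain ⟨hclose, hlen⟩ :=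
    F.norm_iter_sub_sub_le c hN h0 (Nat.le_add_right i m) hq0 hqε hq hx hx' hi
  have hmove : ∀ y ∈ F.basePlane, ‖a - F.iter (i + m) y‖ ≤ 3 * dyadicScale (i + m) →
      ‖F.iter i y - a‖ ≤ 4 * dyadicScale i := by
    intro y hy hya
    have h1 := F.norm_iter_sub_iter_le' c hN h0 hy (Nat.le_add_right i m)
    have h2 := norm_add_le (a - F.iter (i + m) y) (F.iter (i + m) y - F.iter i y)
    rw [sub_add_sub_cancel] at h2
    rw [norm_sub_rev]
    linarith
  have hexit := F.norm_exit_sub_apply_le c hN h0 hx hx' hi3 ha (by linarith)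
    (hay.imp (hmove x hx) (hmove x' hx'))
  set u₀ := F.iter i x - F.iter i x' with hu₀
  set u := F.iter (i + m) x - F.iter (i + m) x' with hu
  have hexit' : ‖u₀ - F.P a (100 * dyadicScale i) u₀‖ ≤ CB * q * ‖u₀‖ := by
    refine hexit.trans ?_
    gcongr
    exact hqa i le_rfl
  obtain ⟨w, hw, -, hwd⟩ := F.exists_mem_near_of_le c (Nat.le_add_right i m) hq0 hqε ha
    (by linarith) hqa hexit'
  rw [Nat.add_sub_cancel_left] at hwd
  have huw : ‖u - w‖ ≤ (CB + 16 * K ^ 2 * m + 4 * CD) * q * (2 * ‖u‖) := by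
    have h1 := norm_add_le (u - u₀) (u₀ - w)
    rw [sub_add_sub_cancel] at h1
    calc ‖u - w‖ ≤ (CB + 16 * K ^ 2 * m + 4 * CD) * q * ‖u₀‖ := by linarith
      _ ≤ _ := by gcongr
  have hadm := isAdmissibleBall_mul_dyadicScale (i := i + m) ha (by linarith) (m := 100)
    (by norm_num) le_rfl
  have h1 := (F.proj hadm).norm_sub_apply_le_of_mem (F.norm_le hadm) c.one_le_K u hw
  have h2 := F.norm_sub_apply_le_reference c (i := i + m) ha (by linarith) ha (by linarith)
    (by rw [sub_self, norm_zero]; have := dyadicScale_pos (i + m); positivity) u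
  refine h2.trans ?_
  have h3 : 20 * K ^ 3 * F.stageFlatness (i + m) a * ‖u‖ ≤ 20 * K ^ 3 * q * ‖u‖ := by
    gcongr
    exact hqa _ (Nat.le_add_right i m)
  have h4 : 2 * K * ‖u - F.P a (100 * dyadicScale (i + m)) u‖
      ≤ 2 * K * (2 * K * ((CB + 16 * K ^ 2 * m + 4 * CD) * q * (2 * ‖u‖))) := by
    gcongr
    exact h1.trans (by gcongr)
  have h5 : 8 * K ^ 2 * (CB + 16 * K ^ 2 * m + 4 * CD) + 20 * K ^ 3 ≤ A * (m + 1) := by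
    have e1 : (8 * K ^ 2 * (CB + 16 * K ^ 2 + 4 * CD) + 20 * K ^ 3) * (m + 1) ≤ A * (m + 1) := by
      gcongr
    have e2 : 0 ≤ 8 * K ^ 2 * (CB + 16 * K ^ 2 + 4 * CD) + 20 * K ^ 3 := by positivity
    have e3 : 0 ≤ (8 * K ^ 2 * CB + 8 * K ^ 2 * (4 * CD) + 20 * K ^ 3) * m := by positivity
    have e4 : 0 ≤ 8 * K ^ 2 * (16 * K ^ 2) := by positivity
    linarith
  have h6 : (8 * K ^ 2 * (CB + 16 * K ^ 2 * m + 4 * CD) + 20 * K ^ 3) * (q * ‖u‖)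
      ≤ A * (m + 1) * (q * ‖u‖) := by gcongr
  linarith

/-- The distortion in one step, of a distance above the scale since stage `i`. -/
theorem logClose_iter_succ_of_lt (hN : (26 : ℝ) ^ k ≤ N) (h0 : (0 : X) ∈ S)
    (hα : 1 ≤ α) (hα2 : α ≤ 2)
    (hC : 0 ≤ C) (hAO : ∀ x r, IsAdmissibleBall S x r → AlmostOrthogonal α C (F.P x r))
    (hA : 8 * K ^ 2 * (CB + 16 * K ^ 2 + 4 * CD) + 20 * K ^ 3 ≤ A) {i : ℕ} (m : ℕ)
    (hq0 : 0 ≤ q) (hqε : q ≤ 2 * ε)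
    (hq : ∀ j, i ≤ j → ∀ p ∈ S, ‖p‖ ≤ 3 / 2 → F.stageFlatness j p ≤ q) (hx : x ∈ F.basePlane)
    (hx' : x' ∈ F.basePlane) (hi : dyadicScale i < ‖F.iter i x - F.iter i x'‖)
    (hi3 : i = 0 ∨ ‖F.iter i x - F.iter i x'‖ ≤ 3 * dyadicScale i) :
    LogClose (224 * K * N ^ 2 * CD * A * C * q ^ α * ((m + 1) / 2 ^ m))
      ‖F.iter (i + m + 1) x - F.iter (i + m + 1) x'‖ ‖F.iter (i + m) x - F.iter (i + m) x'‖ := by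
  classical
  have hri := dyadicScale_pos i
  have hr := dyadicScale_pos (i + m)
  have hK := c.K_pos
  have hN1 := c.one_le_N
  have hCB := c.CB_ge
  have hCD := c.CA_ge.trans c.CA_le
  have hov := F.hasBoundedOverlap c hN (i + m)
  have hT := F.stage_iter c hN h0 (i + m)
  have hACD : 4 * CD ≤ A := by
    have h1 : 1 ≤ K ^ 2 := one_le_pow₀ c.one_le_K
    have h2 := pow_pos hK 3
    nlinarith
  have hpow : (1 : ℝ) ≤ 2 ^ m := one_le_pow₀ (by norm_num)
  obtain ⟨-, hlen⟩ := F.norm_iter_sub_sub_le c hN h0 (Nat.le_add_right i m) hq0 hqε hq hx hx' hi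
  have hCDq : CD * q ≤ CE * (2 * ε) := by
    have := c.CE_ge
    gcongr
    exact c.CD_le_CE
  have hscale : dyadicScale (i + m) ≤ 2 / 2 ^ m * ‖F.iter (i + m) x - F.iter (i + m) x'‖ := by
    rw [dyadicScale_add]
    calc dyadicScale i / 2 ^ m ≤ 2 * ‖F.iter (i + m) x - F.iter (i + m) x'‖ / 2 ^ m := by
          gcongr; linarith
      _ = _ := by ring
  -- The contribution of a net point to the displacement of a point of the surface.
  have hdisp : ∀ y ∈ F.basePlane, ∀ a ∈ net S (i + m),
      ‖netWeight (net S (i + m)) (dyadicScale (i + m)) a (F.iter (i + m) y)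
          • ((a - F.iter (i + m) y)
            - F.P a (20 * dyadicScale (i + m)) (a - F.iter (i + m) y))‖
        ≤ CD * q * dyadicScale (i + m) := by
    intro y hy a ha
    by_cases hnear : a ∈ nearPoints (net S (i + m)) (dyadicScale (i + m)) (F.iter (i + m) y)
    · obtain ⟨h1, h2, h3⟩ := F.norm_le_of_mem_nearPoints c hN hnear
      have ha1 : ‖a‖ ≤ 1 + 21 * dyadicScale (i + m) := ((net_spec S (i + m)).1 ha).2
      have h4 := F.norm_displacement_le c hT (mem_image_of_mem _ hy) (by linarith) h1
        (by linarith) h1 (by rw [norm_sub_rev]; linarith)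
      rw [norm_smul, Real.norm_of_nonneg (netWeight_nonneg _ _)]
      refine (mul_le_of_le_one_left (norm_nonneg _) (netWeight_le_one hr hov ha)).trans
        (h4.trans ?_)
      gcongr
      exact hq _ (Nat.le_add_right i m) a h1 (by linarith [dyadicScale_le (i + m)])
    · rw [netWeight_eq_zero hr hov ha hnear, zero_smul, norm_zero]
      positivity
  have hsub := averagedProjection_sub (P := fun a => F.P a (20 * dyadicScale (i + m))) hr hov
    (F.iter (i + m) x) (F.iter (i + m) x')
  change F.iter (i + m + 1) x - F.iter (i + m + 1) x' = _ at hsub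
  set G := nearPoints (net S (i + m)) (dyadicScale (i + m)) (F.iter (i + m) x) ∪
    nearPoints (net S (i + m)) (dyadicScale (i + m)) (F.iter (i + m) x') with hG
  have hGnet : ∀ a ∈ G, a ∈ net S (i + m) := fun a ha =>
    (Finset.mem_union.1 ha).elim (fun h => ((mem_nearPoints hov).1 h).1)
      fun h => ((mem_nearPoints hov).1 h).1
  have hGnorm : ∀ a ∈ G, ‖a‖ ≤ 1 + 21 * dyadicScale (i + m) := fun a ha =>
    ((net_spec S (i + m)).1 (hGnet a ha)).2
  have hGS : ∀ a ∈ G, a ∈ S := fun a ha => ((net_spec S (i + m)).1 (hGnet a ha)).1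
  have hadm : ∀ a ∈ G, IsAdmissibleBall S a (20 * dyadicScale (i + m)) := fun a ha =>
    isAdmissibleBall_mul_dyadicScale (hGS a ha)
      (by linarith [hGnorm a ha, dyadicScale_le (i + m)]) (by norm_num) (by norm_num)
  have hEn : ∀ a ∈ G, ‖(netWeight (net S (i + m)) (dyadicScale (i + m)) a (F.iter (i + m) x)
        • (a - F.iter (i + m) x)
      - netWeight (net S (i + m)) (dyadicScale (i + m)) a (F.iter (i + m) x')
        • (a - F.iter (i + m) x'))
      - F.P a (20 * dyadicScale (i + m))
        (netWeight (net S (i + m)) (dyadicScale (i + m)) a (F.iter (i + m) x)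
        • (a - F.iter (i + m) x)
      - netWeight (net S (i + m)) (dyadicScale (i + m)) a (F.iter (i + m) x')
        • (a - F.iter (i + m) x'))‖ ≤ 2 * (CD * q * dyadicScale (i + m)) := by
    intro a ha
    have h1 := hdisp x hx a (hGnet a ha)
    have h2 := hdisp x' hx' a (hGnet a ha)
    refine le_trans (le_of_eq ?_) ((norm_sub_le _ _).trans ((add_le_add h1 h2).trans_eq
      (two_mul _).symm))
    congr 1
    simp only [map_sub, map_smul, smul_sub]
    abel
  set u := F.iter (i + m) x - F.iter (i + m) x' with hu
  have hb : 2 * (CD * q * dyadicScale (i + m)) ≤ 4 * CD * q / 2 ^ m * ‖u‖ := by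
    calc 2 * (CD * q * dyadicScale (i + m)) ≤ 2 * (CD * q * (2 / 2 ^ m * ‖u‖)) := by gcongr
      _ = _ := by ring
  have hba : 4 * CD * q / 2 ^ m ≤ A * (m + 1) * q := by
    refine (div_le_self (by positivity) hpow).trans ?_
    have : 4 * CD * q ≤ A * q := by gcongr
    have h2 : 0 ≤ A * q * m := by
      have : 0 ≤ A := by linarith
      positivity
    linarith
  have hNCE : N * (CE * ε) ≤ 1 / 1000 := by
    have h2 : N * (CE * ε) ≤ K * (N * (CE * ε)) := by
      have := c.ε_nonneg
      have := c.CE_ge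
      exact le_mul_of_one_le_left (by positivity) c.one_le_K
    linarith [c.small_CE]
  have hnb : 2 * N * (4 * CD * q / 2 ^ m) ≤ 1 / 4 := by
    calc 2 * N * (4 * CD * q / 2 ^ m) ≤ 2 * N * (4 * CD * q) := by
          gcongr
          exact div_le_self (by positivity) hpow
      _ = 8 * (N * (CD * q)) := by ring
      _ ≤ 8 * (N * (CE * (2 * ε))) := by gcongr
      _ ≤ 1 / 4 := by linarith
  have h := abs_norm_add_sum_sub_norm_le G _ (fun a => F.P a (20 * dyadicScale (i + m))) hα2 hC
    c.one_le_K (n := 2 * N) (by linarith) (card_union_nearPoints_le hov _ _)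
    (fun a ha => F.norm_le (hadm a ha)) (fun a ha => hAO _ _ (hadm a ha))
    (fun a ha => (F.proj (hadm a ha)).map_sub_self _) u
    (b := 4 * CD * q / 2 ^ m) (a := A * (m + 1) * q) (by positivity) hba hnb
    (fun a ha => (hEn a ha).trans hb) (fun a ha => F.norm_sub_apply_le_of_lt c hN h0 hA hq0 hqε hq
      hx hx' hi hi3 (hGS a ha) (hGnorm a ha) ((Finset.mem_union.1 ha).imp
        (fun h => ((mem_nearPoints hov).1 h).2.le) fun h => ((mem_nearPoints hov).1 h).2.le))
  rw [← hsub] at h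
  have hApos : 0 ≤ A := by linarith
  have hA1 : 1 ≤ A * (m + 1) := by
    have : 0 ≤ A * m := by positivity
    linarith
  have h3 := mul_rpow_sub_one_le hA1 hq0 hα hα2
  have h4 : 7 * C * K * (2 * N) ^ 2 * (4 * CD * q / 2 ^ m) * (A * (m + 1) * q) ^ (α - 1)
      ≤ 112 * K * N ^ 2 * CD * A * C * q ^ α * ((m + 1) / 2 ^ m) := by
    calc _ = 112 * K * N ^ 2 * CD * C / 2 ^ m * (q * (A * (m + 1) * q) ^ (α - 1)) := by ring
      _ ≤ 112 * K * N ^ 2 * CD * C / 2 ^ m * (A * (m + 1) * q ^ α) := by gcongr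
      _ = _ := by ring
  have h5 := LogClose.of_abs_sub_le (norm_nonneg _) (norm_nonneg _)
    (h.trans (mul_le_mul_of_nonneg_right h4 (norm_nonneg _))) (by
      refine (abs_norm_sub_norm_le _ _).trans ?_
      have e : F.iter (i + m + 1) x - F.iter (i + m + 1) x' - u
          = (F.iter (i + m + 1) x - F.iter (i + m) x)
            - (F.iter (i + m + 1) x' - F.iter (i + m) x') := by rw [hu]; abel
      rw [e]
      have e1 := F.norm_step_sub_le_of_flatness_le c hN h0 hq0 (hq _ (Nat.le_add_right i m)) hx
      have e2 := F.norm_step_sub_le_of_flatness_le c hN h0 hq0 (hq _ (Nat.le_add_right i m)) hx'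
      refine (norm_sub_le _ _).trans ((add_le_add e1 e2).trans ?_)
      have e3 : 4 * CD * q / 2 ^ m * ‖u‖ ≤ 1 / 2 * ‖u‖ := by
        refine mul_le_mul_of_nonneg_right ?_ (norm_nonneg _)
        refine (div_le_self (by positivity) hpow).trans ?_
        have : CE * (2 * ε) ≤ N * (CE * (2 * ε)) := by
          have := c.CE_ge
          have := c.ε_nonneg
          exact le_mul_of_one_le_left (by positivity) hN1
        linarith
      linarith)
  convert h5 using 1
  ring

/-- The total distortion after the distance has exceeded the scale: the contributions of the
scales decay geometrically. -/
theorem logClose_iter_of_lt (hN : (26 : ℝ) ^ k ≤ N) (h0 : (0 : X) ∈ S)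
    (hα : 1 ≤ α) (hα2 : α ≤ 2)
    (hC : 0 ≤ C) (hAO : ∀ x r, IsAdmissibleBall S x r → AlmostOrthogonal α C (F.P x r))
    (hA : 8 * K ^ 2 * (CB + 16 * K ^ 2 + 4 * CD) + 20 * K ^ 3 ≤ A) {i : ℕ} (m : ℕ)
    (hq0 : 0 ≤ q) (hqε : q ≤ 2 * ε)
    (hq : ∀ j, i ≤ j → ∀ p ∈ S, ‖p‖ ≤ 3 / 2 → F.stageFlatness j p ≤ q) (hx : x ∈ F.basePlane)
    (hx' : x' ∈ F.basePlane) (hi : dyadicScale i < ‖F.iter i x - F.iter i x'‖)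
    (hi3 : i = 0 ∨ ‖F.iter i x - F.iter i x'‖ ≤ 3 * dyadicScale i) :
    LogClose (896 * K * N ^ 2 * CD * A * C * q ^ α)
      ‖F.iter (i + m) x - F.iter (i + m) x'‖ ‖F.iter i x - F.iter i x'‖ := by
  have hK := c.K_pos
  have hCB := c.CB_ge
  have hCD := c.CA_ge.trans c.CA_le
  have hApos : 0 ≤ A := le_trans (by positivity) hA
  have hqα := Real.rpow_nonneg hq0 α
  have key : ∀ m : ℕ, LogClose (224 * K * N ^ 2 * CD * A * C * q ^ α * (4 - (2 * m + 4) / 2 ^ m))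
      ‖F.iter (i + m) x - F.iter (i + m) x'‖ ‖F.iter i x - F.iter i x'‖ := by
    intro m
    induction m with
    | zero => simpa using LogClose.refl _
    | succ m ih =>
      have h := (F.logClose_iter_succ_of_lt c hN h0 hα hα2 hC hAO hA m hq0 hqε hq hx hx' hi
        hi3).trans ih
      have e : 224 * K * N ^ 2 * CD * A * C * q ^ α * (4 - (2 * (m + 1 : ℕ) + 4) / 2 ^ (m + 1))
          = 224 * K * N ^ 2 * CD * A * C * q ^ α * ((m + 1) / 2 ^ m)
            + 224 * K * N ^ 2 * CD * A * C * q ^ α * (4 - (2 * m + 4) / 2 ^ m) := by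
        rw [← mul_add]
        congr 1
        push_cast
        field_simp
        ring
      rw [e]
      exact h
  refine (key m).mono (norm_nonneg _) (norm_nonneg _) ?_
  have h1 : 4 - (2 * m + 4) / 2 ^ m ≤ (4 : ℝ) := by
    have : (0 : ℝ) ≤ (2 * m + 4) / 2 ^ m := by positivity
    linarith
  calc _ ≤ 224 * K * N ^ 2 * CD * A * C * q ^ α * 4 := by gcongr
    _ = _ := by ring

/-- The distortion of the limit map: the flatness numbers add up over the scales that exceed the
distance of the two points, up to the stage `i`, and only the largest one enters from there on. -/
theorem exists_logClose_limitMap [CompleteSpace X] (hN : (26 : ℝ) ^ k ≤ N) (h0 : (0 : X) ∈ S)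
    (hA : 8 * K ^ 2 * (CB + 16 * K ^ 2 + 4 * CD) + 20 * K ^ 3 ≤ A) (hx : x ∈ F.basePlane)
    (hx' : x' ∈ F.basePlane) (hne : x ≠ x') :
    ∃ i : ℕ, (i = 0 ∨ ‖x - x'‖ ≤ (2 / 3) ^ i) ∧ ∀ α C T q : ℝ, 1 ≤ α → α ≤ 2 → 0 ≤ C →
      (∀ x r, IsAdmissibleBall S x r → AlmostOrthogonal α C (F.P x r)) → 0 ≤ q → q ≤ 2 * ε →
      (∀ j, ∀ p ∈ S, ‖p‖ ≤ 3 / 2 → F.stageFlatness j p ≤ q) →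
      (∀ p ∈ S, ‖p‖ ≤ 3 / 2 → ∑ j ∈ Finset.range i, F.stageFlatness j p ^ α ≤ T) →
      LogClose (56 * K * N ^ 2 * CE ^ 2 * C * T + 896 * K * N ^ 2 * CD * A * C * q ^ α)
        ‖F.limitMap x - F.limitMap x'‖ ‖x - x'‖ := by
  obtain ⟨i, hlt, hi, hi3, hd⟩ := F.exists_exit_stage c hN h0 hx hx' hne
  refine ⟨i, hd, fun α C T q hα hα2 hC hAO hq0 hqε hq hT => ?_⟩
  have h1 := F.logClose_iter_of_le c hN h0 hα hα2 hC hAO hx hx' hlt hT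
  refine LogClose.of_tendsto
    ((F.tendsto_iter c hN h0 hx).sub (F.tendsto_iter c hN h0 hx')).norm ?_
  filter_upwards [eventually_ge_atTop i] with n hn
  obtain ⟨m, rfl⟩ := Nat.exists_eq_add_of_le hn
  have h2 := F.logClose_iter_of_lt c hN h0 hα hα2 hC hAO hA m hq0 hqε (fun j _ => hq j) hx hx' hi
    hi3
  rw [add_comm]
  exact h2.trans h1

end FlatSystem

/-! ### Bi-Hölder bounds -/

/-- A distortion that grows linearly with the number of scales between `d` and `1` is a Hölder
distortion. -/
theorem holder_bounds_of_logClose {Λ δ γ d e : ℝ} (hδ : 0 ≤ δ) (hΛ : 0 ≤ Λ) (hγ : 0 < γ)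
    (hγ1 : γ < 1) (hd : 0 < d) (hΛδ : Λ * δ ≤ (1 - γ) / 3) {i : ℕ}
    (hi : i = 0 ∨ d ≤ (2 / 3) ^ i) (h : LogClose (Λ * δ * (i + 1)) e d) :
    (1 - 2 * Λ * δ) * min d (d ^ (1 / γ)) ≤ e ∧ e ≤ (1 + 2 * Λ * δ) * max d (d ^ γ) := by
  have ht : 0 ≤ Λ * δ := by positivity
  have h1 : Real.exp (Λ * δ) ≤ 1 + 2 * Λ * δ := by
    have := Real.abs_exp_sub_one_le (x := Λ * δ) (by rw [abs_of_nonneg ht]; linarith)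
    rw [abs_of_nonneg ht] at this
    linarith [le_abs_self (Real.exp (Λ * δ) - 1)]
  have h2 : 1 - 2 * Λ * δ ≤ Real.exp (-(Λ * δ)) := by
    linarith [Real.add_one_le_exp (-(Λ * δ))]
  have hγ' : 1 - γ ≤ 1 / γ - 1 := by
    have : 1 / γ - 1 - (1 - γ) = (1 - γ) ^ 2 / γ := by field_simp
    have : 0 ≤ (1 - γ) ^ 2 / γ := by positivity
    linarith
  have hsplit : Real.exp (Λ * δ * (i + 1)) = Real.exp (Λ * δ) * Real.exp (Λ * δ * i) := by
    rw [← Real.exp_add]; ring_nf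
  -- The factor gained from `i` scales is absorbed by the change of the exponent.
  have key : (Real.exp (Λ * δ * i) * d ≤ max d (d ^ γ)) ∧
      (min d (d ^ (1 / γ)) ≤ Real.exp (-(Λ * δ * i)) * d) := by
    rcases hi with rfl | hi
    · simp
    have hlog : Real.log d ≤ -(i / 3) := by
      have h3 := Real.log_le_log hd hi
      rw [Real.log_pow] at h3
      have h4 := Real.log_le_sub_one_of_pos (x := (2 / 3 : ℝ)) (by norm_num)
      have : (0 : ℝ) ≤ i := Nat.cast_nonneg i
      nlinarith
    have hi0 : (0 : ℝ) ≤ i := Nat.cast_nonneg i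
    have h5 : Λ * δ * i ≤ (1 - γ) * (i / 3) := by
      have := mul_le_mul_of_nonneg_right hΛδ hi0
      linarith
    have hd' : d = Real.exp (Real.log d) := (Real.exp_log hd).symm
    constructor
    · refine le_trans ?_ (le_max_right _ _)
      rw [Real.rpow_def_of_pos hd]
      nth_rewrite 1 [hd']
      rw [← Real.exp_add, Real.exp_le_exp]
      nlinarith
    · refine (min_le_right _ _).trans ?_
      rw [Real.rpow_def_of_pos hd]
      nth_rewrite 2 [hd']
      rw [← Real.exp_add, Real.exp_le_exp]
      have h6 : (1 - γ) * (i / 3) ≤ (1 / γ - 1) * (i / 3) := by gcongr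
      nlinarith
  constructor
  · have h3 : Real.exp (-(Λ * δ * (i + 1))) * d ≤ e := by
      rw [Real.exp_neg, inv_mul_le_iff₀ (Real.exp_pos _)]
      exact h.2
    refine le_trans ?_ h3
    rw [Real.exp_neg, hsplit, mul_inv, ← Real.exp_neg, ← Real.exp_neg, mul_assoc (Real.exp _)]
    refine mul_le_mul h2 key.2 (le_min hd.le (Real.rpow_nonneg hd.le _)) (Real.exp_nonneg _)
  · refine h.1.trans ?_
    rw [hsplit, mul_assoc (Real.exp _)]
    exact mul_le_mul h1 key.1 (by positivity) (by linarith)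

namespace FlatSystem

variable {k : ℕ} {K ε : ℝ} {S : Set X} (F : FlatSystem k K ε S)
  {N CA CB CD CE A : ℝ} (c : StepConstants K N CA CB CD CE ε)

theorem stageFlatness_le_of_flatness_le {b : ℝ}
    (hb : ∀ x r, IsAdmissibleBall S x r → F.flatness x r ≤ b) (h0 : (0 : X) ∈ S) {p : X}
    (hp : p ∈ S) (hp2 : ‖p‖ ≤ 3 / 2) (j : ℕ) : F.stageFlatness j p ≤ 2 * b := by
  have h1 := hb _ _ (isAdmissibleBall_mul_dyadicScale (i := j) hp (by linarith) (m := 100)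
    (by norm_num) le_rfl)
  have h2 := hb _ _ (isAdmissibleBall_base h0)
  have h3 := F.flatness_nonneg 0 (19 / 10)
  unfold stageFlatness
  split_ifs <;> linarith

include F c

/-- The Hölder estimate uses the exponent `1` only, for which every projection is almost orthogonal
with constant `1`; hence `Λ` depends on the dimension but not on the space. -/
theorem limitMap_holder [CompleteSpace X] (hN : (26 : ℝ) ^ k ≤ N) (h0 : (0 : X) ∈ S)
    (hA : 8 * K ^ 2 * (CB + 16 * K ^ 2 + 4 * CD) + 20 * K ^ 3 ≤ A) {M Λ δ γ : ℝ}
    (hΛ : 2 * M * (56 * K * N ^ 2 * CE ^ 2 + 896 * K * N ^ 2 * CD * A) ≤ Λ) (hM : 0 ≤ M)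
    (hδ : 0 ≤ δ) (hflat : ∀ x r, IsAdmissibleBall S x r → F.flatness x r ≤ M * δ)
    (hMε : M * δ ≤ ε) (hγ : 0 < γ) (hγ1 : γ < 1) (hΛδ : Λ * δ ≤ (1 - γ) / 3) {x x' : X}
    (hx : x ∈ F.basePlane) (hx' : x' ∈ F.basePlane) :
    (1 - 2 * Λ * δ) * min ‖x - x'‖ (‖x - x'‖ ^ (1 / γ)) ≤ ‖F.limitMap x - F.limitMap x'‖ ∧
      ‖F.limitMap x - F.limitMap x'‖ ≤ (1 + 2 * Λ * δ) * max ‖x - x'‖ (‖x - x'‖ ^ γ) := by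
  have hK := c.K_pos
  have hCB := c.CB_ge
  have hCD := c.CA_ge.trans c.CA_le
  have hCE := c.CE_ge
  have hA0 : 0 ≤ A := le_trans (by positivity) hA
  have hΛ0 : 0 ≤ Λ := le_trans (by positivity) hΛ
  rcases eq_or_ne x x' with rfl | hne
  · simp [Real.zero_rpow hγ.ne', Real.zero_rpow (inv_pos.2 hγ).ne']
  obtain ⟨i, hi, h⟩ := F.exists_logClose_limitMap c hN h0 hA hx hx' hne
  have hst := fun j p hp hp2 => F.stageFlatness_le_of_flatness_le hflat h0 (p := p) hp hp2 j
  have h1 := h 1 1 (i * (2 * (M * δ))) (2 * (M * δ)) le_rfl one_le_two zero_le_one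
    (fun _ _ _ => almostOrthogonal_one le_rfl _) (by positivity) (by linarith) hst
    fun p hp hp2 => by
      calc ∑ j ∈ Finset.range i, F.stageFlatness j p ^ (1 : ℝ)
          ≤ ∑ j ∈ Finset.range i, 2 * (M * δ) := Finset.sum_le_sum fun j _ => by
            rw [Real.rpow_one]
            exact hst j p hp hp2
        _ = _ := by simp
  refine holder_bounds_of_logClose hδ hΛ0 hγ hγ1 (norm_pos_iff.2 (sub_ne_zero.2 hne)) hΛδ hi
    (h1.mono (norm_nonneg _) (norm_nonneg _) ?_)
  rw [Real.rpow_one]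
  have h2 : 2 * M * (56 * K * N ^ 2 * CE ^ 2 + 896 * K * N ^ 2 * CD * A) * (δ * (i + 1))
      ≤ Λ * (δ * (i + 1)) := by gcongr
  have h3 : 0 ≤ 2 * M * (56 * K * N ^ 2 * CE ^ 2) * δ := by positivity
  have h4 : 0 ≤ 2 * M * (896 * K * N ^ 2 * CD * A) * (δ * i) := by positivity
  linarith

end FlatSystem

/-! ### Bi-Lipschitz bounds -/

/-- A flatness number at scale `r` that is controlled by the beta numbers at the scales between `r`
and `20 / 19 * r` is controlled by their integral. The factor `20 / 19` leaves room for the scale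
`19 / 10` below `2`. -/
theorem ofReal_rpow_div_le_lintegral {f r α : ℝ} (hf : 0 ≤ f) (hr : 0 < r) (hα : 0 ≤ α)
    {g : ℝ → ℝ≥0∞} (h : ∀ s ∈ Ioo r (20 / 19 * r), ENNReal.ofReal f ≤ g s) :
    ENNReal.ofReal (f ^ α / 20) ≤ ∫⁻ s in Ioo r (20 / 19 * r), g s ^ α / ENNReal.ofReal s := by
  have h1 : ∀ s ∈ Ioo r (20 / 19 * r), ENNReal.ofReal (f ^ α / (20 / 19 * r))
      ≤ g s ^ α / ENNReal.ofReal s := by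
    intro s hs
    rw [ENNReal.ofReal_div_of_pos (by positivity), ← ENNReal.ofReal_rpow_of_nonneg hf hα]
    gcongr
    · exact h s hs
    · exact hs.2.le
  calc ENNReal.ofReal (f ^ α / 20)
      = ∫⁻ _ in Ioo r (20 / 19 * r), ENNReal.ofReal (f ^ α / (20 / 19 * r)) := by
        rw [setLIntegral_const, Real.volume_Ioo, ← ENNReal.ofReal_mul (by positivity)]
        congr 1
        field_simp
        norm_num
    _ ≤ _ := setLIntegral_mono' measurableSet_Ioo h1

/-- A number that bounds the distance to any plane approximating `S` at scale `r`, is bounded by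
the beta numbers at comparable scales. -/
theorem ofReal_le_betaInfty {k : ℕ} {S : Set X} {x : X} {r s f M : ℝ} (hM : 0 < M)
    (hf : ∀ b : ℝ, 0 ≤ b → ∀ V : Submodule ℝ X, IsLinearPlane k V →
        (∀ s ∈ S, ‖s - x‖ < r → ∃ v ∈ V, ‖s - x - v‖ ≤ b * r) → f ≤ M * b)
    (hrs : r ≤ s) (hs : s ≤ 20 / 19 * r) :
    ENNReal.ofReal (f / (20 / 19 * M)) ≤ betaInfty k S x s := by
  unfold betaInfty
  refine le_iInf fun V => le_iInf fun hV => le_iInf fun b => le_iInf fun hb => ?_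
  rw [← ENNReal.ofReal_coe_nnreal]
  refine ENNReal.ofReal_le_ofReal ((div_le_iff₀ (by positivity)).2 ?_)
  have h := hf (20 / 19 * b) (by positivity) V hV fun z hz hzr => by
    obtain ⟨w, hw, hwz⟩ := Metric.mem_thickening_iff.1
      (hb ⟨hz, by rw [Metric.mem_ball, dist_eq_norm]; linarith⟩)
    refine ⟨w - x, hw, ?_⟩
    rw [sub_sub_sub_cancel_right, ← dist_eq_norm]
    refine hwz.le.trans ?_
    calc (b : ℝ) * s ≤ b * (20 / 19 * r) := by gcongr
      _ = _ := by ring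
  linarith

theorem rpow_mul_le_sq_mul {M q α : ℝ} (hM : 1 ≤ M) (hq : 0 ≤ q) (hα2 : α ≤ 2) :
    (M * q) ^ α ≤ M ^ 2 * q ^ α := by
  rw [Real.mul_rpow (by linarith) hq]
  gcongr
  calc M ^ α ≤ M ^ (2 : ℝ) := Real.rpow_le_rpow_of_exponent_le hM hα2
    _ = M ^ 2 := Real.rpow_two M

/-- Summability of the flatness numbers over the scales, from the integral condition on the beta
numbers. The last term accounts for the initial plane. -/
theorem BetaSummable.flatness_bounds {k : ℕ} {S : Set X} {α Q M : ℝ} (h : BetaSummable k S α Q)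
    (hα : 1 ≤ α) (hα2 : α ≤ 2) (hQ : 0 ≤ Q) (hM : 1 ≤ M) {x : X} (hx : x ∈ S) {f : ℝ → ℝ}
    (hf0 : ∀ r, 0 ≤ f r)
    (hf : ∀ r, 0 < r → r ≤ 19 / 10 → ∀ b : ℝ, 0 ≤ b → ∀ V : Submodule ℝ X, IsLinearPlane k V →
        (∀ s ∈ S, ‖s - x‖ < r → ∃ v ∈ V, ‖s - x - v‖ ≤ b * r) → f r ≤ M * b) :
    (∀ r, 0 < r → r ≤ 19 / 10 → f r ^ α ≤ 80 * M ^ 2 * Q ^ α ∧ f r ≤ 40 * M * Q) ∧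
      ∀ n, ∑ j ∈ Finset.range n, f (100 * dyadicScale j) ^ α ≤ 80 * M ^ 2 * Q ^ α := by
  set M' := 20 / 19 * M with hM'
  have hM'1 : 1 ≤ M' := by linarith
  have hQα : 0 ≤ Q ^ α := Real.rpow_nonneg hQ α
  have hint : ∀ r, 0 < r → r ≤ 19 / 10 → ENNReal.ofReal ((f r / M') ^ α / 20)
      ≤ ∫⁻ s in Ioo r (20 / 19 * r), betaInfty k S x s ^ α / ENNReal.ofReal s := by
    intro r hr hr2
    refine ofReal_rpow_div_le_lintegral (by have := hf0 r; positivity) hr (by linarith)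
      fun s hs => ?_
    exact ofReal_le_betaInfty (by linarith) (hf r hr hr2) hs.1.le hs.2.le
  have hsum : ∀ n, ∑ j ∈ Finset.range n, (f (100 * dyadicScale j) / M') ^ α / 20 ≤ Q ^ α := by
    intro n
    have hnn : ∀ j, 0 ≤ (f (100 * dyadicScale j) / M') ^ α / 20 := fun j => by
      have := hf0 (100 * dyadicScale j)
      positivity
    rw [← ENNReal.ofReal_le_ofReal_iff hQα, ENNReal.ofReal_sum_of_nonneg fun j _ => hnn j]
    have hdisj : Pairwise (Function.onFun Disjoint fun j =>
        Ioo (100 * dyadicScale j) (20 / 19 * (100 * dyadicScale j))) := by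
      refine (pairwise_disjoint_on _).2 fun i j hij => Set.disjoint_left.2 fun s hs hs' => ?_
      obtain ⟨m, rfl⟩ := Nat.exists_eq_add_of_lt hij
      have h1 : dyadicScale (i + m + 1) ≤ dyadicScale i / 2 := by
        rw [dyadicScale_succ, dyadicScale_add]
        have := dyadicScale_pos i
        gcongr
        exact div_le_self this.le (one_le_pow₀ (by norm_num))
      linarith [hs.1, hs'.2, dyadicScale_pos i]
    calc ∑ j ∈ Finset.range n, ENNReal.ofReal ((f (100 * dyadicScale j) / M') ^ α / 20)
        ≤ ∑ j ∈ Finset.range n, ∫⁻ s in Ioo (100 * dyadicScale j)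
            (20 / 19 * (100 * dyadicScale j)), betaInfty k S x s ^ α / ENNReal.ofReal s := by
          refine Finset.sum_le_sum fun j _ => hint _ ?_ ?_
          · linarith [dyadicScale_pos j]
          · linarith [dyadicScale_le j]
      _ = ∫⁻ s in ⋃ j ∈ Finset.range n, Ioo (100 * dyadicScale j)
            (20 / 19 * (100 * dyadicScale j)), betaInfty k S x s ^ α / ENNReal.ofReal s :=
          (lintegral_biUnion_finset (hdisj.set_pairwise _) (fun _ _ => measurableSet_Ioo) _).symm
      _ ≤ ∫⁻ s in Ioo (0 : ℝ) 2, betaInfty k S x s ^ α / ENNReal.ofReal s := by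
          refine lintegral_mono_set (iUnion₂_subset fun j _ s hs => ⟨?_, ?_⟩)
          · linarith [dyadicScale_pos j, hs.1]
          · linarith [dyadicScale_le j, hs.2]
      _ ≤ _ := h x hx
  have hone : ∀ r, 0 < r → r ≤ 19 / 10 → (f r / M') ^ α / 20 ≤ Q ^ α := by
    intro r hr hr2
    rw [← ENNReal.ofReal_le_ofReal_iff hQα]
    have hsub : Ioo r (20 / 19 * r) ⊆ Ioo 0 2 := Ioo_subset_Ioo hr.le (by linarith)
    exact ((hint r hr hr2).trans (lintegral_mono_set hsub)).trans (h x hx)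
  have hback : ∀ r, f r ^ α ≤ M' ^ 2 * (f r / M') ^ α := by
    intro r
    have := rpow_mul_le_sq_mul hM'1 (q := f r / M') (by have := hf0 r; positivity) hα2
    rwa [mul_div_cancel₀ _ (by positivity)] at this
  have hM2 : 20 * M' ^ 2 ≤ 80 * M ^ 2 := by
    rw [hM']
    nlinarith [sq_nonneg M]
  refine ⟨fun r hr hr2 => ⟨?_, ?_⟩, fun n => ?_⟩
  · calc f r ^ α ≤ M' ^ 2 * (f r / M') ^ α := hback r
      _ ≤ M' ^ 2 * (20 * Q ^ α) := by gcongr; linarith [hone r hr hr2]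
      _ = 20 * M' ^ 2 * Q ^ α := by ring
      _ ≤ _ := by gcongr
  · have h1 : (f r / M') ^ α ≤ (20 * Q) ^ α := by
      rw [Real.mul_rpow (by norm_num) hQ]
      have h2 : (20 : ℝ) ^ (1 : ℝ) ≤ 20 ^ α := Real.rpow_le_rpow_of_exponent_le (by norm_num) hα
      rw [Real.rpow_one] at h2
      have h3 := mul_le_mul_of_nonneg_right h2 hQα
      linarith [hone r hr hr2]
    have h2 := (Real.rpow_le_rpow_iff (by have := hf0 r; positivity) (by positivity)
      (by linarith)).1 h1
    rw [div_le_iff₀ (by positivity)] at h2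
    have h3 : 0 ≤ M * Q := by positivity
    rw [hM'] at h2
    linarith
  · calc ∑ j ∈ Finset.range n, f (100 * dyadicScale j) ^ α
        ≤ ∑ j ∈ Finset.range n, 20 * M' ^ 2 * ((f (100 * dyadicScale j) / M') ^ α / 20) :=
          Finset.sum_le_sum fun j _ => (hback _).trans_eq (by ring)
      _ = 20 * M' ^ 2 * ∑ j ∈ Finset.range n, (f (100 * dyadicScale j) / M') ^ α / 20 := by
          rw [Finset.mul_sum]
      _ ≤ 80 * M ^ 2 * Q ^ α := by
          refine mul_le_mul hM2 (hsum n) (Finset.sum_nonneg fun j _ => ?_) (by positivity)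
          have := hf0 (100 * dyadicScale j)
          positivity

namespace FlatSystem

variable {k : ℕ} {K ε : ℝ} {S : Set X} (F : FlatSystem k K ε S)

theorem sum_stageFlatness_rpow_le {α : ℝ} (hα : 1 ≤ α) (hα2 : α ≤ 2) (p : X) (n : ℕ) :
    ∑ j ∈ Finset.range n, F.stageFlatness j p ^ α
      ≤ 4 * ∑ j ∈ Finset.range n, F.flatness p (100 * dyadicScale j) ^ α
        + 4 * F.flatness 0 (19 / 10) ^ α := by
  have hb := F.flatness_nonneg 0 (19 / 10)
  have hnn : ∀ j, 0 ≤ F.flatness p (100 * dyadicScale j) ^ α := fun j =>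
    Real.rpow_nonneg (F.flatness_nonneg _ _) _
  have hadd : ∀ a : ℝ, 0 ≤ a → (a + F.flatness 0 (19 / 10)) ^ α
      ≤ 4 * a ^ α + 4 * F.flatness 0 (19 / 10) ^ α := by
    intro a ha
    have h1 : ∀ m : ℝ, 0 ≤ m → (2 * m) ^ α ≤ 4 * m ^ α := fun m hm =>
      (rpow_mul_le_sq_mul one_le_two hm hα2).trans_eq (by norm_num)
    have h2 := Real.rpow_nonneg ha α
    have h3 := Real.rpow_nonneg hb α
    rcases le_total a (F.flatness 0 (19 / 10)) with h | h
    · have := Real.rpow_le_rpow (by linarith : 0 ≤ a + F.flatness 0 (19 / 10))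
        (by linarith : _ ≤ 2 * F.flatness 0 (19 / 10)) (by linarith : 0 ≤ α)
      linarith [h1 _ hb]
    · have := Real.rpow_le_rpow (by linarith : 0 ≤ a + F.flatness 0 (19 / 10))
        (by linarith : _ ≤ 2 * a) (by linarith : 0 ≤ α)
      linarith [h1 _ ha]
  induction n with
  | zero =>
    simp only [Finset.range_zero, Finset.sum_empty]
    have := Real.rpow_nonneg hb α
    linarith
  | succ n ih =>
    rw [Finset.sum_range_succ, Finset.sum_range_succ]
    rcases n with _ | n
    · simpa [stageFlatness] using hadd _ (F.flatness_nonneg p (100 * dyadicScale 0))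
    · have h1 : F.stageFlatness (n + 1) p = F.flatness p (100 * dyadicScale (n + 1)) := by
        simp [stageFlatness]
      rw [h1]
      linarith [hnn (n + 1)]

/-- The initial plane enters only at stage `0`, with the flatness of the ball of radius `19 / 10`, so
the Lipschitz constant is governed by the integral condition alone. -/
theorem limitMap_lipschitz [CompleteSpace X] {N CA CB CD CE A : ℝ}
    (c : StepConstants K N CA CB CD CE ε) (hN : (26 : ℝ) ^ k ≤ N) (h0 : (0 : X) ∈ S)
    (hA : 8 * K ^ 2 * (CB + 16 * K ^ 2 + 4 * CD) + 20 * K ^ 3 ≤ A) {M α C Q : ℝ} (hM : 1 ≤ M)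
    (hopt : ∀ x r, IsAdmissibleBall S x r → ∀ b : ℝ, 0 ≤ b → ∀ V : Submodule ℝ X,
      IsLinearPlane k V → (∀ s ∈ S, ‖s - x‖ < r → ∃ v ∈ V, ‖s - x - v‖ ≤ b * r) →
        F.flatness x r ≤ M * b)
    (hα : 1 ≤ α) (hα2 : α ≤ 2) (hC : 0 ≤ C)
    (hAO : ∀ x r, IsAdmissibleBall S x r → AlmostOrthogonal α C (F.P x r)) (hQ : 0 ≤ Q)
    (hβ : BetaSummable k S α Q) {x x' : X} (hx : x ∈ F.basePlane) (hx' : x' ∈ F.basePlane) :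
    LogClose (C * (640 * M ^ 2 * (56 * K * N ^ 2 * CE ^ 2)
      + 6400 * M ^ 2 * (896 * K * N ^ 2 * CD * A)) * Q ^ α)
      ‖F.limitMap x - F.limitMap x'‖ ‖x - x'‖ := by
  have hK := c.K_pos
  have hCB := c.CB_ge
  have hCD := c.CA_ge.trans c.CA_le
  have hCE := c.CE_ge
  have hε := c.ε_nonneg
  have hA0 : 0 ≤ A := le_trans (by positivity) hA
  have hQα : 0 ≤ Q ^ α := Real.rpow_nonneg hQ α
  rcases eq_or_ne x x' with rfl | hne
  · simp [LogClose]
  have hbd : ∀ p ∈ S, ‖p‖ ≤ 3 / 2 → _ := fun p hp hp2 =>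
    hβ.flatness_bounds hα hα2 hQ hM hp (f := F.flatness p) (F.flatness_nonneg p)
      fun r hr hr2 => hopt p r ⟨hp, by linarith, hr, by linarith⟩
  have hbase := (hbd 0 h0 (by rw [norm_zero]; norm_num)).1 (19 / 10) (by norm_num) le_rfl
  obtain ⟨i, -, h⟩ := F.exists_logClose_limitMap c hN h0 hA hx hx' hne
  have h1 := h α C (640 * M ^ 2 * Q ^ α) (min (80 * M * Q) (2 * ε)) hα hα2 hC hAO (by positivity)
    (min_le_right _ _) (fun j p hp hp2 => le_min ?_
      (F.stageFlatness_le h0 hε hp (by linarith))) fun p hp hp2 => ?_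
  · refine h1.mono (norm_nonneg _) (norm_nonneg _) ?_
    have h2 : min (80 * M * Q) (2 * ε) ^ α ≤ 6400 * M ^ 2 * Q ^ α := by
      refine (Real.rpow_le_rpow (by positivity) (min_le_left _ _) (by linarith)).trans ?_
      refine (rpow_mul_le_sq_mul (by linarith) hQ hα2).trans_eq ?_
      ring
    calc _ ≤ 56 * K * N ^ 2 * CE ^ 2 * C * (640 * M ^ 2 * Q ^ α)
          + 896 * K * N ^ 2 * CD * A * C * (6400 * M ^ 2 * Q ^ α) := by gcongr
      _ = _ := by ring
  · have h2 := ((hbd p hp hp2).1 (100 * dyadicScale j) (by linarith [dyadicScale_pos j])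
      (by linarith [dyadicScale_le j])).2
    have h3 := hbase.2
    have h4 : 0 ≤ M * Q := by positivity
    unfold stageFlatness
    split_ifs <;> linarith
  · have h2 := F.sum_stageFlatness_rpow_le hα hα2 p i
    have h3 := (hbd p hp hp2).2 i
    linarith [hbase.1]

end FlatSystem

/-! ### The parametrisation theorem -/

theorem exists_stepConstants {K N : ℝ} (hK : 1 ≤ K) (hN : 1 ≤ N) :
    ∃ CA CB CD CE ε : ℝ, 0 < ε ∧ StepConstants K N CA CB CD CE ε := by
  set CA := 160000 * K ^ 2 with hCAdef
  set CB := 800 * K ^ 2 * N ^ 2 with hCB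
  set CD := 2 * K * (100 + CA) + 120 * K ^ 3 with hCD
  set CE := 2 * K * CB + 20 * K ^ 3 + (1 + 2 * N) * CD with hCE
  have hCBpos : 0 < CB := by positivity
  have hCEpos : 0 < CE := by positivity
  have hCApos : 0 < CA := by positivity
  exact ⟨CA, CB, CD, CE, 1 / (1000 * K ^ 2 * N * CE), by positivity, hK, hN, le_rfl, le_rfl, le_rfl,
    le_rfl, by positivity, (mul_one_div_cancel (by positivity)).le⟩

theorem IsCriticalExponent.one_le_and_le_two
    {k : ℕ} {α : ℝ} (h : IsCriticalExponent X k α) : 1 ≤ α ∧ α ≤ 2 := by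
  rcases h with rfl | ⟨-, rfl⟩ | ⟨-, -, h1, h2, -⟩
  · norm_num
  · norm_num
  · exact ⟨h1, h2⟩

end

theorem mainTheorem5 (k : ℕ) :
    ∃ c : ℝ, 0 < c ∧ ∀ ρ : ℝ → ℝ, ∃ C : ℝ → ℝ, (∀ α, 0 < C α) ∧
    ∀ γ : ℝ, 0 < γ → γ < 1 → ∃ δ₁ : ℝ, 0 < δ₁ ∧ c * δ₁ < 1 ∧
    ∀ (X : Type*) [NormedAddCommGroup X] [NormedSpace ℝ X] [CompleteSpace X],
    (∀ t : ℝ, 0 ≤ t → modulusOfSmoothness X t = ρ t) →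
    ∀ (S : Set X) (δ : ℝ), IsClosed S → (0 : X) ∈ S → 0 ≤ δ → δ ≤ δ₁ →
    IsReifenbergFlat k δ S 0 →
    ∃ (V : Submodule ℝ X) (φ : V → X),
      IsLinearPlane k V ∧
      (∀ x : V, (x : X) ∉ Metric.ball (0 : X) (3 / 2) → φ x = x) ∧
      S ∩ Metric.ball 0 1 = range φ ∩ Metric.ball 0 1 ∧
      (∀ x y : V,
        (1 - c * δ) * min ‖x - y‖ (‖x - y‖ ^ (1 / γ)) ≤ ‖φ x - φ y‖ ∧
        ‖φ x - φ y‖ ≤ (1 + c * δ) * max ‖x - y‖ (‖x - y‖ ^ γ)) ∧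
      ∀ α Q : ℝ, IsCriticalExponent X k α → 0 ≤ Q → BetaSummable k S α Q →
        ∀ x y : V,
          Real.exp (-(C α * Q ^ α)) * ‖x - y‖ ≤ ‖φ x - φ y‖ ∧
          ‖φ x - φ y‖ ≤ Real.exp (C α * Q ^ α) * ‖x - y‖ := by
  have hk0 : (0 : ℝ) ≤ k := Nat.cast_nonneg k
  obtain ⟨K, hKdef⟩ : ∃ K : ℝ, K = 8 * k + 1 := ⟨_, rfl⟩
  obtain ⟨N, hN⟩ : ∃ N : ℝ, N = (26 : ℝ) ^ k := ⟨_, rfl⟩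
  have hK : 1 ≤ K := by linarith
  have hN1 : 1 ≤ N := hN ▸ one_le_pow₀ (by norm_num)
  obtain ⟨CA, CB, CD, CE, ε, hε, c⟩ := exists_stepConstants hK hN1
  have hCB := c.CB_ge
  have hCD := c.CA_ge.trans c.CA_le
  have hCE := c.CE_ge
  obtain ⟨A, hA⟩ : ∃ A : ℝ, A = 8 * K ^ 2 * (CB + 16 * K ^ 2 + 4 * CD) + 20 * K ^ 3 := ⟨_, rfl⟩
  have hA0 : 0 < A := by rw [hA]; positivity
  obtain ⟨M, hMdef⟩ : ∃ M : ℝ, M = 10 * K ^ 3 := ⟨_, rfl⟩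
  have hK3 : 1 ≤ K ^ 3 := one_le_pow₀ hK
  have hM : 1 ≤ M := by linarith
  obtain ⟨Λ, hΛ⟩ : ∃ Λ : ℝ,
    Λ = 2 * M * (56 * K * N ^ 2 * CE ^ 2 + 896 * K * N ^ 2 * CD * A) := ⟨_, rfl⟩
  have hΛ0 : 0 < Λ := by rw [hΛ]; positivity
  refine ⟨2 * Λ, by positivity, fun ρ => ?_⟩
  obtain ⟨C, hC, hproj⟩ := exists_orthogonality_constant ρ
  refine ⟨fun α => C α * (640 * M ^ 2 * (56 * K * N ^ 2 * CE ^ 2)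
      + 6400 * M ^ 2 * (896 * K * N ^ 2 * CD * A)), fun α => by have := hC α; positivity,
    fun γ hγ hγ1 => ?_⟩
  have hη : 0 < ε / M := by positivity
  -- The construction allows planes with error up to `ε / M`; half of it leaves room for the infimum
  -- over planes, which need not be attained.
  refine ⟨min (ε / M / 2) ((1 - γ) / (3 * Λ)), lt_min (by positivity)
    (div_pos (by linarith) (by positivity)), ?_, ?_⟩
  · calc 2 * Λ * min (ε / M / 2) ((1 - γ) / (3 * Λ)) ≤ 2 * Λ * ((1 - γ) / (3 * Λ)) := by
          gcongr
          exact min_le_right _ _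
      _ = 2 / 3 * (1 - γ) := by field_simp
      _ < 1 := by linarith
  intro X _ _ _ hρ S δ hS h0 hδ hδ1 hflat
  have hδη : δ < ε / M := by linarith [hδ1.trans (min_le_left _ _)]
  have hΛδ : Λ * δ ≤ (1 - γ) / 3 := by
    have h1 := hδ1.trans (min_le_right _ _)
    rw [le_div_iff₀ (by positivity)] at h1
    linarith
  have hKη : K * (ε / M) ≤ 1 / 16 := by
    have h1 := c.small_ε
    have h2 : ε / M ≤ ε := div_le_self hε.le hM
    have h3 : K * (ε / M) ≤ K * ε := by gcongr
    have h4 : 0 ≤ K * ε := by positivity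
    linarith
  have hMη : 10 * K ^ 3 * (ε / M) ≤ ε := by
    rw [← hMdef]
    exact (mul_div_cancel₀ _ (by linarith)).le
  obtain ⟨F, hF, hopt⟩ := hflat.exists_flatSystem hδ hδη hKdef hKη hMη _ (hproj X hρ k)
  rw [← hMdef] at hopt
  have hbound : ∀ x r, IsAdmissibleBall S x r → F.flatness x r ≤ M * δ := by
    intro x r hx
    refine le_of_forall_gt_imp_ge_of_dense fun b hb => ?_
    have hδb : δ < b / M := by rw [lt_div_iff₀ (by positivity)]; linarith
    obtain ⟨V, hV, hV1, -⟩ := hflat.exists_plane hδ hδb hx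
    have h1 := hopt x r hx (b / M) (hδ.trans hδb.le) V hV hV1
    rwa [mul_div_cancel₀ _ (by positivity)] at h1
  have hMε : M * δ ≤ ε := by
    rw [lt_div_iff₀ (by positivity)] at hδη
    linarith
  have hhol : ∀ x y : F.basePlane, _ := fun x y => F.limitMap_holder c hN.ge h0 hA.ge hΛ.ge
    (by linarith) hδ hbound hMε hγ hγ1 hΛδ x.2 y.2
  have hcont : Continuous fun x : F.basePlane => F.limitMap x := by
    refine continuous_iff_continuousAt.2 fun x => ?_
    change Tendsto _ _ _
    rw [tendsto_iff_norm_sub_tendsto_zero]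
    have h1 : Tendsto (fun y : F.basePlane => ‖(y : X) - x‖) (𝓝 x) (𝓝 0) := by
      have h2 : Continuous fun y : F.basePlane => ‖(y : X) - x‖ := by fun_prop
      simpa using h2.tendsto x
    have h3 : Tendsto (fun y : F.basePlane =>
        (1 + 2 * Λ * δ) * max ‖(y : X) - x‖ (‖(y : X) - x‖ ^ γ)) (𝓝 x) (𝓝 0) := by
      have h4 := (h1.max (h1.rpow_const (Or.inr hγ.le))).const_mul (1 + 2 * Λ * δ)
      simpa [Real.zero_rpow hγ.ne'] using h4
    exact squeeze_zero (fun _ => norm_nonneg _) (fun y => (hhol y x).2) h3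
  refine ⟨F.basePlane, fun x => F.limitMap x, F.dim (isAdmissibleBall_base h0), fun x hx => ?_, ?_,
    hhol, fun α Q hα hQ hβ x y => ?_⟩
  · refine F.limitMap_eq_self c hN.ge h0 x.2 ?_
    simpa using hx
  · ext p
    simp only [mem_inter_iff, mem_ball_zero_iff]
    constructor
    · rintro ⟨hp, hp1⟩
      obtain ⟨x, hx⟩ := F.exists_limitMap_eq c hN.ge h0 hcont hp hp1
      exact ⟨⟨x, hx⟩, hp1⟩
    · rintro ⟨⟨x, rfl⟩, hp1⟩
      exact ⟨F.limitMap_mem c hN.ge h0 hS x.2 hp1, hp1⟩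
  · obtain ⟨hα1, hα2⟩ := hα.one_le_and_le_two
    have h := F.limitMap_lipschitz c hN.ge h0 hA.ge hM hopt hα1 hα2 (hC α).le
      (fun x r hx => hF x r hx α hα) hQ hβ x.2 y.2
    refine ⟨?_, h.1⟩
    rw [Real.exp_neg, inv_mul_le_iff₀ (Real.exp_pos _)]
    exact h.2
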